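/- **Polycosymplectic reduction theorem.** All manifolds are smooth, finite-dimensional, Hausdorff and second countable. Let $k\ge 0$. A *$k$-polycosymplectic structure* on a manifold $M$ consists of closed two-forms $\omega^1,\dots,\omega^k$ and closed one-forms $\eta^1,\dots,\eta^k$ such that, at every point, (i) $\eta^1\wedge\dots\wedge\eta^k\neq 0$, (ii) $\bigcap_a\ker\omega^a\cap\bigcap_a\ker\eta^a=\{0\}$ and (iii) $\dim\bigcap_a\ker\omega^a=k$. Its Reeb vector fields $R_1,\dots,R_k$ are determined by $i_{R_a}\omega^b=0$ and $i_{R_a}\eta^b=\delta_a^b$; write $\mathcal R_x=\mathrm{span}\{R_1(x),\dots,R_k(x)\}$. For a subspace $S\subset T_xM$ put $S^{c\omega}=\{v\in T_xM:\ \omega^a(v,s)=0\text{ for all }s\in S\text{ and all }a\}$. Let $G$ be a connected Lie group with Lie algebra $\mathfrak g$, acting smoothly, freely and properly on (the left of) a manifold $M$ with a $k$-polycosymplectic structure $(\omega^a,\eta^a)$. For $\xi\in\mathfrak g$ let $\xi_M$ be its infinitesimal generator. Suppose that the action $\Phi$ is polycosymplectic, that is, $\Phi_g^*\omega^a=\omega^a$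 and $i_{\xi_M}\eta^a=0$ for all $a$, $g\in G$ and $\xi\in\mathfrak g$. Let $J=(J^1,\dots,J^k)\colon M\to(\mathfrak g^*)^k$ be a smooth momentum map, that is, $i_{\xi_M}\omega^a=d\langle J^a,\xi\rangle$ for all $a$ and $\xi$, and suppose that $J$ is equivariant: $J^a(gx)=\mathrm{Ad}^*_{g^{-1}}J^a(x)$. Let $\mu=(\mu_1,\dots,\mu_k)\in(\mathfrak g^*)^k$ be a regular value of $J$, let $G_\mu=\{g\in G:\ \mathrm{Ad}^*_{g^{-1}}\mu_a=\mu_a\text{ for all }a\}$ be its isotropy group, with Lie algebra $\mathfrak g_\mu$, and put $\tilde{\mathfrak g}_x=\{\xi_M(x):\xi\in\mathfrak g\}$ and $\tilde{\mathfrak g}_\mu|_x=\{\xi_M(x):\xi\in\mathfrak g_\mu\}$. Then $J^{-1}(\mu)$ is an embedded submanifold of $M$, with inclusion $j_\mu\colon J^{-1}(\mu)\to M$, and the quotient $M_\mu=J^{-1}(\mu)/G_\mu$ is a (Hausdorff, second countable) manifold for which the projection $\pi_\mu\colon J^{-1}(\mu)\to M_\mu$ is a submersion. Families of forms $(\omega^a_\mu,\eta^a_\mu)_{a=1}^k$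 on $M_\mu$ with $$\pi_\mu^*\omega^a_\mu=j_\mu^*\omega^a,\qquad \pi_\mu^*\eta^a_\mu=j_\mu^*\eta^a\qquad(a=1,\dots,k)$$ are uniquely determined by these relations, and $M_\mu$ carries a $k$-polycosymplectic structure $(\omega^a_\mu,\eta^a_\mu)$ satisfying them if and only if, for every $x\in J^{-1}(\mu)$, $$\mathcal R_x\oplus\tilde{\mathfrak g}_\mu|_x=\tilde{\mathfrak g}_x^{c\omega}\cap\tilde{\mathfrak g}_x^{c\omega\,c\omega}.$$ -/

import Mathlib

open Manifold
open scoped ContDiff Manifold Topology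

noncomputable section

/-! ### Linear algebra of families of forms -/

section Linear

variable {V : Type*} [AddCommGroup V] [Module ℝ V] [TopologicalSpace V] {k : ℕ}

/-- The wedge product `η¹ ∧ ⋯ ∧ ηᵏ` of `k` one-forms, that is, the alternating `k`-form
`(v₁, …, v_k) ↦ det (ηᵃ(v_b))`. -/
def wedgeOneForms (η : Fin k → V [⋀^Fin 1]→L[ℝ] ℝ) : V [⋀^Fin k]→ₗ[ℝ] ℝ :=
  (Matrix.detRowAlternating (n := Fin k) (R := ℝ)).compLinearMap
    { toFun := fun v a => η a ![v]
      map_add' := fun v w => by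
        funext a
        have h := (η a).map_update_add ![0] 0 v w
        simp only [Matrix.vecCons, Fin.update_cons_zero] at h
        exact h
      map_smul' := fun c v => by
        funext a
        have h := (η a).map_update_smul ![0] 0 c v
        simp only [Matrix.vecCons, Fin.update_cons_zero] at h
        exact h }

/-- The orthogonal `S^{cΩ} = {v | Ω¹(v, S) = ⋯ = Ωᵏ(v, S) = 0}` of a subspace `S`. -/
def polyOrthogonal (Ω : Fin k → V [⋀^Fin 2]→L[ℝ] ℝ) (S : Submodule ℝ V) : Submodule ℝ V where
  carrier := {v | ∀ a, ∀ s ∈ S, Ω a ![v, s] = 0}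
  zero_mem' := fun a s _ => (Ω a).map_coord_zero 0 rfl
  add_mem' := fun {v w} hv hw a s hs => by
    have h : Ω a ![v + w, s] = Ω a ![v, s] + Ω a ![w, s] := by
      have h := (Ω a).map_update_add ![0, s] 0 v w
      simp only [Matrix.vecCons, Fin.update_cons_zero] at h
      exact h
    change Ω a ![v + w, s] = 0
    rw [h, hv a s hs, hw a s hs, add_zero]
  smul_mem' := fun c v hv a s hs => by
    have h : Ω a ![c • v, s] = c • Ω a ![v, s] := by
      have h := (Ω a).map_update_smul ![0, s] 0 c v
      simp only [Matrix.vecCons, Fin.update_cons_zero] at h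
      exact h
    change Ω a ![c • v, s] = 0
    rw [h, hv a s hs, smul_zero]

/-- `ker Ω¹ ∩ ⋯ ∩ ker Ωᵏ`. -/
def commonKernel (Ω : Fin k → V [⋀^Fin 2]→L[ℝ] ℝ) : Submodule ℝ V :=
  polyOrthogonal Ω ⊤

/-- The conditions on `k` two-forms and `k` one-forms on a vector space to be a
`k`-polycosymplectic vector space. -/
structure IsPolycosymplecticSpace (Ω : Fin k → V [⋀^Fin 2]→L[ℝ] ℝ)
    (η : Fin k → V [⋀^Fin 1]→L[ℝ] ℝ) : Prop where
  wedge_ne_zero : wedgeOneForms η ≠ 0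
  ker_inter_ker : ∀ v ∈ commonKernel Ω, (∀ a, η a ![v] = 0) → v = 0
  finrank_ker : Module.finrank ℝ (commonKernel Ω) = k

/-- `R` is the `a`-th Reeb vector: `i_R Ω^b = 0` and `i_R η^b = δ_a^b` for all `b`. -/
def IsReebVector (Ω : Fin k → V [⋀^Fin 2]→L[ℝ] ℝ) (η : Fin k → V [⋀^Fin 1]→L[ℝ] ℝ)
    (a : Fin k) (R : V) : Prop :=
  ∀ b, (∀ v, Ω b ![R, v] = 0) ∧ η b ![R] = if a = b then 1 else 0

/-- The span of the Reeb vectors. -/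
def reebSpan (Ω : Fin k → V [⋀^Fin 2]→L[ℝ] ℝ) (η : Fin k → V [⋀^Fin 1]→L[ℝ] ℝ) :
    Submodule ℝ V :=
  Submodule.span ℝ {R | ∃ a, IsReebVector Ω η a R}

end Linear

/-! ### Differential forms on boundaryless manifolds -/

section Forms

/-- Families `x ↦ α_x` of alternating `n`-linear forms on the tangent spaces of `M`. -/
abbrev FormField (E : Type*) [NormedAddCommGroup E] [NormedSpace ℝ E]
    (M : Type*) [TopologicalSpace M] [ChartedSpace E M] (n : ℕ) : Type _ :=
  (x : M) → (TangentSpace 𝓘(ℝ, E) x) [⋀^Fin n]→L[ℝ] ℝ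

variable {E : Type*} [NormedAddCommGroup E] [NormedSpace ℝ E]
  {M : Type*} [TopologicalSpace M] [ChartedSpace E M]
  {E' : Type*} [NormedAddCommGroup E'] [NormedSpace ℝ E']
  {N : Type*} [TopologicalSpace N] [ChartedSpace E' N] {n k : ℕ}

/-- The pull-back `f^*α`. -/
def FormField.pullback (f : N → M) (α : FormField E M n) : FormField E' N n :=
  fun x => (α (f x)).compContinuousLinearMap (mfderiv 𝓘(ℝ, E') 𝓘(ℝ, E) f x)

/-- The expression of `α` in the preferred chart around `c`: its pull-back along the inverse of
the chart, as a form on the model vector space (meaningful on the target of the chart). -/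
def FormField.inChart (α : FormField E M n) (c : M) : E → E [⋀^Fin n]→L[ℝ] ℝ :=
  FormField.pullback (E' := E) (N := E) (extChartAt 𝓘(ℝ, E) c).symm α

/-- `α` is smooth: all its chart expressions are. -/
def FormField.IsSmooth (α : FormField E M n) : Prop :=
  ∀ c : M, ContDiffOn ℝ ∞ (α.inChart c) (extChartAt 𝓘(ℝ, E) c).target

/-- `dα = 0`, computed in charts. -/
def FormField.IsClosed (α : FormField E M n) : Prop :=
  ∀ c : M, ∀ y ∈ (extChartAt 𝓘(ℝ, E) c).target, extDeriv (α.inChart c) y = 0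

/-- `k`-polycosymplectic structures: smooth closed two-forms `Ωᵃ` and one-forms `ηᵃ` making
every tangent space a `k`-polycosymplectic vector space. -/
structure IsPolycosymplectic (Ω : Fin k → FormField E M 2) (η : Fin k → FormField E M 1) :
    Prop where
  smooth_two : ∀ a, (Ω a).IsSmooth
  closed_two : ∀ a, (Ω a).IsClosed
  smooth_one : ∀ a, (η a).IsSmooth
  closed_one : ∀ a, (η a).IsClosed
  pointwise : ∀ x : M, IsPolycosymplecticSpace (fun a => Ω a x) (fun a => η a x)

end Forms

/-! ### Lie groups, their adjoint representation and their actions -/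

section LieGroups

variable {EG : Type*} [NormedAddCommGroup EG] [NormedSpace ℝ EG]
  {G : Type*} [TopologicalSpace G] [ChartedSpace EG G] [Group G]

variable (EG) in
/-- The adjoint action `Ad_g`, the derivative at `1` of `h ↦ g h g⁻¹`. The Lie algebra `T₁G` is
the model space `EG` (with its norm). -/
def lieAd (g : G) : EG →L[ℝ] EG :=
  mfderiv 𝓘(ℝ, EG) 𝓘(ℝ, EG) (fun h : G => g * h * g⁻¹) 1

theorem lieAd_one : lieAd EG (1 : G) = ContinuousLinearMap.id ℝ EG := by
  have h : (fun h : G => 1 * h * (1 : G)⁻¹) = id := by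
    funext h
    simp
  unfold lieAd
  rw [h]
  exact mfderiv_id

theorem lieAd_mul [LieGroup 𝓘(ℝ, EG) ∞ G] (g h : G) :
    lieAd EG (g * h) = (lieAd EG g).comp (lieAd EG h) := by
  have hd : ∀ (g x : G), MDifferentiableAt 𝓘(ℝ, EG) 𝓘(ℝ, EG) (fun y : G => g * y * g⁻¹) x := by
    intro g x
    have : ContMDiff 𝓘(ℝ, EG) 𝓘(ℝ, EG) ∞ (fun y : G => g * y * g⁻¹) :=
      (contMDiff_const.mul contMDiff_id).mul contMDiff_const
    exact (this x).mdifferentiableAt (by simp)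
  have hc : (fun y : G => (g * h) * y * (g * h)⁻¹) =
      (fun y : G => g * y * g⁻¹) ∘ (fun y : G => h * y * h⁻¹) := by
    funext y
    simp [mul_assoc]
  have h1 : h * 1 * h⁻¹ = (1 : G) := by simp
  have key := mfderiv_comp_of_eq (I := 𝓘(ℝ, EG)) (I' := 𝓘(ℝ, EG)) (I'' := 𝓘(ℝ, EG))
    (x := (1 : G)) (hd g 1) (hd h 1) h1
  unfold lieAd
  rw [hc]
  rw [h1] at key
  exact key

/-- The `k`-coadjoint action `(μ₁, …, μ_k) ↦ (Ad*_{g⁻¹} μ₁, …, Ad*_{g⁻¹} μ_k)`. -/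
def coadK {k : ℕ} (g : G) (μ : Fin k → (EG →L[ℝ] ℝ)) : Fin k → (EG →L[ℝ] ℝ) :=
  fun a => (μ a).comp (lieAd EG g⁻¹)

theorem coadK_one {k : ℕ} (μ : Fin k → (EG →L[ℝ] ℝ)) : coadK (1 : G) μ = μ := by
  funext a
  simp [coadK, lieAd_one]

theorem coadK_mul [LieGroup 𝓘(ℝ, EG) ∞ G] {k : ℕ} (g h : G) (μ : Fin k → (EG →L[ℝ] ℝ)) :
    coadK (g * h) μ = coadK g (coadK h μ) := by
  funext a
  simp only [coadK, mul_inv_rev, lieAd_mul]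
  rfl

variable (G) in
/-- The isotropy group `G_μ` of `μ` under the `k`-coadjoint action. -/
def isotropyGroup [LieGroup 𝓘(ℝ, EG) ∞ G] {k : ℕ} (μ : Fin k → (EG →L[ℝ] ℝ)) : Subgroup G where
  carrier := {g | coadK g μ = μ}
  one_mem' := coadK_one μ
  mul_mem' := fun {g h} (hg : coadK g μ = μ) (hh : coadK h μ = μ) => by
    change coadK (g * h) μ = μ
    rw [coadK_mul, hh, hg]
  inv_mem' := fun {g} (hg : coadK g μ = μ) => by
    change coadK g⁻¹ μ = μ
    conv_lhs => rw [← hg]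
    rw [← coadK_mul, inv_mul_cancel, coadK_one]

/-- The Lie algebra of a closed subgroup `K` of `G`, as a subspace of `T₁G`: the velocities at `0`
of the smooth one-parameter subgroups of `G` that lie in `K`. (For closed `K` these velocities
already form a subspace, so that taking the span adds nothing.) -/
def lieSubalgebraOf (EG : Type*) [NormedAddCommGroup EG] [NormedSpace ℝ EG]
    {G : Type*} [TopologicalSpace G] [ChartedSpace EG G] [Group G] (K : Subgroup G) :
    Submodule ℝ EG :=
  Submodule.span ℝ {ξ | ∃ γ : ℝ → G, ContMDiff 𝓘(ℝ, ℝ) 𝓘(ℝ, EG) ∞ γ ∧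
    (∀ s t, γ (s + t) = γ s * γ t) ∧ (∀ t, γ t ∈ K) ∧
    (mfderiv 𝓘(ℝ, ℝ) 𝓘(ℝ, EG) γ 0 : ℝ →L[ℝ] EG) 1 = ξ}

variable {E : Type*} [NormedAddCommGroup E] [NormedSpace ℝ E]
  {M : Type*} [TopologicalSpace M] [ChartedSpace E M] [MulAction G M] {k : ℕ}

variable (EG G) in
/-- `ξ ↦ ξ_M(x)`, where `ξ_M` is the infinitesimal generator of `ξ`: the derivative at `1` of the
orbit map `g ↦ g • x`. -/
def infGenerator (x : M) : EG →L[ℝ] TangentSpace 𝓘(ℝ, E) x :=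
  (mfderiv 𝓘(ℝ, EG) 𝓘(ℝ, E) (fun g : G => g • x) 1 : EG →L[ℝ] E)

variable (EG G) in
/-- `𝔤̃_x = {ξ_M(x) | ξ ∈ 𝔤}`. -/
def orbitTangent (x : M) : Submodule ℝ (TangentSpace 𝓘(ℝ, E) x) :=
  (infGenerator EG G x).toLinearMap.range

/-- `𝔤̃_μ|_x = {ξ_M(x) | ξ ∈ 𝔤_μ}`. -/
def isotropyOrbitTangent [LieGroup 𝓘(ℝ, EG) ∞ G] (μ : Fin k → (EG →L[ℝ] ℝ)) (x : M) :
    Submodule ℝ (TangentSpace 𝓘(ℝ, E) x) :=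
  (lieSubalgebraOf EG (isotropyGroup G μ)).map (infGenerator EG G x).toLinearMap

variable (EG G) in
/-- The action is polycosymplectic: `Φ_g^* Ωᵃ = Ωᵃ` and `i_{ξ_M} ηᵃ = 0`. -/
structure IsPolycosymplecticAction (Ω : Fin k → FormField E M 2) (η : Fin k → FormField E M 1) :
    Prop where
  invariant : ∀ a (g : G), (Ω a).pullback (fun x : M => g • x) = Ω a
  horizontal : ∀ a (ξ : EG) (x : M), η a x ![infGenerator EG G x ξ] = 0

variable (G) in
/-- `J` is a smooth momentum map: `i_{ξ_M} Ωᵃ = d⟨Jᵃ, ξ⟩`. -/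
structure IsMomentumMap (Ω : Fin k → FormField E M 2) (J : M → Fin k → (EG →L[ℝ] ℝ)) :
    Prop where
  smooth : ContMDiff 𝓘(ℝ, E) 𝓘(ℝ, Fin k → (EG →L[ℝ] ℝ)) ∞ J
  momentum : ∀ a (ξ : EG) (x : M) (v : TangentSpace 𝓘(ℝ, E) x),
    Ω a x ![infGenerator EG G x ξ, v] =
      (mfderiv 𝓘(ℝ, E) 𝓘(ℝ, ℝ) (fun y : M => J y a ξ) x v : ℝ)

variable (G) in
/-- `J` intertwines the action on `M` and the `k`-coadjoint action. -/
def IsEquivariantMomentum (J : M → Fin k → (EG →L[ℝ] ℝ)) : Prop :=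
  ∀ (g : G) (x : M), J (g • x) = coadK g (J x)

/-- `μ` is a regular value of `J`. -/
def IsRegularValue (J : M → Fin k → (EG →L[ℝ] ℝ)) (μ : Fin k → (EG →L[ℝ] ℝ)) : Prop :=
  ∀ x : M, J x = μ →
    Function.Surjective (mfderiv 𝓘(ℝ, E) 𝓘(ℝ, Fin k → (EG →L[ℝ] ℝ)) J x)

/-- The level set `J⁻¹(μ)`, with the subspace topology. -/
abbrev LevelSet (J : M → Fin k → (EG →L[ℝ] ℝ)) (μ : Fin k → (EG →L[ℝ] ℝ)) : Type _ :=
  {x : M // J x = μ}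

variable (G) in
/-- Two points of `J⁻¹(μ)` are equivalent when they lie on the same `G_μ`-orbit. -/
def levelSetSetoid [LieGroup 𝓘(ℝ, EG) ∞ G] (J : M → Fin k → (EG →L[ℝ] ℝ))
    (μ : Fin k → (EG →L[ℝ] ℝ)) : Setoid (LevelSet J μ) where
  r x y := ∃ g ∈ isotropyGroup G μ, g • (x : M) = y
  iseqv :=
    { refl := fun x => ⟨1, one_mem _, one_smul G _⟩
      symm := fun {x y} ⟨g, hg, h⟩ => ⟨g⁻¹, inv_mem hg, by rw [← h, inv_smul_smul]⟩
      trans := fun {x y z} ⟨g, hg, h⟩ ⟨g', hg', h'⟩ =>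
        ⟨g' * g, mul_mem hg' hg, by rw [mul_smul, h, h']⟩ }

variable (G) in
/-- The reduced space `M_μ = J⁻¹(μ)/G_μ`, with the quotient topology. -/
abbrev ReducedSpace [LieGroup 𝓘(ℝ, EG) ∞ G] (J : M → Fin k → (EG →L[ℝ] ℝ))
    (μ : Fin k → (EG →L[ℝ] ℝ)) : Type _ :=
  Quotient (levelSetSetoid G J μ)

/-- The inclusion `j_μ : J⁻¹(μ) → M`. -/
def levelInclusion (J : M → Fin k → (EG →L[ℝ] ℝ)) (μ : Fin k → (EG →L[ℝ] ℝ)) :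
    LevelSet J μ → M :=
  Subtype.val

variable (G) in
/-- The projection `π_μ : J⁻¹(μ) → M_μ`. -/
def levelProjection [LieGroup 𝓘(ℝ, EG) ∞ G] (J : M → Fin k → (EG →L[ℝ] ℝ))
    (μ : Fin k → (EG →L[ℝ] ℝ)) : LevelSet J μ → ReducedSpace G J μ :=
  Quotient.mk (levelSetSetoid G J μ)

variable (G) in
/-- The relations `π_μ^* Ωᵃ_μ = j_μ^* Ωᵃ` and `π_μ^* ηᵃ_μ = j_μ^* ηᵃ`. -/
def AreReducedForms [LieGroup 𝓘(ℝ, EG) ∞ G]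
    {F F' : Type*} [NormedAddCommGroup F] [NormedSpace ℝ F]
    [NormedAddCommGroup F'] [NormedSpace ℝ F']
    (J : M → Fin k → (EG →L[ℝ] ℝ)) (μ : Fin k → (EG →L[ℝ] ℝ))
    [ChartedSpace F (LevelSet J μ)] [ChartedSpace F' (ReducedSpace G J μ)]
    (Ω : Fin k → FormField E M 2) (η : Fin k → FormField E M 1)
    (Ωr : Fin k → FormField F' (ReducedSpace G J μ) 2)
    (ηr : Fin k → FormField F' (ReducedSpace G J μ) 1) : Prop :=
  (∀ a, (Ωr a).pullback (E' := F) (levelProjection G J μ) =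
    (Ω a).pullback (E' := F) (levelInclusion J μ)) ∧
  (∀ a, (ηr a).pullback (E' := F) (levelProjection G J μ) =
    (η a).pullback (E' := F) (levelInclusion J μ))

end LieGroups

end

noncomputable section

set_option linter.unusedSectionVars false

/-! ### Derivatives as maps between the model spaces -/

section ModelDeriv

variable (E : Type*) [NormedAddCommGroup E] [NormedSpace ℝ E]
  (E' : Type*) [NormedAddCommGroup E'] [NormedSpace ℝ E']
  {M : Type*} [TopologicalSpace M] [ChartedSpace E M]
  {N : Type*} [TopologicalSpace N] [ChartedSpace E' N]

/-! The nondegeneracy question is linear algebra at each point `x` of the level set. The momentum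
equation says that the orthogonal `W` of the orbit tangent `O` is the kernel of `dJ`, which is the
tangent space of the level set by regularity (`IsMomentumMap.polyOrthogonal_orbitTangent`,
`range_modelDeriv_levelInclusion`). The tangent space of the quotient is `W / H`, where `H` consists
of the values at `x` of the generators from the isotropy algebra
(`modelDeriv_levelProjection_eq_zero_iff`). Hence the common kernel of the reduced two-forms is `(W
∩ W^{cω}) / H`. It always contains the image of the Reeb span, on which the one-forms still give an
isomorphism onto `ℝ^k`. The reduced space is therefore polycosymplectic exactly when nothing else
lies in that kernel, that is, when `W ∩ W^{cω}` is the sum of the Reeb span and `H`. This sum is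
always direct, because the one-forms vanish on orbits and separate the points of the Reeb span. This
is `IsPolycosymplecticSpace.reduced_iff`.

The geometry rests on a linear description of the isotropy algebra: `ξ` belongs to it if and only if
`dJ` kills `ξ_M(x)` (`mem_lieSubalgebraOf_isotropy_iff`). Equivariance makes the velocity of `t ↦ J
(exp(tξ) • x)` a coadjoint translate of its velocity at `0`, so if it vanishes once, the whole
one-parameter group fixes `μ`. Products of such one-parameter groups replace a chart of the isotropy
group. Moving a transversal by them gives charts `(t, c, w)` of `M` in which the level set is `w =
0` and `c` labels the isotropy orbits (`exists_isSliceChart`); freeness and properness exclude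
repeated labels. These charts give both smooth structures.

The reduced forms exist whether or not the pointwise condition holds (`exists_reducedForms`). The
forms are invariant and vanish on vertical vectors, so they descend, and local sections of the
submersion transfer smoothness and closedness. Invariance of the one-forms is deduced from
closedness, horizontality and connectedness of `G`
(`FormField.invariant_of_isClosed_of_horizontal`). -/

/-- The derivative of a map between manifolds, as a map between the model spaces. -/
def modelDeriv (f : M → N) (x : M) : E →L[ℝ] E' := mfderiv 𝓘(ℝ, E) 𝓘(ℝ, E') f x

variable {E E'}
variable {E'' : Type*} [NormedAddCommGroup E''] [NormedSpace ℝ E'']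
  {P : Type*} [TopologicalSpace P] [ChartedSpace E'' P]

theorem HasMFDerivAt.modelDeriv_eq {f : M → N} {x : M} {L : E →L[ℝ] E'}
    (h : HasMFDerivAt 𝓘(ℝ, E) 𝓘(ℝ, E') f x L) : modelDeriv E E' f x = L := h.mfderiv

theorem modelDeriv_comp {g : N → P} {f : M → N} {x : M} {y : N}
    (hg : MDifferentiableAt 𝓘(ℝ, E') 𝓘(ℝ, E'') g y)
    (hf : MDifferentiableAt 𝓘(ℝ, E) 𝓘(ℝ, E') f x) (hy : f x = y) :
    modelDeriv E E'' (fun z => g (f z)) x =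
      (modelDeriv E' E'' g y).comp (modelDeriv E E' f x) := by
  subst hy
  exact mfderiv_comp x hg hf

theorem modelDeriv_comp_apply {g : N → P} {f : M → N} {x : M} {y : N}
    (hg : MDifferentiableAt 𝓘(ℝ, E') 𝓘(ℝ, E'') g y)
    (hf : MDifferentiableAt 𝓘(ℝ, E) 𝓘(ℝ, E') f x) (hy : f x = y) (v : E) :
    modelDeriv E E'' (fun z => g (f z)) x v =
      modelDeriv E' E'' g y (modelDeriv E E' f x v) := by
  rw [modelDeriv_comp hg hf hy]; rfl

theorem modelDeriv_eq_fderiv (f : E → E') (x : E) : modelDeriv E E' f x = fderiv ℝ f x :=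
  mfderiv_eq_fderiv

theorem modelDeriv_congr {f g : M → N} {x : M} (h : f =ᶠ[𝓝 x] g) :
    modelDeriv E E' f x = modelDeriv E E' g x := h.mfderiv_eq

theorem modelDeriv_id (x : M) : modelDeriv E E (fun z : M => z) x = ContinuousLinearMap.id ℝ E :=
  mfderiv_id

theorem modelDeriv_const (x : M) (c : N) : modelDeriv E E' (fun _ : M => c) x = 0 :=
  mfderiv_const

theorem MDifferentiableAt.of_comp_eventuallyEq {f g : M → N} {x : M}
    (h : MDifferentiableAt 𝓘(ℝ, E) 𝓘(ℝ, E') f x) (hfg : g =ᶠ[𝓝 x] f) :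
    MDifferentiableAt 𝓘(ℝ, E) 𝓘(ℝ, E') g x := h.congr_of_eventuallyEq hfg

theorem ContMDiffAt.mdiffAt {f : M → N} {x : M}
    (h : ContMDiffAt 𝓘(ℝ, E) 𝓘(ℝ, E') ∞ f x) : MDifferentiableAt 𝓘(ℝ, E) 𝓘(ℝ, E') f x :=
  h.mdifferentiableAt (by simp)

/-- A map with a differentiable local left inverse has a left invertible derivative. -/
theorem modelDeriv_leftInverse {f : M → N} {g : N → M} {x : M}
    (hf : MDifferentiableAt 𝓘(ℝ, E) 𝓘(ℝ, E') f x)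
    (hg : MDifferentiableAt 𝓘(ℝ, E') 𝓘(ℝ, E) g (f x)) (h : ∀ᶠ z in 𝓝 x, g (f z) = z) (v : E) :
    modelDeriv E' E g (f x) (modelDeriv E E' f x v) = v := by
  rw [← modelDeriv_comp_apply hg hf rfl, modelDeriv_congr (g := fun z => z) h, modelDeriv_id]
  rfl

/-- A map with two arguments, differentiated along two curves. -/
theorem modelDeriv_comp₂ {E₀ : Type*} [NormedAddCommGroup E₀] [NormedSpace ℝ E₀]
    {B : Type*} [TopologicalSpace B] [ChartedSpace E₀ B]
    {m : M → N → P} {a : B → M} {b : B → N} {x : B} {y : M} {z : N}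
    (hm : MDifferentiableAt (𝓘(ℝ, E).prod 𝓘(ℝ, E')) 𝓘(ℝ, E'') (fun p : M × N => m p.1 p.2) (y, z))
    (ha : MDifferentiableAt 𝓘(ℝ, E₀) 𝓘(ℝ, E) a x) (hb : MDifferentiableAt 𝓘(ℝ, E₀) 𝓘(ℝ, E') b x)
    (hy : a x = y) (hz : b x = z) (v : E₀) :
    modelDeriv E₀ E'' (fun t => m (a t) (b t)) x v =
      modelDeriv E E'' (fun p => m p z) y (modelDeriv E₀ E a x v) +
      modelDeriv E' E'' (fun q => m y q) z (modelDeriv E₀ E' b x v) := by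
  subst hy hz
  have h1 := mfderiv_comp_apply (I := 𝓘(ℝ, E₀)) (I' := 𝓘(ℝ, E).prod 𝓘(ℝ, E'))
    (I'' := 𝓘(ℝ, E'')) (x := x) (g := fun p : M × N => m p.1 p.2)
    (f := fun t => (a t, b t)) hm (ha.prodMk hb) v
  have h2 := mfderiv_prod_eq_add_apply hm
    (v := mfderiv 𝓘(ℝ, E₀) (𝓘(ℝ, E).prod 𝓘(ℝ, E')) (fun t => (a t, b t)) x v)
  have h3 := congrArg (fun L : E₀ →L[ℝ] E × E' => L v) (mfderiv_prodMk ha hb)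
  refine h1.trans (h2.trans ?_)
  refine congrArg₂ (fun (u w : E'') => u + w) ?_ ?_
  · exact congrArg (fun u : E × E' => modelDeriv E E'' (fun p => m p (b x)) (a x) u.1) h3
  · exact congrArg (fun u : E × E' => modelDeriv E' E'' (fun p => m (a x) p) (b x) u.2) h3

end ModelDeriv

/-! ### One-parameter subgroups -/

/-- Bootstrapping: if `u` is of class `C^n`, then so is its derivative `F ∘ u`, and `u` is of class
`C^(n+1)`. It upgrades integral curves, which are only known to be differentiable. -/
theorem contDiffOn_of_hasDerivAt_autonomous {E : Type*} [NormedAddCommGroup E] [NormedSpace ℝ E]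
    {F : E → E} {u : ℝ → E} {O : Set ℝ} {T : Set E} (hO : IsOpen O) (hT : Set.MapsTo u O T)
    (hF : ContDiffOn ℝ ∞ F T) (hu : ∀ t ∈ O, HasDerivAt u (F (u t)) t) : ContDiffOn ℝ ∞ u O := by
  rw [contDiffOn_infty]
  intro n
  induction n with
  | zero =>
    exact contDiffOn_zero.2 fun t ht => (hu t ht).continuousAt.continuousWithinAt
  | succ n ih =>
    rw [Nat.cast_succ, contDiffOn_succ_iff_deriv_of_isOpen hO]
    refine ⟨fun t ht => (hu t ht).differentiableAt.differentiableWithinAt, by simp, ?_⟩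
    refine ((hF.of_le (by exact_mod_cast le_top)).comp ih hT).congr fun t ht => (hu t ht).deriv

section
variable {EG : Type*} [NormedAddCommGroup EG] [NormedSpace ℝ EG]
    {G : Type*} [TopologicalSpace G] [ChartedSpace EG G] [Group G]
    [LieGroup 𝓘(ℝ, EG) ∞ G]

theorem mdifferentiable_mul_left_const (g : G) :
    MDifferentiable 𝓘(ℝ, EG) 𝓘(ℝ, EG) (fun h : G => g * h) :=
  (contMDiff_mul_left (I := 𝓘(ℝ, EG)) (n := ∞) (a := g)).mdifferentiable (by simp)

/-- The left-invariant vector field with value `ξ` at `1`. -/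
def leftInvariantField (ξ : EG) (g : G) : TangentSpace 𝓘(ℝ, EG) g :=
  modelDeriv EG EG (fun h : G => g * h) 1 ξ

theorem modelDeriv_mul_left_leftInvariantField (g h : G) (ξ : EG) :
    modelDeriv EG EG (fun x : G => g * x) h (leftInvariantField ξ h) =
      leftInvariantField ξ (g * h) := by
  unfold leftInvariantField
  rw [← modelDeriv_comp_apply (mdifferentiable_mul_left_const g h)
    (mdifferentiable_mul_left_const h 1) (by simp)]
  simp only [mul_assoc]

theorem IsMIntegralCurveOn.mul_left_const {γ : ℝ → G} {ξ : EG} {s : Set ℝ}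
    (hγ : IsMIntegralCurveOn (I := 𝓘(ℝ, EG)) γ (leftInvariantField (G := G) ξ) s) (g : G) :
    IsMIntegralCurveOn (I := 𝓘(ℝ, EG)) (fun t => g * γ t) (leftInvariantField (G := G) ξ) s := by
  intro t ht
  have h1 := (mdifferentiable_mul_left_const (EG := EG) g (γ t)).hasMFDerivAt
  have h2 := h1.comp_hasMFDerivWithinAt t (hγ t ht)
  have h3 : (modelDeriv EG EG (fun x : G => g * x) (γ t)).comp
      ((1 : ℝ →L[ℝ] ℝ).smulRight (leftInvariantField ξ (γ t) : EG)) =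
      ((1 : ℝ →L[ℝ] ℝ).smulRight (leftInvariantField ξ (g * γ t) : EG)) := by
    ext
    refine (congrArg (modelDeriv EG EG (fun x : G => g * x) (γ t))
      (one_smul ℝ (leftInvariantField ξ (γ t) : EG))).trans ?_
    rw [modelDeriv_mul_left_leftInvariantField]
    exact (one_smul ℝ (leftInvariantField ξ (g * γ t) : EG)).symm
  exact h3 ▸ h2

/-- Class `C^1` suffices for existence and uniqueness of integral curves; their smoothness is
recovered in a chart at the identity. -/
theorem contMDiff_leftInvariantField (ξ : EG) :
    ContMDiff 𝓘(ℝ, EG) 𝓘(ℝ, EG).tangent 1 (fun g : G ↦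
      (⟨g, leftInvariantField (G := G) ξ g⟩ : TangentBundle 𝓘(ℝ, EG) G)) := by
  have : LieGroup 𝓘(ℝ, EG) (minSmoothness ℝ 3) G := by
    apply LieGroup.of_le (n := ∞)
    simp only [minSmoothness_of_isRCLikeNormedField]
    exact ENat.LEInfty.out
  exact (contMDiff_mulInvariantVectorField (I := 𝓘(ℝ, EG)) (G := G) ξ).of_le (by simp)

/-- The derivative of a chart along a left-invariant vector field is a smooth function of the
chart coordinate. -/
theorem exists_contDiffOn_chart_leftInvariantField (ξ : EG) : ∃ F : EG → EG,
    ContDiffOn ℝ ∞ F (extChartAt 𝓘(ℝ, EG) (1 : G)).target ∧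
    ∀ g ∈ (extChartAt 𝓘(ℝ, EG) (1 : G)).source,
      modelDeriv EG EG (extChartAt 𝓘(ℝ, EG) (1 : G)) g (leftInvariantField ξ g) =
        F (extChartAt 𝓘(ℝ, EG) (1 : G) g) := by
  set φ := extChartAt 𝓘(ℝ, EG) (1 : G) with hφ
  have hφ1 : (1 : G) ∈ φ.source := mem_extChartAt_source _
  -- The multiplication in chart coordinates. The sought `F` is its partial derivative in the second
  -- variable at `φ 1`; since `g * 1 = g`, the product stays in the chart near every point `(a, φ
  -- 1)`.
  let m : EG × EG → EG := fun p => φ (φ.symm p.1 * φ.symm p.2)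
  have hsymm : ∀ a ∈ φ.target, ContMDiffAt 𝓘(ℝ, EG) 𝓘(ℝ, EG) ∞ φ.symm a := fun a ha =>
    (contMDiffOn_extChartAt_symm (1 : G)).contMDiffAt ((isOpen_extChartAt_target 1).mem_nhds ha)
  have hchart : ∀ g ∈ φ.source, ContMDiffAt 𝓘(ℝ, EG) 𝓘(ℝ, EG) ∞ φ g := fun g hg =>
    contMDiffAt_extChartAt' (by rwa [hφ, extChartAt_source] at hg)
  have hm : ∀ a ∈ φ.target, ContDiffAt ℝ ∞ m (a, φ 1) := by
    intro a ha
    rw [← contMDiffAt_iff_contDiffAt]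
    have h1 : ContMDiffAt 𝓘(ℝ, EG × EG) 𝓘(ℝ, EG) ∞ (fun p : EG × EG => φ.symm p.1) (a, φ 1) :=
      (hsymm a ha).comp (a, φ 1) contDiff_fst.contMDiff.contMDiffAt
    have h2 : ContMDiffAt 𝓘(ℝ, EG × EG) 𝓘(ℝ, EG) ∞ (fun p : EG × EG => φ.symm p.2) (a, φ 1) :=
      ContMDiffAt.comp (a, φ 1) (hsymm (φ 1) (φ.map_source hφ1)) contDiff_snd.contMDiff.contMDiffAt
    have h3 := h1.mul h2
    refine ContMDiffAt.comp (a, φ 1) (hchart _ ?_) h3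
    simp only [φ.left_inv hφ1, mul_one]
    exact φ.map_target ha
  refine ⟨fun a => fderiv ℝ m (a, φ 1) (0, modelDeriv EG EG φ 1 ξ), ?_, ?_⟩
  · intro a ha
    have h1 : ContDiffAt ℝ ∞ (fderiv ℝ m) (a, φ 1) := (hm a ha).fderiv_right (by simp)
    have h2 : ContDiffAt ℝ ∞ (fun a => fderiv ℝ m (a, φ 1)) a :=
      h1.comp a (contDiffAt_id.prodMk contDiffAt_const)
    exact (h2.clm_apply contDiffAt_const).contDiffWithinAt
  · intro g hg
    have hd := (hm (φ g) (φ.map_source hg)).differentiableAt (by simp)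
    have hev : (fun h : G => φ (g * h)) =ᶠ[𝓝 1] fun h => m (φ g, φ h) := by
      filter_upwards [extChartAt_source_mem_nhds (I := 𝓘(ℝ, EG)) (1 : G)] with h hh
      simp [m, φ.left_inv hg, φ.left_inv hh]
    have h1 : modelDeriv EG EG φ g (leftInvariantField ξ g) =
        modelDeriv EG EG (fun h : G => φ (g * h)) 1 ξ :=
      (modelDeriv_comp_apply (hchart g hg).mdiffAt (mdifferentiable_mul_left_const g 1)
        (by simp) ξ).symm
    rw [h1, modelDeriv_congr hev]
    have h2 : HasFDerivAt (fun b => m (φ g, b))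
        ((fderiv ℝ m (φ g, φ 1)).comp (ContinuousLinearMap.inr ℝ EG EG)) (φ 1) :=
      hd.hasFDerivAt.comp (φ 1) (hasFDerivAt_prodMk_right (φ g) (φ 1))
    have h3 := modelDeriv_comp_apply (x := (1 : G)) (g := fun b => m (φ g, b))
      h2.differentiableAt.mdifferentiableAt (hchart 1 hφ1).mdiffAt rfl ξ
    rw [h3, modelDeriv_eq_fderiv, h2.fderiv]
    rfl

variable [FiniteDimensional ℝ EG] [T2Space G]

/-- Left translates of an integral curve are integral curves, so the existence time at the identity
serves at every point. A uniform existence time makes the field complete. -/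
theorem exists_isMIntegralCurve_leftInvariantField (ξ : EG) : ∃ γ : ℝ → G, γ 0 = 1 ∧
    IsMIntegralCurve (I := 𝓘(ℝ, EG)) γ (leftInvariantField (G := G) ξ) := by
  have : CompleteSpace EG := FiniteDimensional.complete ℝ EG
  have : IsManifold 𝓘(ℝ, EG) ∞ G := inferInstance
  have : IsManifold 𝓘(ℝ, EG) 1 G := inferInstance
  have hv := contMDiff_leftInvariantField (G := G) ξ
  obtain ⟨γ, hγ0, hγ⟩ := exists_isMIntegralCurveAt_of_contMDiffAt_boundaryless (t₀ := 0)
    (x₀ := (1 : G)) (hv 1)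
  rw [isMIntegralCurveAt_iff'] at hγ
  obtain ⟨ε, hε, hγ⟩ := hγ
  refine exists_isMIntegralCurve_of_isMIntegralCurveOn hv hε
    (fun x => ⟨fun t => x * γ t, by simp [hγ0], ?_⟩) 1
  have := hγ.mul_left_const x
  rwa [Real.ball_eq_Ioo, zero_sub, zero_add] at this

/-- This plays the role of the exponential map. For fixed `s`, both `γ (s + t)` and `γ s * γ t` are
integral curves in `t` of the same field with the same initial value, so they agree. -/
theorem exists_oneParameterSubgroup (ξ : EG) : ∃ γ : ℝ → G,
    ContMDiff 𝓘(ℝ, ℝ) 𝓘(ℝ, EG) ∞ γ ∧ (∀ s t, γ (s + t) = γ s * γ t) ∧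
    modelDeriv ℝ EG γ 0 1 = ξ := by
  have : CompleteSpace EG := FiniteDimensional.complete ℝ EG
  have : IsManifold 𝓘(ℝ, EG) 1 G := inferInstance
  obtain ⟨γ, hγ0, hγ⟩ := exists_isMIntegralCurve_leftInvariantField (G := G) ξ
  have hv := contMDiff_leftInvariantField (G := G) ξ
  have hmul : ∀ s t, γ (s + t) = γ s * γ t := by
    intro s t
    have h1 : IsMIntegralCurve (I := 𝓘(ℝ, EG)) (fun t => γ s * γ t)
        (leftInvariantField (G := G) ξ) := by
      rw [isMIntegralCurve_iff_isMIntegralCurveOn] at hγ ⊢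
      exact hγ.mul_left_const (γ s)
    have := isMIntegralCurve_Ioo_eq_of_contMDiff_boundaryless (t₀ := 0) hv (hγ.comp_add s) h1
      (by simp [hγ0])
    simpa [add_comm] using congrFun this t
  have hderiv : ∀ t, HasMFDerivAt 𝓘(ℝ, ℝ) 𝓘(ℝ, EG) γ t
    ((1 : ℝ →L[ℝ] ℝ).smulRight (leftInvariantField ξ (γ t) : EG)) := hγ
  have hcont : Continuous γ := hγ.continuous
  refine ⟨γ, ?_, hmul, ?_⟩
  -- Near time `0` the chart coordinate of `γ` solves a smooth autonomous equation.
  · set φ := extChartAt 𝓘(ℝ, EG) (1 : G) with hφ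
    obtain ⟨F, hF, hFφ⟩ := exists_contDiffOn_chart_leftInvariantField (G := G) ξ
    have hO : IsOpen (γ ⁻¹' φ.source) := (isOpen_extChartAt_source 1).preimage hcont
    have hu : ContDiffOn ℝ ∞ (fun t => φ (γ t)) (γ ⁻¹' φ.source) := by
      refine contDiffOn_of_hasDerivAt_autonomous hO (fun t ht => φ.map_source ht) hF ?_
      intro t ht
      have hd : MDifferentiableAt 𝓘(ℝ, EG) 𝓘(ℝ, EG) φ (γ t) :=
        (contMDiffAt_extChartAt' (n := ∞) (by
          simpa [hφ, extChartAt_source] using ht)).mdiffAt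
      have h1 : HasMFDerivAt 𝓘(ℝ, ℝ) 𝓘(ℝ, EG) (fun t => φ (γ t)) t
        ((modelDeriv EG EG φ (γ t)).comp
          ((1 : ℝ →L[ℝ] ℝ).smulRight (leftInvariantField ξ (γ t) : EG))) :=
        hd.hasMFDerivAt.comp t (hderiv t)
      have h2 : HasFDerivAt (fun t => φ (γ t)) ((modelDeriv EG EG φ (γ t)).comp
          ((1 : ℝ →L[ℝ] ℝ).smulRight (leftInvariantField ξ (γ t) : EG)) : ℝ →L[ℝ] EG) t :=
        hasMFDerivAt_iff_hasFDerivAt.1 h1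
      refine h2.hasDerivAt.congr_deriv ?_
      rw [← hFφ _ ht]
      exact (congrArg (modelDeriv EG EG φ (γ t))
        (one_smul ℝ (leftInvariantField ξ (γ t) : EG)))
    have h0 : ContMDiffAt 𝓘(ℝ, ℝ) 𝓘(ℝ, EG) ∞ γ 0 := by
      have h0O : (0 : ℝ) ∈ γ ⁻¹' φ.source := by simp [hγ0, hφ]
      have h1 : ContMDiffAt 𝓘(ℝ, ℝ) 𝓘(ℝ, EG) ∞ (fun t => φ (γ t)) 0 :=
        (hu.contDiffAt (hO.mem_nhds h0O)).contMDiffAt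
      have h2 : ContMDiffAt 𝓘(ℝ, EG) 𝓘(ℝ, EG) ∞ φ.symm (φ (γ 0)) :=
        (contMDiffOn_extChartAt_symm (1 : G)).contMDiffAt
          ((isOpen_extChartAt_target 1).mem_nhds (φ.map_source h0O))
      refine (ContMDiffAt.comp (0 : ℝ) h2 h1).congr_of_eventuallyEq ?_
      filter_upwards [hO.mem_nhds h0O] with t ht
      exact (φ.left_inv ht).symm
    intro t
    have h1 : ContMDiffAt 𝓘(ℝ, ℝ) 𝓘(ℝ, EG) ∞ (fun s => γ (s - t)) t :=
      ContMDiffAt.comp t (by rwa [sub_self])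
        (contDiff_id.sub contDiff_const).contMDiff.contMDiffAt
    have h2 := (contMDiffAt_const (c := γ t)).mul h1
    refine h2.congr_of_eventuallyEq (Filter.Eventually.of_forall fun s => ?_)
    simp [← hmul]
  · rw [(hderiv 0).modelDeriv_eq, hγ0]
    have : leftInvariantField ξ (1 : G) = ξ := by
      simp only [leftInvariantField, one_mul]
      rw [modelDeriv_id]; rfl
    rw [this]
    exact one_smul ℝ ξ
end

/-! ### Maps with vanishing derivative -/

section LocallyConstant

variable {E : Type*} [NormedAddCommGroup E] [NormedSpace ℝ E]
  {E' : Type*} [NormedAddCommGroup E'] [NormedSpace ℝ E']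
  {M : Type*} [TopologicalSpace M] [ChartedSpace E M] [IsManifold 𝓘(ℝ, E) ∞ M]
  {N : Type*} [TopologicalSpace N] [ChartedSpace E' N] [IsManifold 𝓘(ℝ, E') ∞ N]

theorem contMDiffAt_extChartAt_self {c x : M} (hx : x ∈ (extChartAt 𝓘(ℝ, E) c).source) :
    ContMDiffAt 𝓘(ℝ, E) 𝓘(ℝ, E) ∞ (extChartAt 𝓘(ℝ, E) c) x :=
  contMDiffAt_extChartAt' (by rwa [extChartAt_source] at hx)

theorem contMDiffAt_extChartAt_symm_self {c : M} {y : E}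
    (hy : y ∈ (extChartAt 𝓘(ℝ, E) c).target) :
    ContMDiffAt 𝓘(ℝ, E) 𝓘(ℝ, E) ∞ (extChartAt 𝓘(ℝ, E) c).symm y :=
  (contMDiffOn_extChartAt_symm c).contMDiffAt ((isOpen_extChartAt_target c).mem_nhds hy)

theorem isLocallyConstant_of_modelDeriv_eq_zero {f : M → N}
    (hf : MDifferentiable 𝓘(ℝ, E) 𝓘(ℝ, E') f) (h : ∀ x, modelDeriv E E' f x = 0) :
    IsLocallyConstant f := by
  rw [IsLocallyConstant.iff_eventually_eq]
  intro x
  set φ := extChartAt 𝓘(ℝ, E) x with hφ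
  set ψ := extChartAt 𝓘(ℝ, E') (f x) with hψ
  have hxs : x ∈ φ.source := mem_extChartAt_source _
  have hc : ContinuousAt (fun y => f (φ.symm y)) (φ x) := by
    refine ContinuousAt.comp (g := f) (by exact (hf _).continuousAt) ?_
    exact continuousAt_extChartAt_symm x
  have hO : ∀ᶠ y in 𝓝 (φ x), y ∈ φ.target ∧ f (φ.symm y) ∈ ψ.source := by
    have h1 : ψ.source ∈ 𝓝 (f (φ.symm (φ x))) := by
      rw [φ.left_inv hxs]
      exact extChartAt_source_mem_nhds _
    filter_upwards [(isOpen_extChartAt_target x).mem_nhds (φ.map_source hxs), hc h1] with y h2 h3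
    exact ⟨h2, h3⟩
  obtain ⟨r, hr, hball⟩ := Metric.eventually_nhds_iff_ball.1 hO
  have hd : ∀ y ∈ Metric.ball (φ x) r, MDifferentiableAt 𝓘(ℝ, E) 𝓘(ℝ, E')
      (fun y => ψ (f (φ.symm y))) y ∧ modelDeriv E E' (fun y => ψ (f (φ.symm y))) y = 0 := by
    intro y hy
    have h1 := (contMDiffAt_extChartAt_symm_self (hball y hy).1).mdiffAt
    have h2 : MDifferentiableAt 𝓘(ℝ, E) 𝓘(ℝ, E') (fun y => f (φ.symm y)) y :=
      MDifferentiableAt.comp y (hf _) h1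
    have h3 := (contMDiffAt_extChartAt_self (hball y hy).2).mdiffAt
    refine ⟨h3.comp y h2, ?_⟩
    rw [modelDeriv_comp h3 h2 rfl, modelDeriv_comp (hf _) h1 rfl, h]
    simp
  have hconst : ∀ y ∈ Metric.ball (φ x) r, ψ (f (φ.symm y)) = ψ (f x) := by
    intro y hy
    have := Metric.isOpen_ball.is_const_of_fderiv_eq_zero (𝕜 := ℝ) (s := Metric.ball (φ x) r)
      (f := fun y => ψ (f (φ.symm y)))
      (convex_ball _ _).isPreconnected
      (fun y hy => (mdifferentiableAt_iff_differentiableAt.1 (hd y hy).1).differentiableWithinAt)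
      (fun y hy => by
        have := (hd y hy).2
        rwa [modelDeriv_eq_fderiv] at this) hy (Metric.mem_ball_self hr)
    simpa only [φ.left_inv hxs] using this
  filter_upwards [extChartAt_source_mem_nhds (I := 𝓘(ℝ, E)) x,
    (continuousAt_extChartAt (I := 𝓘(ℝ, E)) x) (Metric.ball_mem_nhds _ hr)] with y hy hyb
  have h1 := hconst _ hyb
  rw [φ.left_inv hy] at h1
  have h2 := (hball _ hyb).2
  rw [φ.left_inv hy] at h2
  exact ψ.injOn h2 (mem_extChartAt_source _) h1

end LocallyConstant

/-! ### Smooth actions and infinitesimal generators -/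

theorem contMDiff_translation (EG : Type*) [NormedAddCommGroup EG] [NormedSpace ℝ EG]
    {G : Type*} [TopologicalSpace G] [ChartedSpace EG G] [Group G]
    (E : Type*) [NormedAddCommGroup E] [NormedSpace ℝ E]
    (M : Type*) [TopologicalSpace M] [ChartedSpace E M]
    [MulAction G M] [ContMDiffSMul 𝓘(ℝ, EG) 𝓘(ℝ, E) ∞ G M] (g : G) :
    ContMDiff 𝓘(ℝ, E) 𝓘(ℝ, E) ∞ (fun x : M => g • x) :=
  (contMDiff_smul (I := 𝓘(ℝ, EG)) (G := G)).comp (contMDiff_const.prodMk contMDiff_id)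

section Action

variable {EG : Type*} [NormedAddCommGroup EG] [NormedSpace ℝ EG]
    {G : Type*} [TopologicalSpace G] [ChartedSpace EG G] [Group G]
    [LieGroup 𝓘(ℝ, EG) ∞ G]
    {E : Type*} [NormedAddCommGroup E] [NormedSpace ℝ E]
    {M : Type*} [TopologicalSpace M] [ChartedSpace E M]
    [IsManifold 𝓘(ℝ, E) ∞ M]
    [MulAction G M] [ContMDiffSMul 𝓘(ℝ, EG) 𝓘(ℝ, E) ∞ G M]

variable (EG E G M) in
theorem contMDiff_action : ContMDiff (𝓘(ℝ, EG).prod 𝓘(ℝ, E)) 𝓘(ℝ, E) ∞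
    (fun p : G × M => p.1 • p.2) := contMDiff_smul

variable (EG E) in
theorem contMDiff_orbitMap (x : M) : ContMDiff 𝓘(ℝ, EG) 𝓘(ℝ, E) ∞ (fun g : G => g • x) :=
  (contMDiff_action EG G E M).comp (contMDiff_id.prodMk contMDiff_const)

variable (EG E G) in
/-- The infinitesimal generator as a map between the model spaces. -/
def generator (x : M) : EG →L[ℝ] E := modelDeriv EG E (fun g : G => g • x) 1

/-- The Leibniz rule for the action, at a parameter where the group factor is the identity, so that
the translation contributes nothing. -/
theorem modelDeriv_smul_curve {B : Type*} [NormedAddCommGroup B] [NormedSpace ℝ B]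
    {a : B → G} {b : B → M} {t : B}
    (ha : MDifferentiableAt 𝓘(ℝ, B) 𝓘(ℝ, EG) a t) (hb : MDifferentiableAt 𝓘(ℝ, B) 𝓘(ℝ, E) b t)
    (h1 : a t = 1) (v : B) :
    modelDeriv B E (fun t => a t • b t) t v =
      generator EG G E (b t) (modelDeriv B EG a t v) + modelDeriv B E b t v := by
  have h := modelDeriv_comp₂ (m := fun (g : G) (x : M) => g • x) (a := a) (b := b)
    ((contMDiff_action EG G E M).mdifferentiable (by simp) (1, b t)) ha hb h1 rfl v
  rw [h]
  congr 1
  simp only [one_smul]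
  rw [modelDeriv_id]
  rfl

section OneParameter

variable {γ : ℝ → G}

theorem oneParameter_zero (hmul : ∀ s t, γ (s + t) = γ s * γ t) : γ 0 = 1 := by
  have := hmul 0 0
  simpa using this

/-- Writing `γ s • x = γ t • (γ (s - t) • x)` shows that the velocity at `t` is the translate of the
velocity at `0`. Vanishing at one time therefore propagates to all times. -/
theorem modelDeriv_oneParameter_smul (hγ : ContMDiff 𝓘(ℝ, ℝ) 𝓘(ℝ, EG) ∞ γ)
    (hmul : ∀ s t, γ (s + t) = γ s * γ t) (x : M) (t : ℝ) (v : ℝ) :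
    modelDeriv ℝ E (fun s => γ s • x) t v =
      modelDeriv E E (fun y : M => γ t • y) x (generator EG G E x (modelDeriv ℝ EG γ 0 v)) := by
  have h1 : ContMDiff 𝓘(ℝ, ℝ) 𝓘(ℝ, E) ∞ (fun s => γ s • x) := (contMDiff_orbitMap EG E x).comp hγ
  have h2 : modelDeriv ℝ E (fun s => γ s • x) 0 v = generator EG G E x (modelDeriv ℝ EG γ 0 v) := by
    rw [modelDeriv_smul_curve (hγ 0).mdiffAt mdifferentiableAt_const (oneParameter_zero hmul),
      modelDeriv_const]
    simp
  have h3 : (fun s => γ s • x) = fun s => γ t • (fun s => γ s • x) (s - t) := by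
    funext s
    simp [← mul_smul, ← hmul]
  have hs : modelDeriv ℝ ℝ (fun s : ℝ => s - t) t v = v := by
    rw [modelDeriv_eq_fderiv]; simp
  have hd : MDifferentiableAt 𝓘(ℝ, ℝ) 𝓘(ℝ, E) (fun s => γ s • x) 0 := (h1 0).mdiffAt
  have hdt : MDifferentiableAt 𝓘(ℝ, ℝ) 𝓘(ℝ, ℝ) (fun s : ℝ => s - t) t :=
    (differentiableAt_id.sub_const t).mdifferentiableAt
  have hdc : MDifferentiableAt 𝓘(ℝ, ℝ) 𝓘(ℝ, E) (fun s => γ (s - t) • x) t :=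
    MDifferentiableAt.comp (g := fun s => γ s • x) t (by simpa using hd) hdt
  have h4 : modelDeriv ℝ E (fun s => γ (s - t) • x) t v =
      modelDeriv ℝ E (fun s => γ s • x) 0 v := by
    rw [modelDeriv_comp_apply (g := fun s => γ s • x) (y := 0) hd hdt (by simp), hs]
  rw [← h2, ← h4, h3, modelDeriv_comp_apply (y := x)
    ((contMDiff_translation EG E M (γ t)) _).mdiffAt hdc (by simp [oneParameter_zero hmul])]

end OneParameter

variable [FiniteDimensional ℝ EG] [T2Space G]

/-- If `ξ_M(x) = 0`, the one-parameter subgroup of `ξ` fixes `x`; freeness makes it constant, and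
then `ξ = 0`. -/
theorem generator_injective_of_free (hfree : ∀ (g : G) (x : M), g • x = x → g = 1) (x : M) :
    Function.Injective (generator EG G E x) := by
  rw [injective_iff_map_eq_zero]
  intro ξ hξ
  obtain ⟨γ, hγ, hmul, hγξ⟩ := exists_oneParameterSubgroup (G := G) ξ
  have hs : ContMDiff 𝓘(ℝ, ℝ) 𝓘(ℝ, E) ∞ (fun s => γ s • x) := (contMDiff_orbitMap EG E x).comp hγ
  have hc := isLocallyConstant_of_modelDeriv_eq_zero (hs.mdifferentiable (by simp)) (fun t => by
    refine ContinuousLinearMap.ext_ring ?_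
    rw [modelDeriv_oneParameter_smul hγ hmul, hγξ, hξ]
    simp)
  have h1 : γ = fun _ => 1 := by
    funext t
    refine hfree _ x ?_
    have := hc.apply_eq_of_isPreconnected isPreconnected_univ (Set.mem_univ t) (Set.mem_univ 0)
    simpa [oneParameter_zero hmul] using this
  rw [← hγξ, h1, modelDeriv_const]
  simp

/-- Products of one-parameter subgroups: a smooth map into a subgroup with prescribed derivative. -/
theorem exists_smooth_map_to_subgroup (K : Subgroup G) (m : ℕ) (ξ : Fin m → EG)
    (hξ : ∀ i, ∃ γ : ℝ → G, ContMDiff 𝓘(ℝ, ℝ) 𝓘(ℝ, EG) ∞ γ ∧ (∀ s t, γ (s + t) = γ s * γ t) ∧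
      (∀ t, γ t ∈ K) ∧ modelDeriv ℝ EG γ 0 1 = ξ i) :
    ∃ Ψ : (Fin m → ℝ) → G, ContMDiff 𝓘(ℝ, Fin m → ℝ) 𝓘(ℝ, EG) ∞ Ψ ∧ Ψ 0 = 1 ∧ (∀ t, Ψ t ∈ K) ∧
      ∀ t, modelDeriv (Fin m → ℝ) EG Ψ 0 t = ∑ i, t i • ξ i := by
  induction m with
  | zero =>
    refine ⟨fun _ => 1, contMDiff_const, rfl, fun _ => one_mem _, fun t => ?_⟩
    rw [modelDeriv_const]; simp
  | succ m ih =>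
    obtain ⟨Ψ, hΨ, hΨ0, hΨK, hΨd⟩ := ih (fun i => ξ i.succ) (fun i => hξ i.succ)
    obtain ⟨γ, hγ, hmul, hγK, hγξ⟩ := hξ 0
    have hp : ContDiff ℝ ∞ (fun t : Fin (m + 1) → ℝ => t 0) := contDiff_apply _ _ _
    have hq : ContDiff ℝ ∞ (fun (t : Fin (m + 1) → ℝ) (i : Fin m) => t i.succ) :=
      contDiff_pi.2 fun i => contDiff_apply _ _ _
    have h1 : ContMDiff 𝓘(ℝ, Fin (m + 1) → ℝ) 𝓘(ℝ, EG) ∞ (fun t : Fin (m + 1) → ℝ => γ (t 0)) :=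
      hγ.comp hp.contMDiff
    have h2 : ContMDiff 𝓘(ℝ, Fin (m + 1) → ℝ) 𝓘(ℝ, EG) ∞
        (fun t : Fin (m + 1) → ℝ => Ψ (fun i => t i.succ)) := hΨ.comp hq.contMDiff
    have h0 : γ 0 = 1 := oneParameter_zero hmul
    -- Coordinates of the second kind: the product stays in `K` because every factor does, so `K`
    -- needs no manifold structure of its own.
    refine ⟨fun t => γ (t 0) * Ψ (fun i => t i.succ), h1.mul h2, ?_, fun t => K.mul_mem (hγK _)
      (hΨK _), fun t => ?_⟩
    · exact (congrArg₂ (fun a b : G => a * b) h0 hΨ0).trans (one_mul 1)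
    -- The product is differentiated by letting `G` act on itself by left multiplication.
    · have h := modelDeriv_smul_curve (G := G) (M := G) (E := EG) (h1 0).mdiffAt (h2 0).mdiffAt
        (by simp [h0]) t
      simp only [smul_eq_mul] at h
      rw [h]
      have hone : Ψ (fun i : Fin m => (0 : Fin (m + 1) → ℝ) i.succ) = 1 := hΨ0
      have hgen : generator EG G EG (1 : G) = ContinuousLinearMap.id ℝ EG := by
        unfold generator
        simp only [smul_eq_mul, mul_one]
        exact modelDeriv_id _
      rw [hone, hgen]
      rw [modelDeriv_comp_apply (y := 0) (hγ 0).mdiffAt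
        (hp.differentiable (by simp) 0).mdifferentiableAt rfl,
        modelDeriv_comp_apply (y := 0) (hΨ 0).mdiffAt
        (hq.differentiable (by simp) 0).mdifferentiableAt rfl, hΨd, Fin.sum_univ_succ]
      have e1 : modelDeriv _ ℝ (fun t : Fin (m + 1) → ℝ => t 0) 0 t = t 0 := by
        rw [modelDeriv_eq_fderiv]
        exact congrArg (fun L : (Fin (m + 1) → ℝ) →L[ℝ] ℝ => L t)
          (ContinuousLinearMap.proj (R := ℝ) (φ := fun _ : Fin (m + 1) => ℝ) 0).fderiv
      have e2 : modelDeriv _ (Fin m → ℝ) (fun (t : Fin (m + 1) → ℝ) (i : Fin m) => t i.succ) 0 t =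
          fun i => t i.succ := by
        rw [modelDeriv_eq_fderiv]
        exact congrArg (fun L : (Fin (m + 1) → ℝ) →L[ℝ] (Fin m → ℝ) => L t)
          (ContinuousLinearMap.pi fun i : Fin m =>
            ContinuousLinearMap.proj (R := ℝ) (φ := fun _ : Fin (m + 1) => ℝ) i.succ).fderiv
      rw [e1, e2]
      congr 1
      have : t 0 = t 0 • (1 : ℝ) := by simp
      rw [this, map_smul, hγξ]
      simp

end Action

/-! ### The inverse function theorem on manifolds -/

section InverseFunction

/-- The source is cut down to the open set where the derivative is invertible, so that the inverse
is smooth on the whole target and not only at the image of `a`. -/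
theorem exists_openPartialHomeomorph_of_isInvertible {X Y : Type*}
    [NormedAddCommGroup X] [NormedSpace ℝ X] [CompleteSpace X]
    [NormedAddCommGroup Y] [NormedSpace ℝ Y] {f : X → Y} {U : Set X} {a : X} (hU : IsOpen U)
    (ha : a ∈ U) (hf : ContDiffOn ℝ ∞ f U) (hinv : (fderiv ℝ f a).IsInvertible) :
    ∃ Θ : OpenPartialHomeomorph X Y, a ∈ Θ.source ∧ Θ.source ⊆ U ∧ (∀ y, Θ y = f y) ∧
      ContDiffOn ℝ ∞ Θ.symm Θ.target := by
  have hfa : ∀ y ∈ U, ContDiffAt ℝ ∞ f y := fun y hy => hf.contDiffAt (hU.mem_nhds hy)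
  obtain ⟨e, he⟩ := hinv
  have hd : HasFDerivAt f (e : X →L[ℝ] Y) a :=
    he ▸ ((hfa a ha).differentiableAt (by simp)).hasFDerivAt
  set P := (hfa a ha).toOpenPartialHomeomorph f hd (by simp) with hP
  have hV : IsOpen (U ∩ fderiv ℝ f ⁻¹' (Set.range ((↑) : (X ≃L[ℝ] Y) → X →L[ℝ] Y))) :=
    (hf.continuousOn_fderiv_of_isOpen hU (by simp)).isOpen_inter_preimage hU
      ContinuousLinearEquiv.isOpen
  refine ⟨P.restrOpen _ hV, ⟨(hfa a ha).mem_toOpenPartialHomeomorph_source hd (by simp), ha,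
    e, he⟩, fun y hy => hy.2.1, fun y => rfl, ?_⟩
  intro y hy
  have hy' : P.symm y ∈ (P.restrOpen _ hV).source := (P.restrOpen _ hV).map_target hy
  obtain ⟨e', he'⟩ := hy'.2.2
  refine (OpenPartialHomeomorph.contDiffAt_symm _ hy (f₀' := e') ?_
    (hfa _ hy'.2.1)).contDiffWithinAt
  rw [he']
  exact ((hfa _ hy'.2.1).differentiableAt (by simp)).hasFDerivAt

variable {E : Type*} [NormedAddCommGroup E] [NormedSpace ℝ E] [FiniteDimensional ℝ E]
  {E' : Type*} [NormedAddCommGroup E'] [NormedSpace ℝ E'] [FiniteDimensional ℝ E']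
  {M : Type*} [TopologicalSpace M] [ChartedSpace E M] [IsManifold 𝓘(ℝ, E) ∞ M]
  {N : Type*} [TopologicalSpace N] [ChartedSpace E' N] [IsManifold 𝓘(ℝ, E') ∞ N]

omit [FiniteDimensional ℝ E] in
theorem modelDeriv_extChartAt_symm_apply {c x : M} (hx : x ∈ (extChartAt 𝓘(ℝ, E) c).source)
    (v : E) : modelDeriv E E (extChartAt 𝓘(ℝ, E) c).symm (extChartAt 𝓘(ℝ, E) c x)
      (modelDeriv E E (extChartAt 𝓘(ℝ, E) c) x v) = v := by
  refine modelDeriv_leftInverse (contMDiffAt_extChartAt_self hx).mdiffAt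
    (contMDiffAt_extChartAt_symm_self ((extChartAt 𝓘(ℝ, E) c).map_source hx)).mdiffAt ?_ v
  filter_upwards [(isOpen_extChartAt_source c).mem_nhds hx] with z hz
  exact (extChartAt 𝓘(ℝ, E) c).left_inv hz

omit [FiniteDimensional ℝ E] in
theorem modelDeriv_extChartAt_apply_symm {c : M} {y : E} (hy : y ∈ (extChartAt 𝓘(ℝ, E) c).target)
    (v : E) : modelDeriv E E (extChartAt 𝓘(ℝ, E) c) ((extChartAt 𝓘(ℝ, E) c).symm y)
      (modelDeriv E E (extChartAt 𝓘(ℝ, E) c).symm y v) = v := by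
  refine modelDeriv_leftInverse (contMDiffAt_extChartAt_symm_self hy).mdiffAt
    (contMDiffAt_extChartAt_self ((extChartAt 𝓘(ℝ, E) c).map_target hy)).mdiffAt ?_ v
  filter_upwards [(isOpen_extChartAt_target c).mem_nhds hy] with z hz
  exact (extChartAt 𝓘(ℝ, E) c).right_inv hz

omit [FiniteDimensional ℝ E] in
theorem bijective_modelDeriv_extChartAt {c x : M} (hx : x ∈ (extChartAt 𝓘(ℝ, E) c).source) :
    Function.Bijective (modelDeriv E E (extChartAt 𝓘(ℝ, E) c) x) := by
  refine Function.bijective_iff_has_inverse.2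
    ⟨modelDeriv E E (extChartAt 𝓘(ℝ, E) c).symm (extChartAt 𝓘(ℝ, E) c x),
      modelDeriv_extChartAt_symm_apply hx, fun v => ?_⟩
  have := modelDeriv_extChartAt_apply_symm ((extChartAt 𝓘(ℝ, E) c).map_source hx) v
  rwa [(extChartAt 𝓘(ℝ, E) c).left_inv hx] at this

omit [FiniteDimensional ℝ E] in
theorem bijective_modelDeriv_extChartAt_symm {c : M} {y : E}
    (hy : y ∈ (extChartAt 𝓘(ℝ, E) c).target) :
    Function.Bijective (modelDeriv E E (extChartAt 𝓘(ℝ, E) c).symm y) := by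
  refine Function.bijective_iff_has_inverse.2
    ⟨modelDeriv E E (extChartAt 𝓘(ℝ, E) c) ((extChartAt 𝓘(ℝ, E) c).symm y),
      modelDeriv_extChartAt_apply_symm hy, fun v => ?_⟩
  have := modelDeriv_extChartAt_symm_apply ((extChartAt 𝓘(ℝ, E) c).map_target hy) v
  rwa [(extChartAt 𝓘(ℝ, E) c).right_inv hy] at this

omit [FiniteDimensional ℝ E'] in
theorem ContinuousLinearMap.isInvertible_of_bijective {L : E →L[ℝ] E'}
    (h : Function.Bijective L) : L.IsInvertible :=
  ⟨(LinearEquiv.ofBijective L.toLinearMap h).toContinuousLinearEquiv, by ext; rfl⟩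

omit [FiniteDimensional ℝ E'] in
/-- The inverse function theorem for maps between manifolds. -/
theorem exists_openPartialHomeomorph_of_bijective {f : M → N} {U : Set M} {x : M} (hU : IsOpen U)
    (hx : x ∈ U) (hf : ContMDiffOn 𝓘(ℝ, E) 𝓘(ℝ, E') ∞ f U)
    (hb : Function.Bijective (modelDeriv E E' f x)) :
    ∃ Θ : OpenPartialHomeomorph M N, x ∈ Θ.source ∧ Θ.source ⊆ U ∧ (∀ y ∈ Θ.source, Θ y = f y) ∧
      ContMDiffOn 𝓘(ℝ, E) 𝓘(ℝ, E') ∞ Θ Θ.source ∧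
      ContMDiffOn 𝓘(ℝ, E') 𝓘(ℝ, E) ∞ Θ.symm Θ.target := by
  have : CompleteSpace E := FiniteDimensional.complete ℝ E
  set φ := extChartAt 𝓘(ℝ, E) x with hφ
  set ψ := extChartAt 𝓘(ℝ, E') (f x) with hψ
  have hxφ : x ∈ φ.source := mem_extChartAt_source _
  have hfxψ : f x ∈ ψ.source := mem_extChartAt_source _
  have hO : IsOpen (U ∩ f ⁻¹' ψ.source) :=
    hf.continuousOn.isOpen_inter_preimage hU (isOpen_extChartAt_source _)
  set V := φ.target ∩ φ.symm ⁻¹' (U ∩ f ⁻¹' ψ.source) with hV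
  have hVo : IsOpen V :=
    (continuousOn_extChartAt_symm x).isOpen_inter_preimage (isOpen_extChartAt_target x) hO
  have hxV : φ x ∈ V := by
    refine ⟨φ.map_source hxφ, ?_⟩
    simp only [Set.mem_preimage, φ.left_inv hxφ]
    exact ⟨hx, hfxψ⟩
  have hfa : ∀ y ∈ U, ContMDiffAt 𝓘(ℝ, E) 𝓘(ℝ, E') ∞ f y := fun y hy =>
    hf.contMDiffAt (hU.mem_nhds hy)
  have h1 : ∀ y ∈ V, ContMDiffAt 𝓘(ℝ, E) 𝓘(ℝ, E') ∞ (fun y => f (φ.symm y)) y := fun y hy =>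
    ContMDiffAt.comp y (hfa _ hy.2.1) (contMDiffAt_extChartAt_symm_self hy.1)
  have h2 : ∀ y ∈ V, ContMDiffAt 𝓘(ℝ, E) 𝓘(ℝ, E') ∞ (fun y => ψ (f (φ.symm y))) y := fun y hy =>
    ContMDiffAt.comp y (contMDiffAt_extChartAt_self hy.2.2) (h1 y hy)
  have hinv : (fderiv ℝ (fun y => ψ (f (φ.symm y))) (φ x)).IsInvertible := by
    apply ContinuousLinearMap.isInvertible_of_bijective
    rw [← modelDeriv_eq_fderiv, modelDeriv_comp (y := f x) (contMDiffAt_extChartAt_self hfxψ).mdiffAt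
      (h1 _ hxV).mdiffAt (by rw [φ.left_inv hxφ]), modelDeriv_comp (y := x) (hfa x hx).mdiffAt
      (contMDiffAt_extChartAt_symm_self (φ.map_source hxφ)).mdiffAt (φ.left_inv hxφ)]
    exact (bijective_modelDeriv_extChartAt hfxψ).comp
      (hb.comp (bijective_modelDeriv_extChartAt_symm (φ.map_source hxφ)))
  obtain ⟨P, hxP, hPV, hPf, hPs⟩ := exists_openPartialHomeomorph_of_isInvertible hVo hxV
    (fun y hy => (contMDiffAt_iff_contDiffAt.1 (h2 y hy)).contDiffWithinAt) hinv
  set Θ := ((chartAt E x).trans P).trans (chartAt E' (f x)).symm with hΘ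
  have hsrc : ∀ y ∈ Θ.source, y ∈ φ.source ∧ φ y ∈ P.source := by
    intro y hy
    simp only [hΘ, OpenPartialHomeomorph.trans_source, Set.mem_inter_iff] at hy
    exact ⟨by simpa [hφ] using hy.1.1, by simpa [hφ] using hy.1.2⟩
  have hmap : ∀ y ∈ Θ.source, Θ y = ψ.symm (P (φ y)) := fun y _ => by simp [hΘ, hφ, hψ]
  have hval : ∀ y ∈ Θ.source, Θ y = f y := by
    intro y hy
    have := hPV (hsrc y hy).2
    have h3 := this.2.2
    simp only [φ.left_inv (hsrc y hy).1, Set.mem_preimage] at h3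
    rw [hmap y hy, hPf, φ.left_inv (hsrc y hy).1, ψ.left_inv h3]
  have hUsrc : Θ.source ⊆ U := by
    intro y hy
    have := (hPV (hsrc y hy).2).2.1
    rwa [φ.left_inv (hsrc y hy).1] at this
  refine ⟨Θ, ?_, hUsrc, hval, ?_, ?_⟩
  · have : ψ (f x) ∈ ψ.target := ψ.map_source hfxψ
    simp only [hΘ, OpenPartialHomeomorph.trans_source, Set.mem_inter_iff]
    refine ⟨⟨mem_chart_source _ _, by simpa [hφ] using hxP⟩, ?_⟩
    have h3 : P (φ x) ∈ ψ.target := by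
      rw [hPf, φ.left_inv hxφ]; exact this
    simpa [hφ, hψ] using h3
  · exact (hf.mono hUsrc).congr hval
  · have hsymm : ∀ z ∈ Θ.target, Θ.symm z = φ.symm (P.symm (ψ z)) := fun z _ => by
      simp [hΘ, hφ, hψ]
    have ht : ∀ z ∈ Θ.target, z ∈ ψ.source ∧ ψ z ∈ P.target ∧ P.symm (ψ z) ∈ φ.target := by
      intro z hz
      simp only [hΘ, OpenPartialHomeomorph.trans_target, Set.mem_inter_iff] at hz
      refine ⟨by simpa [hψ] using hz.1, by simpa [hψ] using hz.2.1, by simpa [hφ, hψ] using hz.2.2⟩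
    refine ContMDiffOn.congr (fun z hz => ?_) hsymm
    have h3 := contMDiffAt_extChartAt_self (ht z hz).1
    have h4 : ContMDiffAt 𝓘(ℝ, E') 𝓘(ℝ, E) ∞ P.symm (ψ z) :=
      (hPs.contDiffAt (P.open_target.mem_nhds (ht z hz).2.1)).contMDiffAt
    have h5 := contMDiffAt_extChartAt_symm_self (ht z hz).2.2
    exact (h5.comp z (h4.comp z h3)).contMDiffWithinAt

/-- An immersion is locally injective. -/
theorem exists_injOn_nhds_of_injective_modelDeriv {f : M → N} {U : Set M} {x : M} (hU : IsOpen U)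
    (hx : x ∈ U) (hf : ContMDiffOn 𝓘(ℝ, E) 𝓘(ℝ, E') ∞ f U)
    (hi : Function.Injective (modelDeriv E E' f x)) : ∃ V ∈ 𝓝 x, Set.InjOn f V := by
  set ψ := extChartAt 𝓘(ℝ, E') (f x) with hψ
  have hfxψ : f x ∈ ψ.source := mem_extChartAt_source _
  have hO : IsOpen (U ∩ f ⁻¹' ψ.source) :=
    hf.continuousOn.isOpen_inter_preimage hU (isOpen_extChartAt_source _)
  have hfa : ∀ y ∈ U, ContMDiffAt 𝓘(ℝ, E) 𝓘(ℝ, E') ∞ f y := fun y hy =>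
    hf.contMDiffAt (hU.mem_nhds hy)
  have hinj := (bijective_modelDeriv_extChartAt hfxψ).1.comp hi
  -- After composition with a chart and a linear left inverse `r` of the derivative, `f` has the
  -- identity as derivative. The inverse function theorem makes the composite, hence `f`, injective
  -- near `x`.
  obtain ⟨r, hr⟩ := LinearMap.exists_leftInverse_of_injective
    (((modelDeriv E' E' ψ (f x)).comp (modelDeriv E E' f x)).toLinearMap)
    (LinearMap.ker_eq_bot.2 hinj)
  have h1 : ∀ y ∈ U ∩ f ⁻¹' ψ.source, ContMDiffAt 𝓘(ℝ, E) 𝓘(ℝ, E') ∞ (fun y => ψ (f y)) y :=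
    fun y hy => ContMDiffAt.comp y (contMDiffAt_extChartAt_self hy.2) (hfa y hy.1)
  have h2 : ∀ y ∈ U ∩ f ⁻¹' ψ.source, ContMDiffAt 𝓘(ℝ, E) 𝓘(ℝ, E) ∞
      (fun y => r.toContinuousLinearMap (ψ (f y))) y :=
    fun y hy => ContMDiffAt.comp y
      r.toContinuousLinearMap.contDiff.contMDiff.contMDiffAt (h1 y hy)
  obtain ⟨Θ, hxΘ, hΘU, hΘf, -⟩ := exists_openPartialHomeomorph_of_bijective (E' := E) hO ⟨hx, hfxψ⟩
    (fun y hy => (h2 y hy).contMDiffWithinAt) (by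
      have : modelDeriv E E (fun y => r.toContinuousLinearMap (ψ (f y))) x =
          ContinuousLinearMap.id ℝ E := by
        rw [modelDeriv_comp (g := r.toContinuousLinearMap)
          r.toContinuousLinearMap.differentiableAt.mdifferentiableAt (h1 x ⟨hx, hfxψ⟩).mdiffAt rfl,
          modelDeriv_eq_fderiv, ContinuousLinearMap.fderiv,
          modelDeriv_comp (contMDiffAt_extChartAt_self hfxψ).mdiffAt (hfa x hx).mdiffAt rfl]
        ext v
        exact LinearMap.congr_fun hr v
      rw [this]
      exact Function.bijective_id)
  refine ⟨Θ.source, Θ.open_source.mem_nhds hxΘ, fun y hy z hz hyz => Θ.injOn hy hz ?_⟩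
  rw [hΘf y hy, hΘf z hz, hyz]

end InverseFunction

/-! ### Adapted linear coordinates -/

section LinearAlgebra

/-- Linear coordinates adapted to a surjection `D : E → W` and an injection `B : A → ker D`. -/
theorem exists_continuousLinearEquiv_adapted {A E W : Type*}
    [NormedAddCommGroup A] [NormedSpace ℝ A] [FiniteDimensional ℝ A]
    [NormedAddCommGroup E] [NormedSpace ℝ E] [FiniteDimensional ℝ E]
    [NormedAddCommGroup W] [NormedSpace ℝ W] [FiniteDimensional ℝ W]
    (D : E →L[ℝ] W) (hD : Function.Surjective D) (B : A →L[ℝ] E) (hB : Function.Injective B)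
    (hDB : ∀ t, D (B t) = 0) (e : ℕ)
    (he : Module.finrank ℝ A + e + Module.finrank ℝ W = Module.finrank ℝ E) :
    ∃ Λ : (A × (Fin e → ℝ) × W) ≃L[ℝ] E, (∀ t, Λ (t, 0, 0) = B t) ∧ ∀ p, D (Λ p) = p.2.2 := by
  let K := LinearMap.ker D.toLinearMap
  let B' : A →ₗ[ℝ] K := B.toLinearMap.codRestrict K hDB
  have hB' : Function.Injective B' := fun s t h => hB (congrArg Subtype.val h)
  obtain ⟨R, hR⟩ := LinearMap.exists_rightInverse_of_surjective D.toLinearMap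
    (LinearMap.range_eq_top.2 hD)
  have hR' : ∀ w, D (R w) = w := fun w => LinearMap.congr_fun hR w
  -- The decomposition is `E = B(A) ⊕ C ⊕ R(W)`, with `C` complementary to `B(A)` in `ker D` and `R`
  -- a linear section of `D`. The dimension hypothesis forces `dim C = e`.
  obtain ⟨C, hC⟩ := Submodule.exists_isCompl (LinearMap.range B')
  have hCe : Module.finrank ℝ C = e := by
    have h1 := Submodule.finrank_add_eq_of_isCompl hC
    rw [LinearMap.finrank_range_of_inj hB'] at h1
    have h2 := LinearMap.finrank_range_add_finrank_ker D.toLinearMap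
    rw [LinearMap.range_eq_top.2 hD, finrank_top] at h2
    change _ + Module.finrank ℝ K = _ at h2
    omega
  let ι : (Fin e → ℝ) ≃ₗ[ℝ] C := LinearEquiv.ofFinrankEq _ _ (by simp [hCe])
  let L : (A × (Fin e → ℝ) × W) →ₗ[ℝ] E :=
    B.toLinearMap.coprod ((K.subtype ∘ₗ C.subtype ∘ₗ ι.toLinearMap).coprod R)
  have hL : ∀ t c w, L (t, c, w) = B t + ((((ι c : C) : K) : E) + R w) := fun t c w => rfl
  have hDK : ∀ v : K, D (v : E) = 0 := fun v => v.2
  have hinj : Function.Injective L := by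
    rw [injective_iff_map_eq_zero]
    rintro ⟨t, c, w⟩ h
    rw [hL] at h
    have hw : w = 0 := by
      have := congrArg D h
      simpa [hDB, hDK, hR'] using this
    subst hw
    have h1 : B' t + (ι c : K) = 0 := by
      apply Subtype.ext
      change B t + ((ι c : K) : E) = 0
      simpa using h
    have h2 : B' t = 0 := by
      have h3 : B' t ∈ C := by
        rw [eq_neg_of_add_eq_zero_left h1]
        exact C.neg_mem (ι c).2
      have := Submodule.mem_inf.2 ⟨LinearMap.mem_range_self B' t, h3⟩
      rwa [hC.inf_eq_bot, Submodule.mem_bot] at this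
    have h3 : t = 0 := hB' (by rw [h2, map_zero])
    subst h3
    have h4 : c = 0 := by
      rw [h2, zero_add] at h1
      exact ι.injective (Subtype.ext (by rw [h1]; simp))
    rw [h4]
    rfl
  let Λ := (LinearEquiv.ofInjectiveOfFinrankEq L hinj (by
    rw [Module.finrank_prod, Module.finrank_prod, Module.finrank_fin_fun]
    omega)).toContinuousLinearEquiv
  have hΛ : ∀ p, Λ p = L p := fun p => rfl
  refine ⟨Λ, fun t => ?_, fun ⟨t, c, w⟩ => ?_⟩
  · rw [hΛ, hL]; simp
  · rw [hΛ, hL]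
    simp [hDB, hDK, hR']

end LinearAlgebra

/-! ### The momentum map along orbits and the isotropy algebra -/

section Momentum

variable {EG : Type*} [NormedAddCommGroup EG] [NormedSpace ℝ EG]
    {G : Type*} [TopologicalSpace G] [ChartedSpace EG G] [Group G]
    [LieGroup 𝓘(ℝ, EG) ∞ G]
    {E : Type*} [NormedAddCommGroup E] [NormedSpace ℝ E]
    {M : Type*} [TopologicalSpace M] [ChartedSpace E M]
    [IsManifold 𝓘(ℝ, E) ∞ M]
    [MulAction G M] [ContMDiffSMul 𝓘(ℝ, EG) 𝓘(ℝ, E) ∞ G M]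
    {k : ℕ} {Ω : Fin k → FormField E M 2} {J : M → Fin k → (EG →L[ℝ] ℝ)}
    {μ : Fin k → (EG →L[ℝ] ℝ)}

theorem IsMomentumMap.modelDeriv_apply (hJ : IsMomentumMap G Ω J) (x : M) (v : E) (a : Fin k)
    (ξ : EG) : modelDeriv E (Fin k → (EG →L[ℝ] ℝ)) J x v a ξ =
      Ω a x ![infGenerator EG G x ξ, v] := by
  refine Eq.trans ?_ (hJ.momentum a ξ x v).symm
  let ev : (Fin k → (EG →L[ℝ] ℝ)) →L[ℝ] ℝ :=
    (ContinuousLinearMap.apply ℝ ℝ ξ).comp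
      (ContinuousLinearMap.proj (R := ℝ) (φ := fun _ : Fin k => EG →L[ℝ] ℝ) a)
  have h := modelDeriv_comp_apply (E := E) (E' := Fin k → (EG →L[ℝ] ℝ)) (E'' := ℝ) (x := x)
    (g := ev) (f := J) ev.differentiableAt.mdifferentiableAt (hJ.smooth x).mdiffAt rfl v
  rw [modelDeriv_eq_fderiv, ContinuousLinearMap.fderiv] at h
  exact h.symm

/-- The `k`-coadjoint action of `g` as a continuous linear map. -/
def coadKL (k : ℕ) (g : G) : (Fin k → (EG →L[ℝ] ℝ)) →L[ℝ] (Fin k → (EG →L[ℝ] ℝ)) :=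
  ContinuousLinearMap.pi fun a =>
    (ContinuousLinearMap.precomp ℝ (lieAd EG g⁻¹)).comp
      (ContinuousLinearMap.proj (R := ℝ) (φ := fun _ : Fin k => EG →L[ℝ] ℝ) a)

theorem coadKL_apply (g : G) (ν : Fin k → (EG →L[ℝ] ℝ)) : coadKL k g ν = coadK g ν := rfl

/-- This is the derivative of the equivariance relation, the coadjoint action of a fixed `g` being
linear. -/
theorem modelDeriv_momentum_translation (hJ : IsMomentumMap G Ω J)
    (hJeq : IsEquivariantMomentum G J) (g : G) (x : M) (v : E) :
    modelDeriv E (Fin k → (EG →L[ℝ] ℝ)) J (g • x) (modelDeriv E E (fun y : M => g • y) x v) =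
      coadK g (modelDeriv E (Fin k → (EG →L[ℝ] ℝ)) J x v) := by
  rw [← modelDeriv_comp_apply (hJ.smooth _).mdiffAt ((contMDiff_translation EG E M g) x).mdiffAt
    rfl]
  have : (fun y => J (g • y)) = fun y => coadKL k g (J y) := funext fun y => hJeq g y
  rw [this, modelDeriv_comp_apply (E' := Fin k → (EG →L[ℝ] ℝ)) (g := coadKL k g)
    (coadKL k g).differentiableAt.mdifferentiableAt (hJ.smooth x).mdiffAt rfl,
    modelDeriv_eq_fderiv, ContinuousLinearMap.fderiv, coadKL_apply]

theorem smul_mem_level_iff (hJeq : IsEquivariantMomentum G J) {x : M} (hx : J x = μ) (g : G) :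
    J (g • x) = μ ↔ g ∈ isotropyGroup G μ := by
  rw [hJeq, hx]
  rfl

/-- `J` is constant along the orbit of `x` under a one-parameter subgroup of the isotropy group.
Since the conclusion is linear in `ξ`, it passes to the span. -/
theorem modelDeriv_momentum_generator_eq_zero (hJ : IsMomentumMap G Ω J)
    (hJeq : IsEquivariantMomentum G J) {x : M} (hx : J x = μ) {ξ : EG}
    (hξ : ξ ∈ lieSubalgebraOf EG (isotropyGroup G μ)) :
    modelDeriv E (Fin k → (EG →L[ℝ] ℝ)) J x (generator EG G E x ξ) = 0 := by
  suffices h : lieSubalgebraOf EG (isotropyGroup G μ) ≤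
      LinearMap.ker ((modelDeriv E (Fin k → (EG →L[ℝ] ℝ)) J x).comp
        (generator EG G E x)).toLinearMap from h hξ
  refine Submodule.span_le.2 ?_
  rintro _ ⟨γ, hγ, hmul, hK, rfl⟩
  change modelDeriv E (Fin k → (EG →L[ℝ] ℝ)) J x (generator EG G E x (modelDeriv ℝ EG γ 0 1)) = 0
  have h0 := oneParameter_zero hmul
  have h1 := modelDeriv_oneParameter_smul (E := E) hγ hmul x 0 1
  simp only [h0, one_smul] at h1
  rw [modelDeriv_id] at h1
  have h2 : ContMDiff 𝓘(ℝ, ℝ) 𝓘(ℝ, E) ∞ (fun s => γ s • x) := (contMDiff_orbitMap EG E x).comp hγ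
  have h3 := modelDeriv_comp_apply (x := (0 : ℝ)) (y := x) (hJ.smooth x).mdiffAt (h2 0).mdiffAt
    (by simp [h0]) (1 : ℝ)
  rw [h1] at h3
  refine h3.symm.trans ?_
  have : (fun s => J (γ s • x)) = fun _ => μ :=
    funext fun s => (smul_mem_level_iff hJeq hx _).2 (hK s)
  rw [this, modelDeriv_const]
  rfl

variable [FiniteDimensional ℝ EG] [T2Space G]

/-- The velocity of `s ↦ J (γ s • x)` is `coadK (γ s)` applied to its velocity at `0`, which
vanishes by assumption. So `J` stays equal to `μ` along the curve, and an element that keeps `x` in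
the level set is in the isotropy group. -/
theorem exists_oneParameter_isotropy (hJ : IsMomentumMap G Ω J)
    (hJeq : IsEquivariantMomentum G J) {x : M} (hx : J x = μ) {ξ : EG}
    (hξ : modelDeriv E (Fin k → (EG →L[ℝ] ℝ)) J x (generator EG G E x ξ) = 0) :
    ∃ γ : ℝ → G, ContMDiff 𝓘(ℝ, ℝ) 𝓘(ℝ, EG) ∞ γ ∧ (∀ s t, γ (s + t) = γ s * γ t) ∧
      (∀ t, γ t ∈ isotropyGroup G μ) ∧ modelDeriv ℝ EG γ 0 1 = ξ := by
  obtain ⟨γ, hγ, hmul, hγξ⟩ := exists_oneParameterSubgroup (G := G) ξ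
  refine ⟨γ, hγ, hmul, fun t => ?_, hγξ⟩
  have h0 := oneParameter_zero hmul
  have h2 : ContMDiff 𝓘(ℝ, ℝ) 𝓘(ℝ, E) ∞ (fun s => γ s • x) := (contMDiff_orbitMap EG E x).comp hγ
  have h3 : ContMDiff 𝓘(ℝ, ℝ) 𝓘(ℝ, Fin k → (EG →L[ℝ] ℝ)) ∞ (fun s => J (γ s • x)) :=
    hJ.smooth.comp h2
  have hc := isLocallyConstant_of_modelDeriv_eq_zero (h3.mdifferentiable (by simp)) (fun t => by
    refine ContinuousLinearMap.ext_ring ?_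
    rw [modelDeriv_comp_apply (hJ.smooth _).mdiffAt (h2 t).mdiffAt rfl,
      modelDeriv_oneParameter_smul hγ hmul, modelDeriv_momentum_translation hJ hJeq, hγξ, hξ,
      ← coadKL_apply]
    simp)
  rw [← smul_mem_level_iff hJeq hx]
  have := hc.apply_eq_of_isPreconnected isPreconnected_univ (Set.mem_univ t) (Set.mem_univ 0)
  simpa [h0, hx] using this

/-- This linear description of the isotropy algebra replaces the closed subgroup theorem. Together
with `exists_oneParameter_isotropy` it shows that every element of the span is itself a velocity,
once the level set has a point. -/
theorem mem_lieSubalgebraOf_isotropy_iff (hJ : IsMomentumMap G Ω J)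
    (hJeq : IsEquivariantMomentum G J) {x : M} (hx : J x = μ) {ξ : EG} :
    ξ ∈ lieSubalgebraOf EG (isotropyGroup G μ) ↔
      modelDeriv E (Fin k → (EG →L[ℝ] ℝ)) J x (generator EG G E x ξ) = 0 := by
  refine ⟨modelDeriv_momentum_generator_eq_zero hJ hJeq hx, fun h => ?_⟩
  obtain ⟨γ, hγ, hmul, hK, hξ⟩ := exists_oneParameter_isotropy hJ hJeq hx h
  exact Submodule.subset_span ⟨γ, hγ, hmul, hK, hξ⟩

end Momentum

/-! ### Slices for free proper actions -/

section Slice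

variable {EG : Type*} [NormedAddCommGroup EG] [NormedSpace ℝ EG]
    {G : Type*} [TopologicalSpace G] [ChartedSpace EG G] [Group G]
    [LieGroup 𝓘(ℝ, EG) ∞ G]
    {E : Type*} [NormedAddCommGroup E] [NormedSpace ℝ E]
    {M : Type*} [TopologicalSpace M] [ChartedSpace E M]
    [IsManifold 𝓘(ℝ, E) ∞ M]
    [MulAction G M] [ContMDiffSMul 𝓘(ℝ, EG) 𝓘(ℝ, E) ∞ G M]

/-- By properness the pairs `(h • y, y)` with `h` outside an open neighbourhood of `1` form a closed
set. Freeness keeps `(x, x)` out of it, so some `N × N` avoids it too. -/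
theorem exists_nhds_smul_mem_of_free {G M : Type*} [TopologicalSpace G] [TopologicalSpace M]
    [Group G] [MulAction G M] [ProperSMul G M]
    (hfree : ∀ (g : G) (x : M), g • x = x → g = 1) (x : M) {V : Set G} (hV : V ∈ 𝓝 1) :
    ∃ N ∈ 𝓝 x, ∀ (h : G), ∀ y ∈ N, h • y ∈ N → h ∈ V := by
  obtain ⟨V', hV'V, hV'o, h1⟩ := mem_nhds_iff.1 hV
  have hcl := (ProperSMul.isProperMap_smul_pair (G := G) (X := M)).isClosedMap _
    ((hV'o.isClosed_compl).prod (isClosed_univ (X := M)))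
  have hx : (x, x) ∉ (fun gx : G × M => (gx.1 • gx.2, gx.2)) '' (V'ᶜ ×ˢ Set.univ) := by
    rintro ⟨⟨g, y⟩, ⟨hg, -⟩, heq⟩
    obtain ⟨h2, rfl⟩ := Prod.mk.inj heq
    exact hg (hfree g y h2 ▸ h1)
  have hmem := hcl.isOpen_compl.mem_nhds hx
  rw [nhds_prod_eq, Filter.mem_prod_same_iff] at hmem
  obtain ⟨N, hN, hsub⟩ := hmem
  refine ⟨N, hN, fun h y hy hhy => ?_⟩
  by_contra hh
  exact hsub (Set.mk_mem_prod hhy hy) ⟨(h, y), ⟨fun h3 => hh (hV'V h3), trivial⟩, rfl⟩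

/-- A slice transversal to the orbits meets nearby orbits at most once, within a neighbourhood of
the identity. -/
theorem exists_nhds_slice_injective [FiniteDimensional ℝ EG] [FiniteDimensional ℝ E]
    {B : Type*} [NormedAddCommGroup B] [NormedSpace ℝ B]
    [FiniteDimensional ℝ B] {σ : B → M} {O : Set B} (hO : IsOpen O) (h0 : (0 : B) ∈ O)
    (hσ : ContMDiffOn 𝓘(ℝ, B) 𝓘(ℝ, E) ∞ σ O)
    (hinj : ∀ ξ c, generator EG G E (σ 0) ξ + modelDeriv B E σ 0 c = 0 → ξ = 0 ∧ c = 0) :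
    ∃ V ∈ 𝓝 (1 : G), ∃ V' ∈ 𝓝 (0 : B), ∀ h ∈ V, ∀ c ∈ V', ∀ c' ∈ V',
      h • σ c = σ c' → c = c' := by
  set φ := extChartAt 𝓘(ℝ, EG) (1 : G) with hφ
  have hφ1 : (1 : G) ∈ φ.source := mem_extChartAt_source _
  have hU : IsOpen (φ.target ×ˢ O) := (isOpen_extChartAt_target (1 : G)).prod hO
  have h1U : (φ 1, (0 : B)) ∈ φ.target ×ˢ O := ⟨φ.map_source hφ1, h0⟩
  have ha : ∀ p ∈ φ.target ×ˢ O,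
      ContMDiffAt 𝓘(ℝ, EG × B) 𝓘(ℝ, EG) ∞ (fun p : EG × B => φ.symm p.1) p := fun p hp =>
    ContMDiffAt.comp p (contMDiffAt_extChartAt_symm_self hp.1) contDiff_fst.contMDiff.contMDiffAt
  have hσa : ∀ c ∈ O, ContMDiffAt 𝓘(ℝ, B) 𝓘(ℝ, E) ∞ σ c := fun c hc =>
    hσ.contMDiffAt (hO.mem_nhds hc)
  have hb : ∀ p ∈ φ.target ×ˢ O,
      ContMDiffAt 𝓘(ℝ, EG × B) 𝓘(ℝ, E) ∞ (fun p : EG × B => σ p.2) p := fun p hp =>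
    ContMDiffAt.comp p (hσa _ hp.2) contDiff_snd.contMDiff.contMDiffAt
  have hf : ContMDiffOn 𝓘(ℝ, EG × B) 𝓘(ℝ, E) ∞ (fun p : EG × B => φ.symm p.1 • σ p.2)
      (φ.target ×ˢ O) := fun p hp =>
    (ContMDiffAt.comp p (contMDiff_action EG G E M _)
      ((ha p hp).prodMk (hb p hp))).contMDiffWithinAt
  -- The transversality hypothesis says exactly that `(g, c) ↦ g • σ c`, in coordinates on `G`, is
  -- an immersion at the base point.
  obtain ⟨V, hV, hVinj⟩ := exists_injOn_nhds_of_injective_modelDeriv hU h1U hf (by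
    rw [injective_iff_map_eq_zero]
    rintro ⟨η, c⟩ h
    have d1 : modelDeriv (EG × B) EG (fun p : EG × B => φ.symm p.1) (φ 1, 0) (η, c) =
        modelDeriv EG EG φ.symm (φ 1) η := by
      rw [modelDeriv_comp_apply (g := φ.symm) (f := Prod.fst) (y := φ 1)
        (contMDiffAt_extChartAt_symm_self (φ.map_source hφ1)).mdiffAt
        differentiableAt_fst.mdifferentiableAt rfl, modelDeriv_eq_fderiv, fderiv_fst]
      rfl
    have d2 : modelDeriv (EG × B) E (fun p : EG × B => σ p.2) (φ 1, 0) (η, c) =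
        modelDeriv B E σ 0 c := by
      rw [modelDeriv_comp_apply (g := σ) (f := Prod.snd) (y := 0) (hσa 0 h0).mdiffAt
        differentiableAt_snd.mdifferentiableAt rfl, modelDeriv_eq_fderiv, fderiv_snd]
      rfl
    rw [modelDeriv_smul_curve (ha _ h1U).mdiffAt (hb _ h1U).mdiffAt (φ.left_inv hφ1), d1, d2] at h
    obtain ⟨h2, h3⟩ := hinj _ _ h
    have h4 := (bijective_modelDeriv_extChartAt_symm (φ.map_source hφ1)).1
      (h2.trans (map_zero _).symm)
    rw [h4, h3]
    rfl)
  rw [nhds_prod_eq, Filter.mem_prod_iff] at hV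
  obtain ⟨V₁, hV₁, V₂, hV₂, hsub⟩ := hV
  refine ⟨φ.source ∩ φ ⁻¹' V₁, Filter.inter_mem (extChartAt_source_mem_nhds _)
    ((continuousAt_extChartAt (1 : G)) hV₁), V₂, hV₂, fun h hh c hc c' hc' heq => ?_⟩
  -- The relation `h • σ c = 1 • σ c'` is a coincidence of two values of the injective map.
  have := hVinj (hsub (Set.mk_mem_prod hh.2 hc))
    (hsub (Set.mk_mem_prod (mem_of_mem_nhds hV₁) hc')) (by
      simp only [φ.left_inv hh.1, φ.left_inv hφ1, one_smul, heq])
  exact (Prod.mk.inj this).2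

end Slice

/-- A chart of `M` with values in `A × B × C`, in which the subset `p` is the locus where the last
coordinate vanishes, and two points of `p` are equivalent if and only if their middle coordinates
agree. -/
structure IsSliceChart (E : Type*) {M A B C : Type*} [NormedAddCommGroup E] [NormedSpace ℝ E]
    [TopologicalSpace M] [ChartedSpace E M] [NormedAddCommGroup A] [NormedSpace ℝ A]
    [NormedAddCommGroup B] [NormedSpace ℝ B] [NormedAddCommGroup C] [NormedSpace ℝ C]
    (p : M → Prop) (s : Setoid (Subtype p)) (Θ : OpenPartialHomeomorph M (A × B × C)) : Prop where
  smooth : ContMDiffOn 𝓘(ℝ, E) 𝓘(ℝ, A × B × C) ∞ Θ Θ.source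
  smooth_symm : ContMDiffOn 𝓘(ℝ, A × B × C) 𝓘(ℝ, E) ∞ Θ.symm Θ.target
  mem_iff : ∀ y ∈ Θ.source, p y ↔ (Θ y).2.2 = 0
  rel_iff : ∀ y y' : Subtype p, (y : M) ∈ Θ.source → (y' : M) ∈ Θ.source →
    (s y y' ↔ (Θ y).2.1 = (Θ y').2.1)
  zero_mem : ∀ q ∈ Θ.target, ((0, q.2.1, 0) : A × B × C) ∈ Θ.target

section

variable {EG : Type*} [NormedAddCommGroup EG] [NormedSpace ℝ EG]
    {G : Type*} [TopologicalSpace G] [ChartedSpace EG G] [Group G]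
    [LieGroup 𝓘(ℝ, EG) ∞ G]
    {E : Type*} [NormedAddCommGroup E] [NormedSpace ℝ E]
    {M : Type*} [TopologicalSpace M] [ChartedSpace E M]
    [IsManifold 𝓘(ℝ, E) ∞ M]
    [MulAction G M] [ContMDiffSMul 𝓘(ℝ, EG) 𝓘(ℝ, E) ∞ G M]
    [FiniteDimensional ℝ EG] [FiniteDimensional ℝ E]
    {k : ℕ} {Ω : Fin k → FormField E M 2} {J : M → Fin k → (EG →L[ℝ] ℝ)}
    {μ : Fin k → (EG →L[ℝ] ℝ)}

/-- A submersion is locally the last component of a chart, whose derivative at the given point is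
a prescribed isomorphism. -/
theorem exists_chart_of_submersion {A B W : Type*} [NormedAddCommGroup A] [NormedSpace ℝ A]
    [NormedAddCommGroup B] [NormedSpace ℝ B] [NormedAddCommGroup W] [NormedSpace ℝ W]
    {J : M → W} (hJ : ContMDiff 𝓘(ℝ, E) 𝓘(ℝ, W) ∞ J) (x : M)
    (Λ : (A × B × W) ≃L[ℝ] E) (hΛ : ∀ p, modelDeriv E W J x (Λ p) = p.2.2) :
    ∃ P : OpenPartialHomeomorph M (A × B × W), x ∈ P.source ∧ P x = 0 ∧
      (∀ y ∈ P.source, (P y).2.2 = J y - J x) ∧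
      ContMDiffOn 𝓘(ℝ, A × B × W) 𝓘(ℝ, E) ∞ P.symm P.target ∧
      ∀ p, modelDeriv (A × B × W) E P.symm 0 p = Λ p := by
  set φ := extChartAt 𝓘(ℝ, E) x with hφ
  have hxφ : x ∈ φ.source := mem_extChartAt_source _
  let L : E →L[ℝ] A × B × W := (Λ.symm : E →L[ℝ] A × B × W).comp (modelDeriv E E φ.symm (φ x))
  let L' : E →L[ℝ] A × B := (ContinuousLinearMap.fst ℝ A (B × W)).comp L |>.prod
    ((ContinuousLinearMap.fst ℝ B W).comp ((ContinuousLinearMap.snd ℝ A (B × W)).comp L))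
  let a : E → A × B := fun z => L' (z - φ x)
  have ha : ContDiff ℝ ∞ a := L'.contDiff.comp (contDiff_id.sub contDiff_const)
  -- The first two components of the linearized chart are kept and the third is replaced by `J - J
  -- x`. The derivative at `x` is still the inverse of `Λ`, because `dJ` is the third component of
  -- that inverse.
  let q : M → A × B × W := fun y => ((a (φ y)).1, (a (φ y)).2, J y - J x)
  have hφs : ∀ y ∈ φ.source, ContMDiffAt 𝓘(ℝ, E) 𝓘(ℝ, E) ∞ φ y := fun y hy =>
    contMDiffAt_extChartAt_self hy
  let ι₁ : (A × B) →L[ℝ] A × B × W := (ContinuousLinearMap.fst ℝ A B).prod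
    ((ContinuousLinearMap.snd ℝ A B).prod 0)
  let ι₂ : W →L[ℝ] A × B × W := (0 : W →L[ℝ] A).prod
    ((0 : W →L[ℝ] B).prod (ContinuousLinearMap.id ℝ W))
  have hq : q = fun y => ι₁ (a (φ y)) + ι₂ (J y - J x) := by
    funext y
    simp [q, ι₁, ι₂]
  have h1 : ∀ y ∈ φ.source, ContMDiffAt 𝓘(ℝ, E) 𝓘(ℝ, A × B × W) ∞ (fun y => ι₁ (a (φ y))) y :=
    fun y hy => (ι₁.contDiff.comp ha).contMDiff.contMDiffAt.comp y (hφs y hy)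
  have hι₂ : ContDiff ℝ ∞ (fun w => ι₂ (w - J x)) :=
    ι₂.contDiff.comp (contDiff_id.sub contDiff_const)
  have h2 : ContMDiff 𝓘(ℝ, E) 𝓘(ℝ, A × B × W) ∞ (fun y => ι₂ (J y - J x)) :=
    hι₂.contMDiff.comp hJ
  have hqs : ∀ y ∈ φ.source, ContMDiffAt 𝓘(ℝ, E) 𝓘(ℝ, A × B × W) ∞ q y := fun y hy => by
    rw [hq]
    exact (h1 y hy).add (h2 y)
  have hda : fderiv ℝ (fun z => ι₁ (a z)) (φ x) = ι₁.comp L' := by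
    have : HasFDerivAt a L' (φ x) := by
      have := L'.hasFDerivAt.comp (φ x) ((hasFDerivAt_id (𝕜 := ℝ) (φ x)).sub_const (φ x))
      exact this
    exact (ι₁.hasFDerivAt.comp (φ x) this).fderiv
  have hdJ : fderiv ℝ (fun w => ι₂ (w - J x)) (J x) = ι₂ :=
    (ι₂.hasFDerivAt.comp (J x) ((hasFDerivAt_id (𝕜 := ℝ) (J x)).sub_const (J x))).fderiv
  have hdq : ∀ v, modelDeriv E (A × B × W) q x v = Λ.symm v := by
    intro v
    have e0 : modelDeriv E (A × B × W) q x v =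
        modelDeriv E (A × B × W) (fun y => ι₁ (a (φ y))) x v +
        modelDeriv E (A × B × W) (fun y => ι₂ (J y - J x)) x v := by
      rw [hq]
      exact congrArg (fun T : E →L[ℝ] A × B × W => T v)
        (((h1 x hxφ).mdiffAt.hasMFDerivAt).add ((h2 x).mdiffAt.hasMFDerivAt)).mfderiv
    rw [e0, modelDeriv_comp_apply (E' := E) (g := fun z => ι₁ (a z)) (f := φ) (y := φ x)
      ((ι₁.contDiff.comp ha).differentiable (by simp) _).mdifferentiableAt (hφs x hxφ).mdiffAt rfl,
      modelDeriv_comp_apply (E' := W) (g := fun w => ι₂ (w - J x)) (f := J) (y := J x)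
      (hι₂.differentiable (by simp) _).mdifferentiableAt (hJ x).mdiffAt rfl, modelDeriv_eq_fderiv,
      modelDeriv_eq_fderiv, hda, hdJ]
    have e1 : L (modelDeriv E E φ x v) = Λ.symm v :=
      congrArg Λ.symm (modelDeriv_extChartAt_symm_apply hxφ v)
    have e2 : modelDeriv E W J x v = (Λ.symm v).2.2 := by
      rw [← hΛ, Λ.apply_symm_apply]
    rw [e2]
    refine Prod.ext ?_ (Prod.ext ?_ ?_)
    · simp [ι₁, ι₂, L', e1]
    · simp [ι₁, ι₂, L', e1]
    · simp [ι₁, ι₂]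
  obtain ⟨P, hxP, hPU, hPq, -, hPs⟩ := exists_openPartialHomeomorph_of_bijective (f := q)
    (isOpen_extChartAt_source x) hxφ (fun y hy => (hqs y hy).contMDiffWithinAt) (by
      have : (modelDeriv E (A × B × W) q x : E → A × B × W) = Λ.symm := funext hdq
      rw [this]
      exact Λ.symm.bijective)
  have hP0 : P x = 0 := by
    rw [hPq x hxP]
    simp [q, a]
  refine ⟨P, hxP, hP0, fun y hy => by rw [hPq y hy], hPs, fun p => ?_⟩
  have hPt : P x ∈ P.target := P.map_source hxP
  have hev : P =ᶠ[𝓝 x] q := by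
    filter_upwards [P.open_source.mem_nhds hxP] with y hy using hPq y hy
  have := modelDeriv_leftInverse (f := P) (g := P.symm) (x := x) (E := E) (E' := A × B × W)
    ((hqs x hxφ).mdiffAt.of_comp_eventuallyEq hev)
    ((hPs.contMDiffAt (P.open_target.mem_nhds hPt)).mdiffAt)
    (by filter_upwards [P.open_source.mem_nhds hxP] with y hy using P.left_inv hy) (Λ p)
  rwa [modelDeriv_congr hev, hdq, Λ.symm_apply_apply, hP0] at this

variable [T2Space G] [ProperSMul G M]

/-- Slice charts for the action of `G_μ` on `J⁻¹(μ)`. -/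
theorem exists_isSliceChart (hfree : ∀ (g : G) (x : M), g • x = x → g = 1)
    (hJ : IsMomentumMap G Ω J) (hJeq : IsEquivariantMomentum G J)
    (hμ : IsRegularValue (E := E) J μ) (e : ℕ)
    (he : Module.finrank ℝ (lieSubalgebraOf EG (isotropyGroup G μ)) + e +
      Module.finrank ℝ (Fin k → (EG →L[ℝ] ℝ)) = Module.finrank ℝ E) (x : LevelSet J μ) :
    ∃ Θ : OpenPartialHomeomorph M
        ((Fin (Module.finrank ℝ (lieSubalgebraOf EG (isotropyGroup G μ))) → ℝ) × (Fin e → ℝ) ×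
          (Fin k → (EG →L[ℝ] ℝ))),
      (x : M) ∈ Θ.source ∧ IsSliceChart E (fun x => J x = μ) (levelSetSetoid G J μ) Θ := by
  obtain ⟨x, hx⟩ := x
  set m := Module.finrank ℝ (lieSubalgebraOf EG (isotropyGroup G μ)) with hm
  set b := Module.finBasis ℝ (lieSubalgebraOf EG (isotropyGroup G μ)) with hb
  -- `Ψ` maps into the isotropy group, with derivative at `0` an isomorphism onto the isotropy
  -- algebra.
  obtain ⟨Ψ, hΨ, hΨ0, hΨK, hΨd⟩ := exists_smooth_map_to_subgroup (isotropyGroup G μ) m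
    (fun i => (b i : EG)) (fun i => exists_oneParameter_isotropy hJ hJeq hx
      ((mem_lieSubalgebraOf_isotropy_iff hJ hJeq hx).1 (b i).2))
  let I : (Fin m → ℝ) →ₗ[ℝ] EG := (Submodule.subtype _) ∘ₗ b.equivFun.symm.toLinearMap
  have hI : ∀ t, I t = ∑ i, t i • (b i : EG) := by
    intro t
    simp [I, Module.Basis.equivFun_symm_apply]
    rfl
  let B : (Fin m → ℝ) →L[ℝ] E := (generator EG G E x).comp I.toContinuousLinearMap
  have hgen := generator_injective_of_free (EG := EG) (E := E) hfree x
  -- The three coordinates point along the isotropy orbit, across it inside `ker dJ`, and across the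
  -- level set.
  obtain ⟨Λ, hΛB, hΛ⟩ := exists_continuousLinearEquiv_adapted
    (modelDeriv E (Fin k → (EG →L[ℝ] ℝ)) J x) (hμ x hx) B
    (hgen.comp ((Submodule.injective_subtype _).comp b.equivFun.symm.injective))
    (fun t => modelDeriv_momentum_generator_eq_zero hJ hJeq hx (b.equivFun.symm t).2) e
    (by rw [Module.finrank_fin_fun]; exact he)
  obtain ⟨P, hxP, hPx, hPJ, hPs, hPd⟩ := exists_chart_of_submersion hJ.smooth x Λ hΛ
  have hP0 : (0 : (Fin m → ℝ) × (Fin e → ℝ) × (Fin k → (EG →L[ℝ] ℝ))) ∈ P.target :=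
    hPx ▸ P.map_source hxP
  have hPs0 : P.symm 0 = x := by rw [← hPx, P.left_inv hxP]
  have hPsa : ∀ p ∈ P.target, ContMDiffAt _ 𝓘(ℝ, E) ∞ P.symm p := fun p hp =>
    hPs.contMDiffAt (P.open_target.mem_nhds hp)
  have hJP : ∀ p ∈ P.target, J (P.symm p) = μ + p.2.2 := by
    intro p hp
    have := hPJ _ (P.map_target hp)
    rw [P.right_inv hp, hx] at this
    rw [this]; abel
  -- the slice
  let j : (Fin e → ℝ) →L[ℝ] (Fin m → ℝ) × (Fin e → ℝ) × (Fin k → (EG →L[ℝ] ℝ)) :=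
    (0 : (Fin e → ℝ) →L[ℝ] (Fin m → ℝ)).prod
      ((ContinuousLinearMap.id ℝ (Fin e → ℝ)).prod 0)
  have hj : ∀ c, j c = (0, c, 0) := fun c => rfl
  have hjP : IsOpen (j ⁻¹' P.target) := P.open_target.preimage j.continuous
  have hj0 : (0 : Fin e → ℝ) ∈ j ⁻¹' P.target := by
    simp only [Set.mem_preimage, map_zero]
    exact hP0
  have hσs : ∀ c ∈ j ⁻¹' P.target, ContMDiffAt 𝓘(ℝ, Fin e → ℝ) 𝓘(ℝ, E) ∞
      (fun c => P.symm (j c)) c := fun c hc =>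
    ContMDiffAt.comp c (hPsa _ hc) j.contDiff.contMDiff.contMDiffAt
  have hσ0 : P.symm (j 0) = x := by rw [map_zero, hPs0]
  obtain ⟨V, hV, V', hV', hVinj⟩ := exists_nhds_slice_injective (G := G) (EG := EG) hjP hj0
    (σ := fun c => P.symm (j c)) (fun c hc => (hσs c hc).contMDiffWithinAt) (by
      intro ξ c h
      simp only [hσ0] at h
      have hd : modelDeriv (Fin e → ℝ) E (fun c => P.symm (j c)) 0 c = Λ (0, c, 0) := by
        rw [modelDeriv_comp_apply (g := P.symm) (f := j) (hPsa _ hP0).mdiffAt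
          j.differentiableAt.mdifferentiableAt (map_zero j), modelDeriv_eq_fderiv,
          ContinuousLinearMap.fderiv, hPd, hj]
      rw [hd] at h
      -- Applying `dJ` to the relation kills the slice direction, so `ξ` lies in the isotropy
      -- algebra. Its generator is then a first coordinate of `Λ`, and injectivity of `Λ` separates
      -- it from `c`.
      have h1 : ξ ∈ lieSubalgebraOf EG (isotropyGroup G μ) := by
        rw [mem_lieSubalgebraOf_isotropy_iff hJ hJeq hx]
        have := congrArg (modelDeriv E (Fin k → (EG →L[ℝ] ℝ)) J x) h
        rwa [map_add, hΛ, map_zero, add_zero] at this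
      have h2 : I (b.equivFun ⟨ξ, h1⟩) = ξ := by simp [I]
      have h3 : Λ (b.equivFun ⟨ξ, h1⟩, c, 0) = 0 := by
        have e1 : ((b.equivFun ⟨ξ, h1⟩, c, 0) :
            (Fin m → ℝ) × (Fin e → ℝ) × (Fin k → (EG →L[ℝ] ℝ))) =
            (b.equivFun ⟨ξ, h1⟩, 0, 0) + (0, c, 0) := by simp
        rw [e1, map_add, hΛB]
        change generator EG G E x (I _) + _ = 0
        rw [h2, h]
      have h4 := Λ.injective (h3.trans (map_zero Λ).symm)
      have h5 : b.equivFun ⟨ξ, h1⟩ = 0 := congrArg Prod.fst h4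
      have h6 : c = 0 := congrArg (fun p => p.2.1) h4
      rw [h5, map_zero] at h2
      exact ⟨h2.symm, h6⟩)
  obtain ⟨N, hN, hNV⟩ := exists_nhds_smul_mem_of_free hfree x hV
  -- the chart
  let π₂ : ((Fin m → ℝ) × (Fin e → ℝ) × (Fin k → (EG →L[ℝ] ℝ))) →L[ℝ]
      ((Fin m → ℝ) × (Fin e → ℝ) × (Fin k → (EG →L[ℝ] ℝ))) :=
    (0 : _ →L[ℝ] (Fin m → ℝ)).prod (ContinuousLinearMap.snd ℝ _ _)
  have hπ₂ : ∀ p, π₂ p = (0, p.2) := fun p => rfl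
  have hO : IsOpen (π₂ ⁻¹' P.target) := P.open_target.preimage π₂.continuous
  have h0O : (0 : (Fin m → ℝ) × (Fin e → ℝ) × (Fin k → (EG →L[ℝ] ℝ))) ∈ π₂ ⁻¹' P.target := by
    simp only [Set.mem_preimage, map_zero]
    exact hP0
  let Ψ' : (Fin m → ℝ) × (Fin e → ℝ) × (Fin k → (EG →L[ℝ] ℝ)) → G := fun p => Ψ p.1
  have hΨ' : ContMDiff 𝓘(ℝ, (Fin m → ℝ) × (Fin e → ℝ) × (Fin k → (EG →L[ℝ] ℝ))) 𝓘(ℝ, EG) ∞ Ψ' :=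
    hΨ.comp contDiff_fst.contMDiff
  have hPπ : ∀ p ∈ π₂ ⁻¹' P.target, ContMDiffAt _ 𝓘(ℝ, E) ∞ (fun p => P.symm (π₂ p)) p :=
    fun p hp => ContMDiffAt.comp p (hPsa _ hp) π₂.contDiff.contMDiff.contMDiffAt
  -- The inverse chart is `(t, c, w) ↦ Ψ t • P.symm (0, c, w)`; its derivative at `0` is `Λ`.
  have hθs : ContMDiffOn _ 𝓘(ℝ, E) ∞ (fun p => Ψ' p • P.symm (π₂ p)) (π₂ ⁻¹' P.target) :=
    fun p hp => (ContMDiffAt.comp p (contMDiff_action EG G E M _)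
      ((hΨ' p).prodMk (hPπ p hp))).contMDiffWithinAt
  obtain ⟨Θ', h0Θ, hΘO, hΘθ, hΘs, hΘs'⟩ := exists_openPartialHomeomorph_of_bijective hO h0O hθs (by
    have : (modelDeriv _ E (fun p => Ψ' p • P.symm (π₂ p)) 0 : _ → E) = Λ := by
      funext p
      have d1 : modelDeriv _ EG Ψ' 0 p = I p.1 := by
        rw [modelDeriv_comp_apply (g := Ψ) (f := Prod.fst) (y := 0) (hΨ 0).mdiffAt
          differentiableAt_fst.mdifferentiableAt rfl, modelDeriv_eq_fderiv, fderiv_fst, hΨd, hI]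
        rfl
      have d2 : modelDeriv _ E (fun p => P.symm (π₂ p)) 0 p = Λ (0, p.2) := by
        rw [modelDeriv_comp_apply (g := P.symm) (f := π₂) (hPsa _ hP0).mdiffAt
          π₂.differentiableAt.mdifferentiableAt (map_zero π₂), modelDeriv_eq_fderiv,
          ContinuousLinearMap.fderiv, hPd, hπ₂]
      rw [modelDeriv_smul_curve (hΨ' 0).mdiffAt (hPπ 0 h0O).mdiffAt hΨ0, d1, d2]
      simp only [map_zero, hPs0]
      change B p.1 + _ = _
      rw [← hΛB, ← map_add]
      exact congrArg Λ (Prod.ext (add_zero _) (zero_add _))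
    rw [this]
    exact Λ.bijective)
  have hcont : ContinuousAt (fun p => P.symm (j p.2.1))
      (0 : (Fin m → ℝ) × (Fin e → ℝ) × (Fin k → (EG →L[ℝ] ℝ))) :=
    (hσs 0 hj0).continuousAt.comp (f := fun p : (Fin m → ℝ) × (Fin e → ℝ) ×
      (Fin k → (EG →L[ℝ] ℝ)) => p.2.1) (x := 0) (by fun_prop)
  have hnhds : ∀ᶠ p in 𝓝 (0 : (Fin m → ℝ) × (Fin e → ℝ) × (Fin k → (EG →L[ℝ] ℝ))),
      p ∈ Θ'.source ∧ p.2.1 ∈ V' ∧ P.symm (j p.2.1) ∈ N := by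
    have h1 : ∀ᶠ p in 𝓝 (0 : (Fin m → ℝ) × (Fin e → ℝ) × (Fin k → (EG →L[ℝ] ℝ))), p.2.1 ∈ V' :=
      (show ContinuousAt (fun p : (Fin m → ℝ) × (Fin e → ℝ) ×
        (Fin k → (EG →L[ℝ] ℝ)) => p.2.1) 0 by fun_prop) hV'
    have h2 : N ∈ 𝓝 (P.symm (j 0)) := hσ0 ▸ hN
    filter_upwards [Θ'.open_source.mem_nhds h0Θ, h1, hcont h2] with p h3 h4 h5
    exact ⟨h3, h4, h5⟩
  -- The domain is a ball because the norm of a product is a maximum: replacing coordinates by `0`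
  -- does not leave the ball, as `zero_mem` requires.
  obtain ⟨r, hr, hball⟩ := Metric.eventually_nhds_iff_ball.1 hnhds
  set Θ := Θ'.restrOpen (Metric.ball 0 r) Metric.isOpen_ball with hΘ
  have hsrc : Θ.source = Metric.ball 0 r := by
    rw [hΘ, OpenPartialHomeomorph.restrOpen_source, Set.inter_eq_right]
    exact fun p hp => (hball p hp).1
  have hval : ∀ p ∈ Θ.source, Θ p = Ψ p.1 • P.symm (0, p.2) := fun p hp => hΘθ p hp.1
  -- Since `Ψ` fixes `μ`, equivariance gives `J = μ + coadK (Ψ t) w`, and the coadjoint action is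
  -- invertible.
  have hJΘ : ∀ p ∈ Θ.source, (J (Θ p) = μ ↔ p.2.2 = 0) := by
    intro p hp
    have h1 : coadK (Ψ p.1) μ = μ := hΨK p.1
    have h3 : J (P.symm (0, p.2)) = μ + p.2.2 := hJP _ (hΘO hp.1)
    rw [hval p hp, hJeq, h3, ← coadKL_apply, map_add, coadKL_apply, h1,
      add_eq_left]
    refine ⟨fun h => ?_, fun h => by rw [h, map_zero]⟩
    have h2 : coadK (Ψ p.1)⁻¹ (coadK (Ψ p.1) p.2.2) = p.2.2 := by
      rw [← coadK_mul, inv_mul_cancel, coadK_one]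
    rw [← h2]
    rw [coadKL_apply] at h
    change coadK (Ψ p.1)⁻¹ (coadK (Ψ p.1) p.2.2) = 0
    rw [h, ← coadKL_apply, map_zero]
  refine ⟨Θ.symm, ?_, ?_, ?_, ?_, ?_, ?_⟩
  · have h0 : (0 : (Fin m → ℝ) × (Fin e → ℝ) × (Fin k → (EG →L[ℝ] ℝ))) ∈ Θ.source := by
      rw [hsrc]; exact Metric.mem_ball_self hr
    have h1 : Θ 0 = x := by
      rw [hval 0 h0]
      change Ψ 0 • P.symm 0 = x
      rw [hΨ0, one_smul, hPs0]
    have h2 := Θ.map_source h0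
    rw [h1] at h2
    exact h2
  · exact hΘs'.mono (by rw [hΘ]; exact Set.inter_subset_left)
  · exact hΘs.mono Set.inter_subset_left
  · intro y hy
    have := hJΘ _ (Θ.map_target hy)
    rwa [Θ.right_inv hy] at this
  · rintro ⟨y, hy⟩ ⟨y', hy'⟩ hys hys'
    have ht := Θ.map_target hys
    have ht' := Θ.map_target hys'
    have e1 := hval _ ht
    have e1' := hval _ ht'
    have z1 := (hJΘ _ ht).1 (by rw [Θ.right_inv hys]; exact hy)
    have z1' := (hJΘ _ ht').1 (by rw [Θ.right_inv hys']; exact hy')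
    rw [Θ.right_inv hys] at e1
    rw [Θ.right_inv hys'] at e1'
    change y = _ at e1
    change y' = _ at e1'
    set p := Θ.symm y with hp
    set p' := Θ.symm y' with hp'
    change (∃ g ∈ isotropyGroup G μ, g • y = y') ↔ p.2.1 = p'.2.1
    have s1 : ((0, p.2) : (Fin m → ℝ) × (Fin e → ℝ) × (Fin k → (EG →L[ℝ] ℝ))) = j p.2.1 := by
      rw [hj, ← z1]
    have s1' : ((0, p'.2) : (Fin m → ℝ) × (Fin e → ℝ) × (Fin k → (EG →L[ℝ] ℝ))) = j p'.2.1 := by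
      rw [hj, ← z1']
    rw [s1] at e1
    rw [s1'] at e1'
    rw [hsrc] at ht ht'
    constructor
    -- Moving both points back to the slice turns `g` into `(Ψ t')⁻¹ * g * Ψ t`. This element maps a
    -- slice point in `N` into `N`, so it lies in `V`, where the slice is met at most once.
    · rintro ⟨g, -, hg⟩
      have h1 : ((Ψ p'.1)⁻¹ * g * Ψ p.1) • P.symm (j p.2.1) = P.symm (j p'.2.1) := by
        rw [mul_smul, mul_smul, ← e1, hg, e1', inv_smul_smul]
      exact hVinj _ (hNV _ _ (hball _ ht).2.2 (h1 ▸ (hball _ ht').2.2)) _ (hball _ ht).2.1 _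
        (hball _ ht').2.1 h1
    · intro h
      refine ⟨Ψ p'.1 * (Ψ p.1)⁻¹, mul_mem (hΨK _) (inv_mem (hΨK _)), ?_⟩
      rw [e1, e1', h, mul_smul, inv_smul_smul]
  · intro q hq
    change q ∈ Θ.source at hq
    change _ ∈ Θ.source
    rw [hsrc, mem_ball_zero_iff] at hq ⊢
    refine lt_of_le_of_lt ?_ hq
    simp only [Prod.norm_def, norm_zero]
    have := norm_nonneg q.1
    have := norm_nonneg q.2.1
    have := norm_nonneg q.2.2
    refine max_le (by positivity) (le_max_of_le_right (max_le (le_max_left _ _) (by positivity)))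

end

/-! ### Manifold structures on a subset and on its quotient from slice charts -/

section SliceAtlas

variable {E M A B C : Type*} [NormedAddCommGroup E] [NormedSpace ℝ E]
    [TopologicalSpace M] [ChartedSpace E M] [NormedAddCommGroup A] [NormedSpace ℝ A]
    [NormedAddCommGroup B] [NormedSpace ℝ B] [NormedAddCommGroup C] [NormedSpace ℝ C]
    {p : M → Prop} {s : Setoid (Subtype p)} {Θ : OpenPartialHomeomorph M (A × B × C)}
    {D D' : Type*} [NormedAddCommGroup D] [NormedSpace ℝ D]
    [NormedAddCommGroup D'] [NormedSpace ℝ D']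

/-- The parametrization `u ↦ (u, 0)` of the slice coordinates of the subset. -/
def levelParam (C : Type*) [NormedAddCommGroup C] [NormedSpace ℝ C] (l : (A × B) ≃L[ℝ] D) :
    D →L[ℝ] A × B × C :=
  ((ContinuousLinearMap.fst ℝ A B).prod ((ContinuousLinearMap.snd ℝ A B).prod 0)).comp
    (l.symm : D →L[ℝ] A × B)

/-- The projection onto the slice coordinates of the subset. -/
def levelCoord (C : Type*) [NormedAddCommGroup C] [NormedSpace ℝ C] (l : (A × B) ≃L[ℝ] D) :
    A × B × C →L[ℝ] D :=
  (l : (A × B) →L[ℝ] D).comp ((ContinuousLinearMap.fst ℝ A (B × C)).prod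
    ((ContinuousLinearMap.fst ℝ B C).comp (ContinuousLinearMap.snd ℝ A (B × C))))

/-- The parametrization `b ↦ (0, b, 0)` of the slice coordinates of the quotient. -/
def quotParam (A C : Type*) [NormedAddCommGroup A] [NormedSpace ℝ A] [NormedAddCommGroup C]
    [NormedSpace ℝ C] (l : B ≃L[ℝ] D') : D' →L[ℝ] A × B × C :=
  (0 : D' →L[ℝ] A).prod ((l.symm : D' →L[ℝ] B).prod 0)

/-- The projection onto the slice coordinates of the quotient. -/
def quotCoord (A C : Type*) [NormedAddCommGroup A] [NormedSpace ℝ A] [NormedAddCommGroup C]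
    [NormedSpace ℝ C] (l : B ≃L[ℝ] D') : A × B × C →L[ℝ] D' :=
  (l : B →L[ℝ] D').comp
    ((ContinuousLinearMap.fst ℝ B C).comp (ContinuousLinearMap.snd ℝ A (B × C)))

theorem levelParam_apply (l : (A × B) ≃L[ℝ] D) (u : D) :
    levelParam C l u = ((l.symm u).1, (l.symm u).2, 0) := rfl

theorem levelCoord_apply (l : (A × B) ≃L[ℝ] D) (q : A × B × C) :
    levelCoord C l q = l (q.1, q.2.1) := rfl

theorem quotParam_apply (l : B ≃L[ℝ] D') (b : D') :
    quotParam A C l b = (0, l.symm b, 0) := rfl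

theorem quotCoord_apply (l : B ≃L[ℝ] D') (q : A × B × C) : quotCoord A C l q = l q.2.1 := rfl

theorem levelParam_levelCoord (l : (A × B) ≃L[ℝ] D) {q : A × B × C} (hq : q.2.2 = 0) :
    levelParam C l (levelCoord C l q) = q := by
  rw [levelParam_apply, levelCoord_apply, l.symm_apply_apply, ← hq]

theorem levelCoord_levelParam (l : (A × B) ≃L[ℝ] D) (u : D) :
    levelCoord C l (levelParam C l u) = u := by
  rw [levelParam_apply, levelCoord_apply]
  exact l.apply_symm_apply u

theorem quotCoord_quotParam (l : B ≃L[ℝ] D') (b : D') :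
    quotCoord A C l (quotParam A C l b) = b := by
  rw [quotParam_apply, quotCoord_apply, l.apply_symm_apply]

/-- On the subset the last slice coordinate vanishes and can be dropped. The point `x` only supplies
the value of the inverse outside the target. -/
theorem IsSliceChart.exists_levelChart (h : IsSliceChart E p s Θ) (l : (A × B) ≃L[ℝ] D)
    (x : Subtype p) : ∃ χ : OpenPartialHomeomorph (Subtype p) D,
      χ.source = Subtype.val ⁻¹' Θ.source ∧ (∀ y, χ y = levelCoord C l (Θ y)) ∧
      χ.target = levelParam C l ⁻¹' Θ.target ∧
      ∀ u ∈ χ.target, (χ.symm u : M) = Θ.symm (levelParam C l u) := by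
  classical
  have hp : ∀ u ∈ levelParam C l ⁻¹' Θ.target, p (Θ.symm (levelParam C l u)) := by
    intro u hu
    rw [h.mem_iff _ (Θ.map_target hu), Θ.right_inv hu, levelParam_apply]
  let inv : D → Subtype p := fun u =>
    if hu : p (Θ.symm (levelParam C l u)) then ⟨_, hu⟩ else x
  have hinv : ∀ u ∈ levelParam C l ⁻¹' Θ.target, (inv u : M) = Θ.symm (levelParam C l u) := by
    intro u hu
    simp only [inv, dif_pos (hp u hu)]
  have hpc : ∀ y : Subtype p, (y : M) ∈ Θ.source →
      levelParam C l (levelCoord C l (Θ y)) = Θ y := fun y hy =>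
    levelParam_levelCoord l ((h.mem_iff y hy).1 y.2)
  let χ : OpenPartialHomeomorph (Subtype p) D :=
    { toFun := fun y => levelCoord C l (Θ y)
      invFun := inv
      source := Subtype.val ⁻¹' Θ.source
      target := levelParam C l ⁻¹' Θ.target
      map_source' := fun y hy => by
        simp only [Set.mem_preimage, hpc y hy]
        exact Θ.map_source hy
      map_target' := fun u hu => by
        simp only [Set.mem_preimage, hinv u hu]
        exact Θ.map_target hu
      left_inv' := fun y hy => by
        apply Subtype.ext
        rw [hinv, hpc y hy, Θ.left_inv hy]
        simp only [Set.mem_preimage, hpc y hy]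
        exact Θ.map_source hy
      right_inv' := fun u hu => by
        rw [hinv u hu, Θ.right_inv hu, levelCoord_levelParam]
      open_source := Θ.open_source.preimage continuous_subtype_val
      open_target := Θ.open_target.preimage (levelParam C l).continuous
      continuousOn_toFun := (levelCoord C l).continuous.comp_continuousOn
        (Θ.continuousOn.comp continuous_subtype_val.continuousOn fun y hy => hy)
      continuousOn_invFun := by
        refine (Topology.IsEmbedding.subtypeVal (p := p)).isInducing.continuousOn_iff.2 ?_
        exact (Θ.continuousOn_symm.comp (levelParam C l).continuous.continuousOn
          fun u hu => hu).congr hinv }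
  exact ⟨χ, rfl, fun y => rfl, rfl, hinv⟩

/-- The chart is built from its inverse, which sends `b` to the class of the point with slice
coordinates `(0, b, 0)`. `rel_iff` gives injectivity, `zero_mem` lets every class met by the slice
chart be reached, and openness of the projection gives a homeomorphism onto an open set. -/
theorem IsSliceChart.exists_quotChart (h : IsSliceChart E p s Θ) (l : B ≃L[ℝ] D')
    (hopen : IsOpenMap (Quotient.mk s)) (x : Subtype p) :
    ∃ χ : OpenPartialHomeomorph (Quotient s) D',
      (∀ y : Subtype p, (y : M) ∈ Θ.source → Quotient.mk s y ∈ χ.source) ∧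
      (∀ y : Subtype p, (y : M) ∈ Θ.source → χ (Quotient.mk s y) = quotCoord A C l (Θ y)) ∧
      χ.target = quotParam A C l ⁻¹' Θ.target ∧
      ∀ b ∈ χ.target, ∃ y : Subtype p, (y : M) = Θ.symm (quotParam A C l b) ∧
        χ.symm b = Quotient.mk s y := by
  classical
  have : Nonempty D' := ⟨0⟩
  have hp : ∀ b ∈ quotParam A C l ⁻¹' Θ.target, p (Θ.symm (quotParam A C l b)) := by
    intro u hu
    rw [h.mem_iff _ (Θ.map_target hu), Θ.right_inv hu, quotParam_apply]
  let inv : D' → Subtype p := fun u =>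
    if hu : p (Θ.symm (quotParam A C l u)) then ⟨_, hu⟩ else x
  have hinv : ∀ u ∈ quotParam A C l ⁻¹' Θ.target, (inv u : M) = Θ.symm (quotParam A C l u) := by
    intro u hu
    simp only [inv, dif_pos (hp u hu)]
  have hsrc : ∀ u ∈ quotParam A C l ⁻¹' Θ.target, (inv u : M) ∈ Θ.source := fun u hu => by
    rw [hinv u hu]; exact Θ.map_target hu
  have hΘinv : ∀ u ∈ quotParam A C l ⁻¹' Θ.target, Θ (inv u) = quotParam A C l u := fun u hu => by
    rw [hinv u hu, Θ.right_inv hu]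
  let f : D' → Quotient s := fun u => Quotient.mk s (inv u)
  have hO : IsOpen (quotParam A C l ⁻¹' Θ.target) :=
    Θ.open_target.preimage (quotParam A C l).continuous
  have hmem : ∀ y : Subtype p, (y : M) ∈ Θ.source →
      quotCoord A C l (Θ y) ∈ quotParam A C l ⁻¹' Θ.target := by
    intro y hy
    have := h.zero_mem _ (Θ.map_source hy)
    simpa [quotCoord_apply, quotParam_apply] using this
  have hf : ∀ y : Subtype p, (y : M) ∈ Θ.source →
      f (quotCoord A C l (Θ y)) = Quotient.mk s y := by
    intro y hy
    apply Quotient.sound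
    change s _ _
    rw [h.rel_iff _ _ (hsrc _ (hmem y hy)) hy, hΘinv _ (hmem y hy), quotParam_apply,
      quotCoord_apply, l.symm_apply_apply]
  have hinj : Set.InjOn f (quotParam A C l ⁻¹' Θ.target) := by
    intro u hu v hv huv
    have h1 : s (inv u) (inv v) := Quotient.exact huv
    rw [h.rel_iff _ _ (hsrc u hu) (hsrc v hv), hΘinv u hu, hΘinv v hv] at h1
    exact l.symm.injective h1
  have hcinv : ContinuousOn inv (quotParam A C l ⁻¹' Θ.target) := by
    refine (Topology.IsEmbedding.subtypeVal (p := p)).isInducing.continuousOn_iff.2 ?_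
    exact (Θ.continuousOn_symm.comp (quotParam A C l).continuous.continuousOn
      fun u hu => hu).congr hinv
  have hcont : ContinuousOn f (quotParam A C l ⁻¹' Θ.target) :=
    continuous_quotient_mk'.comp_continuousOn hcinv
  have hopenf : ∀ U ⊆ quotParam A C l ⁻¹' Θ.target, IsOpen U → IsOpen (f '' U) := by
    intro U hU hUo
    have : f '' U = Quotient.mk s '' {y : Subtype p | (y : M) ∈ Θ.source ∧
        quotCoord A C l (Θ y) ∈ U} := by
      apply Set.Subset.antisymm
      · rintro _ ⟨u, hu, rfl⟩
        refine ⟨inv u, ⟨hsrc u (hU hu), ?_⟩, rfl⟩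
        rwa [hΘinv u (hU hu), quotCoord_quotParam]
      · rintro _ ⟨y, ⟨hy, hyU⟩, rfl⟩
        exact ⟨_, hyU, hf y hy⟩
    rw [this]
    apply hopen
    exact ((quotCoord A C l).continuous.comp_continuousOn Θ.continuousOn).isOpen_inter_preimage
      Θ.open_source hUo |>.preimage continuous_subtype_val
  let e := (hinj.bijOn_image).toPartialEquiv
  let χ := (OpenPartialHomeomorph.ofContinuousOpenRestrict e hcont (by
    intro U hU
    rw [Set.domRestrict_eq, Set.image_comp]
    exact hopenf _ (by rintro _ ⟨⟨u, hu⟩, -, rfl⟩; exact hu)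
      (hO.isOpenMap_subtype_val U hU)) hO).symm
  have hχs : ∀ b, χ.symm b = f b := fun b => rfl
  refine ⟨χ, fun y hy => ?_, fun y hy => ?_, rfl, fun b hb => ⟨inv b, hinv b hb, rfl⟩⟩
  · rw [← hf y hy, ← hχs]
    exact χ.map_target (hmem y hy)
  · rw [← hf y hy, ← hχs]
    exact χ.right_inv (hmem y hy)

variable [IsManifold 𝓘(ℝ, E) ∞ M]

theorem IsSliceChart.contMDiffAt (h : IsSliceChart E p s Θ) {y : M} (hy : y ∈ Θ.source) :
    ContMDiffAt 𝓘(ℝ, E) 𝓘(ℝ, A × B × C) ∞ Θ y :=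
  h.smooth.contMDiffAt (Θ.open_source.mem_nhds hy)

theorem IsSliceChart.contMDiffAt_symm (h : IsSliceChart E p s Θ) {q : A × B × C}
    (hq : q ∈ Θ.target) : ContMDiffAt 𝓘(ℝ, A × B × C) 𝓘(ℝ, E) ∞ Θ.symm q :=
  h.smooth_symm.contMDiffAt (Θ.open_target.mem_nhds hq)

end SliceAtlas

section Structures

universe u
variable {E : Type u} {M C : Type*} [NormedAddCommGroup E] [NormedSpace ℝ E]
    [FiniteDimensional ℝ E]
    [TopologicalSpace M] [ChartedSpace E M] [IsManifold 𝓘(ℝ, E) ∞ M]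
    {A B D D' : Type} [NormedAddCommGroup A] [NormedSpace ℝ A] [FiniteDimensional ℝ A]
    [NormedAddCommGroup B] [NormedSpace ℝ B] [FiniteDimensional ℝ B]
    [NormedAddCommGroup C] [NormedSpace ℝ C] [FiniteDimensional ℝ C]
    [NormedAddCommGroup D] [NormedSpace ℝ D] [NormedAddCommGroup D'] [NormedSpace ℝ D']
    {p : M → Prop} {s : Setoid (Subtype p)}

/-- A subset with an equivalence relation that are covered by slice charts, where equivalent points
are related by smooth maps preserving the equivalence classes, is an embedded submanifold with a
quotient manifold. -/
theorem exists_manifold_structures_of_sliceCharts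
    (hslice : ∀ x : Subtype p, ∃ Θ : OpenPartialHomeomorph M (A × B × C),
      (x : M) ∈ Θ.source ∧ IsSliceChart E p s Θ)
    (htrans : ∀ x y : Subtype p, s x y → ∃ h : M → M, ContMDiff 𝓘(ℝ, E) 𝓘(ℝ, E) ∞ h ∧
      (∀ z : Subtype p, ∃ hz : p (h z), s z ⟨h z, hz⟩) ∧ h x = y)
    (hopen : IsOpenMap (Quotient.mk s)) (l : (A × B) ≃L[ℝ] D) (l' : B ≃L[ℝ] D')
    (lE : (A × B × C) ≃L[ℝ] E) :
    ∃ (_ : ChartedSpace D (Subtype p)) (_ : IsManifold 𝓘(ℝ, D) ∞ (Subtype p))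
      (_ : ChartedSpace D' (Quotient s)) (_ : IsManifold 𝓘(ℝ, D') ∞ (Quotient s)),
      IsSmoothEmbedding 𝓘(ℝ, D) 𝓘(ℝ, E) ∞ (Subtype.val : Subtype p → M) ∧
      IsSubmersion 𝓘(ℝ, D) 𝓘(ℝ, D') ∞ (Quotient.mk s) := by
  choose Θ hxΘ hΘ using hslice
  choose χ hχs hχ hχt hχi using fun x => (hΘ x).exists_levelChart l x
  choose χ' hχ's hχ' hχ't hχ'i using fun x => (hΘ x).exists_quotChart l' hopen x
  let cN : ChartedSpace D (Subtype p) :=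
    { atlas := Set.range χ
      chartAt := χ
      mem_chart_source := fun x => by rw [hχs]; exact hxΘ x
      chart_mem_atlas := fun x => Set.mem_range_self x }
  let cQ : ChartedSpace D' (Quotient s) :=
    { atlas := Set.range χ'
      chartAt := fun q => χ' q.out
      mem_chart_source := fun q => by
        have := hχ's q.out q.out (hxΘ _)
        rwa [Quotient.out_eq] at this
      chart_mem_atlas := fun q => Set.mem_range_self _ }
  have mN : IsManifold 𝓘(ℝ, D) ∞ (Subtype p) := by
    apply isManifold_of_contDiffOn
    rintro _ _ ⟨x, rfl⟩ ⟨y, rfl⟩ u hu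
    simp only [modelWithCornersSelf_coe, modelWithCornersSelf_coe_symm, Set.range_id,
      Set.inter_univ, Set.preimage_id_eq, id_eq, OpenPartialHomeomorph.trans_source,
      OpenPartialHomeomorph.symm_source, Set.mem_inter_iff, Set.mem_preimage] at hu
    obtain ⟨hu1, hu2⟩ := hu
    have hu1' := hu1
    rw [hχs, Set.mem_preimage, hχi x u hu1] at hu2
    rw [hχt, Set.mem_preimage] at hu1
    have h1 : ContMDiffAt 𝓘(ℝ, D) 𝓘(ℝ, D) ∞
        (fun u => levelCoord C l (Θ y ((Θ x).symm (levelParam C l u)))) u :=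
      ContMDiffAt.comp u (levelCoord C l).contDiff.contMDiff.contMDiffAt
        (ContMDiffAt.comp u ((hΘ y).contMDiffAt hu2) (ContMDiffAt.comp u
          ((hΘ x).contMDiffAt_symm hu1) (levelParam C l).contDiff.contMDiff.contMDiffAt))
    refine ((contMDiffAt_iff_contDiffAt.1 h1).congr_of_eventuallyEq ?_).contDiffWithinAt
    filter_upwards [(χ x).open_target.mem_nhds hu1'] with v hv
    change χ y ((χ x).symm v) = _
    rw [hχ, hχi x v hv]
  have mQ : IsManifold 𝓘(ℝ, D') ∞ (Quotient s) := by
    apply isManifold_of_contDiffOn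
    rintro _ _ ⟨x, rfl⟩ ⟨y, rfl⟩ u hu
    simp only [modelWithCornersSelf_coe, modelWithCornersSelf_coe_symm, Set.range_id,
      Set.inter_univ, Set.preimage_id_eq, id_eq, OpenPartialHomeomorph.trans_source,
      OpenPartialHomeomorph.symm_source, Set.mem_inter_iff, Set.mem_preimage] at hu
    obtain ⟨hu1, hu2⟩ := hu
    have hu1' := hu1
    obtain ⟨z, hz, hzu⟩ := hχ'i x u hu1
    have hv := (χ' y).map_source hu2
    obtain ⟨w, hw, hwv⟩ := hχ'i y _ hv
    rw [(χ' y).left_inv hu2, hzu] at hwv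
    -- The two quotient charts may represent the same class by different points `z` and `w`. The
    -- symmetry `h` taking `z` to `w` exhibits the coordinate change as a composition of smooth maps
    -- through `M`.
    obtain ⟨h, hsm, hh, hhz⟩ := htrans z w (Quotient.exact hwv)
    rw [hχ't, Set.mem_preimage] at hu1 hv
    have hws : h ((Θ x).symm (quotParam A C l' u)) ∈ (Θ y).source := by
      rw [← hz, hhz, hw]
      exact (Θ y).map_target hv
    have h1 : ContMDiffAt 𝓘(ℝ, D') 𝓘(ℝ, E) ∞
        (fun u => h ((Θ x).symm (quotParam A C l' u))) u :=
      ContMDiffAt.comp u (hsm _) (ContMDiffAt.comp u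
          ((hΘ x).contMDiffAt_symm hu1) (quotParam A C l').contDiff.contMDiff.contMDiffAt)
    have h2 : ContMDiffAt 𝓘(ℝ, D') 𝓘(ℝ, D') ∞
        (fun u => quotCoord A C l' (Θ y (h ((Θ x).symm (quotParam A C l' u))))) u :=
      ContMDiffAt.comp u (quotCoord A C l').contDiff.contMDiff.contMDiffAt
        (ContMDiffAt.comp u ((hΘ y).contMDiffAt hws) h1)
    refine ((contMDiffAt_iff_contDiffAt.1 h2).congr_of_eventuallyEq ?_).contDiffWithinAt
    filter_upwards [(χ' x).open_target.mem_nhds hu1',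
      h1.continuousAt ((Θ y).open_source.mem_nhds hws)] with v hv1 hv2
    change χ' y ((χ' x).symm v) = _
    obtain ⟨z', hz', hzv⟩ := hχ'i x v hv1
    obtain ⟨hpz, hsz⟩ := hh z'
    have h3 : Quotient.mk s z' = Quotient.mk s ⟨h z', hpz⟩ := Quotient.sound hsz
    have h4 : h (z' : M) ∈ (Θ y).source := by rw [hz']; exact hv2
    rw [hzv, h3, hχ' y ⟨h z', hpz⟩ h4]
    change quotCoord A C l' (Θ y (h (z' : M))) = _
    rw [hz']
  refine ⟨cN, mN, cQ, mQ, ⟨?_, Topology.IsEmbedding.subtypeVal⟩, ?_⟩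
  -- The complement `C` is replaced by an isomorphic copy in the universe of `E`.
  · let lC : ULift.{u} (Fin (Module.finrank ℝ C) → ℝ) ≃L[ℝ] C :=
      (LinearEquiv.ofFinrankEq _ _ (by
        rw [LinearEquiv.finrank_eq (ULift.moduleEquiv (R := ℝ)), Module.finrank_fin_fun])
          : _ ≃ₗ[ℝ] C).toContinuousLinearEquiv
    let eq : (D × ULift.{u} (Fin (Module.finrank ℝ C) → ℝ)) ≃L[ℝ] E :=
      ((l.symm.prodCongr lC).trans (ContinuousLinearEquiv.prodAssoc ℝ A B C)).trans lE
    refine ⟨ULift.{u} (Fin (Module.finrank ℝ C) → ℝ), inferInstance, inferInstance, fun x => ?_⟩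
    refine IsImmersionAtOfComplement.mk_of_charts eq (χ x)
      ((Θ x).trans lE.toHomeomorph.toOpenPartialHomeomorph) ?_ ?_ ?_ ?_ ?_ ?_
    · rw [hχs]; exact hxΘ x
    · simpa using hxΘ x
    · exact IsManifold.subset_maximalAtlas (Set.mem_range_self x)
    · refine OpenPartialHomeomorph.mem_maximalAtlas_of_contMDiffOn _ ?_ ?_
      · intro y hy
        have hy' : y ∈ (Θ x).source := by simpa using hy
        exact (ContMDiffAt.comp y lE.contDiff.contMDiff.contMDiffAt
          ((hΘ x).contMDiffAt hy')).contMDiffWithinAt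
      · intro v hv
        have hv' : lE.symm v ∈ (Θ x).target := by simpa using hv
        exact (ContMDiffAt.comp v ((hΘ x).contMDiffAt_symm hv')
          lE.symm.contDiff.contMDiff.contMDiffAt).contMDiffWithinAt
    · intro y hy
      rw [hχs] at hy
      simpa using hy
    · intro v hv
      have hv' : v ∈ (χ x).target := by simpa using hv
      have hv'' := hv'
      rw [hχt, Set.mem_preimage] at hv''
      change lE (Θ x ((χ x).symm v)) = eq (v, 0)
      rw [hχi x v hv', (Θ x).right_inv hv'', levelParam_apply]
      change lE _ = lE ((l.symm v).1, (l.symm v).2, lC 0)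
      rw [map_zero]
  · let eq : D ≃L[ℝ] D' × A :=
      l.symm.trans ((ContinuousLinearEquiv.prodComm ℝ A B).trans
        (l'.prodCongr (ContinuousLinearEquiv.refl ℝ A)))
    refine ⟨A, inferInstance, inferInstance, fun x => ?_⟩
    refine IsSubmersionAtOfComplement.mk_of_charts eq (χ x) (χ' x) ?_ ?_ ?_ ?_ ?_ ?_
    · rw [hχs]; exact hxΘ x
    · exact hχ's x x (hxΘ x)
    · exact IsManifold.subset_maximalAtlas (Set.mem_range_self x)
    · exact IsManifold.subset_maximalAtlas (Set.mem_range_self x)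
    · intro y hy
      rw [hχs] at hy
      exact hχ's x y hy
    · intro v hv
      have hv' : v ∈ (χ x).target := by simpa using hv
      have hv'' := hv'
      rw [hχt, Set.mem_preimage] at hv''
      change χ' x (Quotient.mk s ((χ x).symm v)) = (eq v).1
      have hs : ((χ x).symm v : M) ∈ (Θ x).source := by
        rw [hχi x v hv']; exact (Θ x).map_target hv''
      rw [hχ' x _ hs, hχi x v hv', (Θ x).right_inv hv'', levelParam_apply, quotCoord_apply]
      rfl

end Structures

/-! ### Local left inverses of immersions and local sections of submersions -/

section LocalInverses

variable {E : Type*} [NormedAddCommGroup E] [NormedSpace ℝ E]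
  {E' : Type*} [NormedAddCommGroup E'] [NormedSpace ℝ E']
  {M : Type*} [TopologicalSpace M] [ChartedSpace E M] [IsManifold 𝓘(ℝ, E) ∞ M]
  {N : Type*} [TopologicalSpace N] [ChartedSpace E' N] [IsManifold 𝓘(ℝ, E') ∞ N]

/-- An immersion has smooth local left inverses. -/
theorem exists_leftInverse_of_isImmersion {f : N → M}
    (hf : IsImmersion 𝓘(ℝ, E') 𝓘(ℝ, E) ∞ f) (x : N) :
    ∃ r : M → N, ContMDiffAt 𝓘(ℝ, E) 𝓘(ℝ, E') ∞ r (f x) ∧ ∀ᶠ z in 𝓝 x, r (f z) = z := by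
  have h := hf.isImmersionAt x
  have hw := h.writtenInCharts
  have hd := h.domChart_mem_maximalAtlas
  have hc := h.codChart_mem_maximalAtlas
  have hxd := h.mem_domChart_source
  have hxc := h.mem_codChart_source
  have hss := h.source_subset_preimage_source
  set φ := h.domChart
  set ψ := h.codChart
  have key : ∀ z ∈ φ.source, (h.equiv.symm (ψ (f z))).1 = φ z := by
    intro z hz
    have h1 := hw (x := φ z) (by simpa using φ.map_source hz)
    simp only [Function.comp, OpenPartialHomeomorph.extend_coe, modelWithCornersSelf_coe, id,
      OpenPartialHomeomorph.extend_coe_symm, modelWithCornersSelf_coe_symm, φ.left_inv hz] at h1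
    rw [h1, ContinuousLinearEquiv.symm_apply_apply]
  refine ⟨fun y => φ.symm (h.equiv.symm (ψ y)).1, ?_, ?_⟩
  · have h1 : ContMDiffAt 𝓘(ℝ, E) 𝓘(ℝ, E') ∞ (fun y => (h.equiv.symm (ψ y)).1) (f x) := by
      have h2 : ContMDiffAt 𝓘(ℝ, E) 𝓘(ℝ, E) ∞ ψ (f x) :=
        contMDiffAt_of_mem_maximalAtlas hc hxc
      exact (contDiff_fst.comp h.equiv.symm.contDiff).contMDiff.contMDiffAt.comp (f x) h2
    refine ContMDiffAt.comp (f x) (g := φ.symm) ?_ h1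
    rw [key x hxd]
    exact contMDiffAt_symm_of_mem_maximalAtlas hd (φ.map_source hxd)
  · filter_upwards [φ.open_source.mem_nhds hxd] with z hz
    rw [key z hz, φ.left_inv hz]

/-- A submersion has smooth local sections through every point. -/
theorem exists_section_of_isSubmersion {f : N → M}
    (hf : IsSubmersion 𝓘(ℝ, E') 𝓘(ℝ, E) ∞ f) (x : N) :
    ∃ σ : M → N, σ (f x) = x ∧ (∀ᶠ z in 𝓝 (f x), ContMDiffAt 𝓘(ℝ, E) 𝓘(ℝ, E') ∞ σ z) ∧
      ∀ᶠ z in 𝓝 (f x), f (σ z) = z := by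
  have h := hf.isSubmersionAt x
  have hw := h.writtenInCharts
  have hd := h.domChart_mem_maximalAtlas
  have hc := h.codChart_mem_maximalAtlas
  have hxd := h.mem_domChart_source
  have hxc := h.mem_codChart_source
  have hss := h.source_subset_preimage_source
  set φ := h.domChart
  set ψ := h.codChart
  have key : ∀ z ∈ φ.source, ψ (f z) = (h.equiv (φ z)).1 := by
    intro z hz
    have h1 := hw (x := φ z) (by simpa using φ.map_source hz)
    simpa only [Function.comp, OpenPartialHomeomorph.extend_coe, modelWithCornersSelf_coe, id,
      OpenPartialHomeomorph.extend_coe_symm, modelWithCornersSelf_coe_symm, φ.left_inv hz] using h1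
  -- The section keeps the fibre coordinate frozen at its value for `x`.
  let τ : M → E' := fun q => h.equiv.symm (ψ q, (h.equiv (φ x)).2)
  have hτx : τ (f x) = φ x := by
    simp only [τ, key x hxd]
    exact h.equiv.symm_apply_apply _
  have hτ : ∀ q ∈ ψ.source, ContMDiffAt 𝓘(ℝ, E) 𝓘(ℝ, E') ∞ τ q := fun q hq =>
    (h.equiv.symm.contDiff.comp (contDiff_id.prodMk contDiff_const)).contMDiff.contMDiffAt.comp q
      (contMDiffAt_of_mem_maximalAtlas hc hq)
  have hev : ∀ᶠ q in 𝓝 (f x), q ∈ ψ.source ∧ τ q ∈ φ.target :=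
    Filter.Eventually.and (ψ.open_source.mem_nhds hxc) ((hτ _ hxc).continuousAt.eventually_mem
      (φ.open_target.mem_nhds (by rw [hτx]; exact φ.map_source hxd)))
  refine ⟨fun q => φ.symm (τ q), (congrArg φ.symm hτx).trans (φ.left_inv hxd), ?_, ?_⟩
  · filter_upwards [hev] with q hq
    exact ContMDiffAt.comp q (contMDiffAt_symm_of_mem_maximalAtlas hd hq.2) (hτ q hq.1)
  · filter_upwards [hev] with q hq
    have hs := φ.map_target hq.2
    apply ψ.injOn (hss hs) hq.1
    rw [key _ hs, φ.right_inv hq.2]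
    simp [τ]

theorem injective_modelDeriv_of_isImmersion {f : N → M}
    (hf : IsImmersion 𝓘(ℝ, E') 𝓘(ℝ, E) ∞ f) (x : N) :
    Function.Injective (modelDeriv E' E f x) := by
  obtain ⟨r, hr, hrf⟩ := exists_leftInverse_of_isImmersion hf x
  refine Function.LeftInverse.injective (g := modelDeriv E E' r (f x)) fun v => ?_
  rw [← modelDeriv_comp_apply (g := r) (f := f) hr.mdiffAt (hf.contMDiff x).mdiffAt rfl v,
    modelDeriv_congr hrf]
  exact congrArg (fun L : E' →L[ℝ] E' => L v) (modelDeriv_id x)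

theorem surjective_modelDeriv_of_isSubmersion {f : N → M}
    (hf : IsSubmersion 𝓘(ℝ, E') 𝓘(ℝ, E) ∞ f) (x : N) :
    Function.Surjective (modelDeriv E' E f x) := by
  obtain ⟨σ, hσx, hσ, hfσ⟩ := exists_section_of_isSubmersion hf x
  refine Function.RightInverse.surjective (g := modelDeriv E E' σ (f x)) fun v => ?_
  rw [← modelDeriv_comp_apply (g := f) (f := σ) (hf.contMDiff _).mdiffAt hσ.self_of_nhds.mdiffAt
    hσx v, modelDeriv_congr hfσ]
  exact congrArg (fun L : E →L[ℝ] E => L v) (modelDeriv_id _)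

end LocalInverses

/-! ### Topology and smooth structure of the reduced space -/

section ReducedSpace

variable {EG : Type*} [NormedAddCommGroup EG] [NormedSpace ℝ EG] [FiniteDimensional ℝ EG]
    {G : Type*} [TopologicalSpace G] [ChartedSpace EG G] [Group G]
    [LieGroup 𝓘(ℝ, EG) ∞ G]
    {E : Type*} [NormedAddCommGroup E] [NormedSpace ℝ E] [FiniteDimensional ℝ E]
    {M : Type*} [TopologicalSpace M] [ChartedSpace E M]
    [IsManifold 𝓘(ℝ, E) ∞ M]
    [MulAction G M] [ContMDiffSMul 𝓘(ℝ, EG) 𝓘(ℝ, E) ∞ G M]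
    {k : ℕ} {Ω : Fin k → FormField E M 2} {J : M → Fin k → (EG →L[ℝ] ℝ)}
    {μ : Fin k → (EG →L[ℝ] ℝ)}

include E in
-- The saturation of an open subset is the union of its translates by the isotropy group.
theorem isOpenMap_levelProjection (hJeq : IsEquivariantMomentum G J) :
    IsOpenMap (levelProjection G J μ) := by
  rintro _ ⟨V, hV, rfl⟩
  rw [isOpen_coinduced]
  have : levelProjection G J μ ⁻¹' (levelProjection G J μ '' (Subtype.val ⁻¹' V)) =
      ⋃ g ∈ isotropyGroup G μ, Subtype.val ⁻¹' ((fun x : M => g • x) ⁻¹' V) := by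
    ext y
    simp only [Set.mem_preimage, Set.mem_image, Set.mem_iUnion, exists_prop]
    constructor
    · rintro ⟨z, hz, hzy⟩
      obtain ⟨g, hg, h⟩ := Quotient.exact hzy.symm
      exact ⟨g, hg, by rwa [h]⟩
    · rintro ⟨g, hg, h⟩
      refine ⟨⟨g • (y : M), (smul_mem_level_iff hJeq y.2 g).2 hg⟩, h, Quotient.sound ?_⟩
      exact (levelSetSetoid G J μ).symm ⟨g, hg, rfl⟩
  change IsOpen (levelProjection G J μ ⁻¹' _)
  rw [this]
  exact isOpen_biUnion fun g _ =>
    (hV.preimage (contMDiff_translation EG E M g).continuous).preimage continuous_subtype_val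

/-- The reduced space injects continuously into the orbit space of `G`, which is Hausdorff by
properness. By equivariance, points of the level set in one `G`-orbit are in one isotropy orbit. -/
theorem t2Space_reducedSpace [ProperSMul G M] [IsTopologicalGroup G]
    (hJeq : IsEquivariantMomentum G J) :
    T2Space (ReducedSpace G J μ) := by
  let f : ReducedSpace G J μ → Quotient (MulAction.orbitRel G M) :=
    Quotient.lift (fun x : LevelSet J μ => Quotient.mk (MulAction.orbitRel G M) (x : M)) (by
      rintro x y ⟨g, -, h⟩
      apply Quotient.sound
      exact (MulAction.orbitRel G M).symm ⟨g, h⟩)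
  refine T2Space.of_injective_continuous (f := f) ?_ ?_
  · rintro ⟨x⟩ ⟨y⟩ h
    obtain ⟨g, hg : g • (y : M) = x⟩ := Quotient.exact (s := MulAction.orbitRel G M) h
    apply Quotient.sound
    refine (levelSetSetoid G J μ).symm ⟨g, ?_, hg⟩
    rw [← smul_mem_level_iff hJeq y.2, hg]
    exact x.2
  · exact (continuous_quotient_mk'.comp continuous_subtype_val).quotient_lift _

include E in
theorem secondCountableTopology_reducedSpace [SecondCountableTopology M]
    (hJeq : IsEquivariantMomentum G J) : SecondCountableTopology (ReducedSpace G J μ) :=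
  have : SecondCountableTopology (LevelSet J μ) :=
    TopologicalSpace.Subtype.secondCountableTopology {x | J x = μ}
  (Topology.IsQuotientMap.secondCountableTopology (π := levelProjection G J μ)
    isQuotientMap_quotient_mk' (isOpenMap_levelProjection (E := E) hJeq))

/-- The smooth structures of the level set and of the reduced space, with their dimensions. -/
theorem exists_manifold_structures (hfree : ∀ (g : G) (x : M), g • x = x → g = 1)
    [T2Space M] [ProperSMul G M] [T2Space G]
    (hJ : IsMomentumMap G Ω J) (hJeq : IsEquivariantMomentum G J)
    (hμ : IsRegularValue (E := E) J μ) :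
    ∃ (d e : ℕ)
      (_ : ChartedSpace (EuclideanSpace ℝ (Fin d)) (LevelSet J μ))
      (_ : IsManifold (𝓡 d) ∞ (LevelSet J μ))
      (_ : ChartedSpace (EuclideanSpace ℝ (Fin e)) (ReducedSpace G J μ))
      (_ : IsManifold (𝓡 e) ∞ (ReducedSpace G J μ)),
      IsSmoothEmbedding (𝓡 d) 𝓘(ℝ, E) ∞ (levelInclusion J μ) ∧
      IsSubmersion (𝓡 d) (𝓡 e) ∞ (levelProjection G J μ) ∧
      ∀ _ : LevelSet J μ,
        d + Module.finrank ℝ (Fin k → (EG →L[ℝ] ℝ)) = Module.finrank ℝ E ∧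
        Module.finrank ℝ (lieSubalgebraOf EG (isotropyGroup G μ)) + e = d := by
  have htrans : ∀ x y : LevelSet J μ, levelSetSetoid G J μ x y →
      ∃ h : M → M, ContMDiff 𝓘(ℝ, E) 𝓘(ℝ, E) ∞ h ∧
      (∀ z : LevelSet J μ, ∃ hz : J (h z) = μ, levelSetSetoid G J μ z ⟨h z, hz⟩) ∧ h x = y := by
    rintro x y ⟨g, hg, h⟩
    exact ⟨fun z => g • z, contMDiff_translation EG E M g, fun z =>
      ⟨(smul_mem_level_iff hJeq z.2 g).2 hg, ⟨g, hg, rfl⟩⟩, h⟩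
  have hopen := isOpenMap_levelProjection (E := E) (μ := μ) hJeq
  -- Without a point of the level set there is no surjective derivative from which to count
  -- dimensions. Both models are then taken of dimension `0`, which is why the dimension formulas
  -- are stated conditionally on a point.
  rcases isEmpty_or_nonempty (LevelSet J μ) with hN | ⟨⟨x⟩⟩
  · let l : ((Fin 0 → ℝ) × (Fin 0 → ℝ)) ≃L[ℝ] EuclideanSpace ℝ (Fin 0) :=
      ContinuousLinearEquiv.ofFinrankEq (by simp)
    let l' : (Fin 0 → ℝ) ≃L[ℝ] EuclideanSpace ℝ (Fin 0) :=
      ContinuousLinearEquiv.ofFinrankEq (by simp)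
    let lE : ((Fin 0 → ℝ) × (Fin 0 → ℝ) × E) ≃L[ℝ] E :=
      ContinuousLinearEquiv.ofFinrankEq (by simp)
    obtain ⟨cN, mN, cQ, mQ, h1, h2⟩ := exists_manifold_structures_of_sliceCharts
      (fun x : LevelSet J μ => hN.elim x) htrans hopen l l' lE
    exact ⟨0, 0, cN, mN, cQ, mQ, h1, h2, fun x => hN.elim x⟩
  · set m := Module.finrank ℝ (lieSubalgebraOf EG (isotropyGroup G μ)) with hm
    set w := Module.finrank ℝ (Fin k → (EG →L[ℝ] ℝ)) with hw
    set D := modelDeriv E (Fin k → (EG →L[ℝ] ℝ)) J x with hD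
    have hsurj : Function.Surjective D := hμ x x.2
    have h1 := LinearMap.finrank_range_add_finrank_ker D.toLinearMap
    rw [LinearMap.range_eq_top.2 hsurj, finrank_top] at h1
    -- The isotropy algebra embeds in `ker dJ` through the generators, so the subtraction defining
    -- `e` is not truncated.
    have h2 : m ≤ Module.finrank ℝ (LinearMap.ker D.toLinearMap) := by
      have hinj := generator_injective_of_free (EG := EG) (E := E) hfree (x : M)
      let B : lieSubalgebraOf EG (isotropyGroup G μ) →ₗ[ℝ] LinearMap.ker D.toLinearMap :=
        ((generator EG G E (x : M)).toLinearMap.domRestrict _).codRestrict _ fun ξ =>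
          (mem_lieSubalgebraOf_isotropy_iff hJ hJeq x.2).1 ξ.2
      exact LinearMap.finrank_le_finrank_of_injective (f := B) fun a b h =>
        Subtype.ext (hinj (congrArg Subtype.val h))
    obtain ⟨e, he⟩ : ∃ e, m + e + w = Module.finrank ℝ E :=
      ⟨Module.finrank ℝ (LinearMap.ker D.toLinearMap) - m, by omega⟩
    let l : ((Fin m → ℝ) × (Fin e → ℝ)) ≃L[ℝ] EuclideanSpace ℝ (Fin (m + e)) :=
      ContinuousLinearEquiv.ofFinrankEq (by simp)
    let l' : (Fin e → ℝ) ≃L[ℝ] EuclideanSpace ℝ (Fin e) :=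
      ContinuousLinearEquiv.ofFinrankEq (by simp)
    let lE : ((Fin m → ℝ) × (Fin e → ℝ) × (Fin k → (EG →L[ℝ] ℝ))) ≃L[ℝ] E :=
      ContinuousLinearEquiv.ofFinrankEq (by
        rw [Module.finrank_prod, Module.finrank_prod, ← hw, ← he]
        simp [add_assoc])
    obtain ⟨cN, mN, cQ, mQ, h1, h2⟩ := exists_manifold_structures_of_sliceCharts
      (exists_isSliceChart hfree hJ hJeq hμ e he) htrans hopen l l' lE
    exact ⟨m + e, e, cN, mN, cQ, mQ, h1, h2, fun _ => ⟨he, rfl⟩⟩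

end ReducedSpace

/-! ### Tangent spaces of the level set and of the reduced space -/

section Tangent

variable {EG : Type*} [NormedAddCommGroup EG] [NormedSpace ℝ EG] [FiniteDimensional ℝ EG]
    {G : Type*} [TopologicalSpace G] [ChartedSpace EG G] [Group G]
    [LieGroup 𝓘(ℝ, EG) ∞ G]
    {E : Type*} [NormedAddCommGroup E] [NormedSpace ℝ E] [FiniteDimensional ℝ E]
    {M : Type*} [TopologicalSpace M] [ChartedSpace E M]
    [IsManifold 𝓘(ℝ, E) ∞ M]
    [MulAction G M] [ContMDiffSMul 𝓘(ℝ, EG) 𝓘(ℝ, E) ∞ G M]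
    {k : ℕ} {Ω : Fin k → FormField E M 2} {J : M → Fin k → (EG →L[ℝ] ℝ)}
    {μ : Fin k → (EG →L[ℝ] ℝ)}
    {F F' : Type*} [NormedAddCommGroup F] [NormedSpace ℝ F] [NormedAddCommGroup F']
    [NormedSpace ℝ F'] [FiniteDimensional ℝ F] [FiniteDimensional ℝ F']
    [ChartedSpace F (LevelSet J μ)] [IsManifold 𝓘(ℝ, F) ∞ (LevelSet J μ)]
    [ChartedSpace F' (ReducedSpace G J μ)] [IsManifold 𝓘(ℝ, F') ∞ (ReducedSpace G J μ)]

/-- The tangent space of the level set is the kernel of the derivative of the momentum map. -/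
theorem range_modelDeriv_levelInclusion (hJ : IsMomentumMap G Ω J)
    (hμ : IsRegularValue (E := E) J μ)
    (hj : IsSmoothEmbedding 𝓘(ℝ, F) 𝓘(ℝ, E) ∞ (levelInclusion J μ))
    (hF : Module.finrank ℝ F + Module.finrank ℝ (Fin k → (EG →L[ℝ] ℝ)) = Module.finrank ℝ E)
    (x : LevelSet J μ) :
    LinearMap.range (modelDeriv F E (levelInclusion J μ) x).toLinearMap =
      LinearMap.ker (modelDeriv E (Fin k → (EG →L[ℝ] ℝ)) J x).toLinearMap := by
  apply Submodule.eq_of_le_of_finrank_eq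
  · rintro _ ⟨v, rfl⟩
    rw [LinearMap.mem_ker]
    change modelDeriv E (Fin k → (EG →L[ℝ] ℝ)) J x (modelDeriv F E (levelInclusion J μ) x v) = 0
    rw [← modelDeriv_comp_apply (g := J) (f := levelInclusion J μ) (y := (x : M))
      (hJ.smooth _).mdiffAt (hj.contMDiff x).mdiffAt rfl v]
    have : (fun z => J (levelInclusion J μ z)) = fun _ => μ := funext fun z => z.2
    rw [this, modelDeriv_const]
    rfl
  · rw [LinearMap.finrank_range_of_inj (injective_modelDeriv_of_isImmersion hj.isImmersion x)]
    have h1 := LinearMap.finrank_range_add_finrank_ker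
      (modelDeriv E (Fin k → (EG →L[ℝ] ℝ)) J x).toLinearMap
    have hsurj : Function.Surjective (modelDeriv E (Fin k → (EG →L[ℝ] ℝ)) J x) := hμ x x.2
    rw [LinearMap.range_eq_top.2 hsurj, finrank_top] at h1
    omega

/-- The vertical tangent vectors of the projection are the infinitesimal generators of the
isotropy group. -/
theorem modelDeriv_levelProjection_eq_zero_iff (hfree : ∀ (g : G) (x : M), g • x = x → g = 1)
    [T2Space M] [T2Space G] (hJ : IsMomentumMap G Ω J)
    (hJeq : IsEquivariantMomentum G J)
    (hj : IsSmoothEmbedding 𝓘(ℝ, F) 𝓘(ℝ, E) ∞ (levelInclusion J μ))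
    (hπ : IsSubmersion 𝓘(ℝ, F) 𝓘(ℝ, F') ∞ (levelProjection G J μ))
    (hF : Module.finrank ℝ (lieSubalgebraOf EG (isotropyGroup G μ)) + Module.finrank ℝ F' =
      Module.finrank ℝ F)
    (x : LevelSet J μ) (v : F) :
    modelDeriv F F' (levelProjection G J μ) x v = 0 ↔
      modelDeriv F E (levelInclusion J μ) x v ∈
        (lieSubalgebraOf EG (isotropyGroup G μ)).map (generator EG G E (x : M)).toLinearMap := by
  set P := (modelDeriv F F' (levelProjection G J μ) x).toLinearMap with hP
  set I := (modelDeriv F E (levelInclusion J μ) x).toLinearMap with hI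
  have hIinj : Function.Injective I := injective_modelDeriv_of_isImmersion hj.isImmersion x
  have hgen := generator_injective_of_free (EG := EG) (E := E) hfree (x : M)
  have hle : (lieSubalgebraOf EG (isotropyGroup G μ)).map
      (generator EG G E (x : M)).toLinearMap ≤ (LinearMap.ker P).map I := by
    rintro _ ⟨ξ, hξ, rfl⟩
    obtain ⟨γ, hγ, hmul, hK, hγξ⟩ := exists_oneParameter_isotropy hJ hJeq x.2
      ((mem_lieSubalgebraOf_isotropy_iff hJ hJeq x.2).1 hξ)
    -- This curve in the level set has velocity `ξ_M(x)` in `M` and projects to a single point, so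
    -- the generator is vertical. Equality with the whole vertical space follows by counting
    -- dimensions.
    let c : ℝ → LevelSet J μ := fun t => ⟨γ t • (x : M), (smul_mem_level_iff hJeq x.2 _).2 (hK t)⟩
    have hjc : ContMDiff 𝓘(ℝ, ℝ) 𝓘(ℝ, E) ∞ (levelInclusion J μ ∘ c) :=
      (contMDiff_orbitMap EG E (x : M)).comp hγ
    have hc : ContMDiff 𝓘(ℝ, ℝ) 𝓘(ℝ, F) ∞ c := by
      exact (ContMDiff.iff_comp_isImmersion hj.isImmersion).2
        ⟨hj.isEmbedding.continuous_iff.2 hjc.continuous, hjc⟩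
    have hγ0 := oneParameter_zero hmul
    have hc0 : c 0 = x := Subtype.ext (by simp [c, hγ0])
    refine ⟨modelDeriv ℝ F c 0 1, ?_, ?_⟩
    · rw [SetLike.mem_coe, LinearMap.mem_ker]
      change modelDeriv F F' (levelProjection G J μ) x (modelDeriv ℝ F c 0 1) = 0
      rw [← modelDeriv_comp_apply (g := levelProjection G J μ) (f := c)
        (hπ.contMDiff x).mdiffAt (hc 0).mdiffAt hc0 1]
      have : (fun t => levelProjection G J μ (c t)) = fun _ => levelProjection G J μ x :=
        funext fun t => Quotient.sound ((levelSetSetoid G J μ).symm ⟨γ t, hK t, rfl⟩)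
      rw [this, modelDeriv_const]
      rfl
    · change modelDeriv F E (levelInclusion J μ) x (modelDeriv ℝ F c 0 1) =
        generator EG G E (x : M) ξ
      rw [← modelDeriv_comp_apply (g := levelInclusion J μ) (f := c)
        (hj.contMDiff x).mdiffAt (hc 0).mdiffAt hc0 1, ← hγξ]
      exact modelDeriv_comp_apply (g := fun g : G => g • (x : M)) (f := γ)
        (contMDiff_orbitMap EG E (x : M) 1).mdiffAt (hγ 0).mdiffAt hγ0 1
  have heq : (lieSubalgebraOf EG (isotropyGroup G μ)).map
      (generator EG G E (x : M)).toLinearMap = (LinearMap.ker P).map I := by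
    apply Submodule.eq_of_le_of_finrank_eq hle
    rw [← (Submodule.equivMapOfInjective _ hgen _).finrank_eq,
      ← (Submodule.equivMapOfInjective _ hIinj _).finrank_eq]
    have h1 := LinearMap.finrank_range_add_finrank_ker P
    have hsurj : Function.Surjective P := surjective_modelDeriv_of_isSubmersion hπ x
    rw [LinearMap.range_eq_top.2 hsurj, finrank_top] at h1
    omega
  rw [heq]
  constructor
  · intro h
    exact ⟨v, h, rfl⟩
  · rintro ⟨w, hw, hwv⟩
    rw [← hIinj hwv]
    exact hw

end Tangent

/-! ### Pull-backs of forms to vector spaces -/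

section PullbackForms

variable {E : Type*} [NormedAddCommGroup E] [NormedSpace ℝ E]
  {E' : Type*} [NormedAddCommGroup E'] [NormedSpace ℝ E']
  {E'' : Type*} [NormedAddCommGroup E''] [NormedSpace ℝ E'']
  {M : Type*} [TopologicalSpace M] [ChartedSpace E M] [IsManifold 𝓘(ℝ, E) ∞ M]
  {N : Type*} [TopologicalSpace N] [ChartedSpace E' N] [IsManifold 𝓘(ℝ, E') ∞ N]
  {n : ℕ}

/-- Alternatization as a continuous linear map. -/
def alternatizationCLM (E : Type*) [NormedAddCommGroup E] [NormedSpace ℝ E] (n : ℕ) :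
    ContinuousMultilinearMap ℝ (fun _ : Fin n => E) ℝ →L[ℝ] E [⋀^Fin n]→L[ℝ] ℝ :=
  LinearMap.mkContinuous
    { toFun := ContinuousMultilinearMap.alternatization
      map_add' := map_add _
      map_smul' := fun c f => by
        ext v
        simp only [ContinuousMultilinearMap.alternatization_apply_apply, RingHom.id_apply,
          ContinuousAlternatingMap.smul_apply, _root_.smul_apply,
          Finset.smul_sum]
        exact Finset.sum_congr rfl fun σ _ => smul_comm _ _ _ }
    (Fintype.card (Equiv.Perm (Fin n))) (fun f => by
      refine ContinuousAlternatingMap.opNorm_le_bound _ (by positivity) fun v => ?_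
      change ‖ContinuousMultilinearMap.alternatization f v‖ ≤ _
      rw [ContinuousMultilinearMap.alternatization_apply_apply, mul_assoc]
      refine (norm_sum_le _ _).trans ?_
      rw [← nsmul_eq_mul, ← Finset.card_univ]
      refine Finset.sum_le_card_nsmul _ _ _ fun σ _ => ?_
      have h1 : ‖Equiv.Perm.sign σ • f (v ∘ σ)‖ = ‖f (v ∘ σ)‖ := by
        rcases Int.units_eq_one_or (Equiv.Perm.sign σ) with h | h <;> simp [h]
      rw [h1]
      refine (f.le_opNorm _).trans_eq ?_
      congr 1
      exact Equiv.prod_comp σ fun i => ‖v i‖)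

theorem alternatizationCLM_apply (f : ContinuousMultilinearMap ℝ (fun _ : Fin n => E) ℝ)
    (v : Fin n → E) :
    alternatizationCLM E n f v = ∑ σ : Equiv.Perm (Fin n), Equiv.Perm.sign σ • f (v ∘ σ) :=
  ContinuousMultilinearMap.alternatization_apply_apply f v

/-- For multilinear maps, pull-back is a continuous multilinear function of the linear maps, hence
smooth. Alternatization leads back to alternating forms, at the price of a factor `n!`, which is
divided out. -/
theorem contDiff_compContinuousLinearMap : ContDiff ℝ ∞
    (fun p : (E [⋀^Fin n]→L[ℝ] ℝ) × (E' →L[ℝ] E) => p.1.compContinuousLinearMap p.2) := by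
  have h1 : ContDiff ℝ ∞ (fun p : (E [⋀^Fin n]→L[ℝ] ℝ) × (E' →L[ℝ] E) =>
      ContinuousMultilinearMap.compContinuousLinearMapContinuousMultilinear ℝ
        (fun _ : Fin n => E') (fun _ : Fin n => E) ℝ (fun _ => p.2)
        (ContinuousAlternatingMap.toContinuousMultilinearMapCLM ℝ p.1)) := by
    refine ContDiff.clm_apply ?_ ?_
    · exact (ContinuousMultilinearMap.contDiff _).comp (contDiff_pi.2 fun _ => contDiff_snd)
    · exact (ContinuousLinearMap.contDiff _).comp contDiff_fst
  have h2 := ((alternatizationCLM E' n).contDiff (n := ∞)).comp h1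
  have h3 : (fun p : (E [⋀^Fin n]→L[ℝ] ℝ) × (E' →L[ℝ] E) => p.1.compContinuousLinearMap p.2) =
      fun p => (Nat.factorial n : ℝ)⁻¹ • alternatizationCLM E' n
        (ContinuousMultilinearMap.compContinuousLinearMapContinuousMultilinear ℝ
        (fun _ : Fin n => E') (fun _ : Fin n => E) ℝ (fun _ => p.2)
        (ContinuousAlternatingMap.toContinuousMultilinearMapCLM ℝ p.1)) := by
    funext p
    ext v
    rw [ContinuousAlternatingMap.smul_apply, alternatizationCLM_apply]
    have h : ∀ σ : Equiv.Perm (Fin n), Equiv.Perm.sign σ •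
        (ContinuousMultilinearMap.compContinuousLinearMapContinuousMultilinear ℝ
        (fun _ : Fin n => E') (fun _ : Fin n => E) ℝ (fun _ => p.2)
        (ContinuousAlternatingMap.toContinuousMultilinearMapCLM ℝ p.1)) (v ∘ σ) =
        p.1.compContinuousLinearMap p.2 v := by
      intro σ
      change Equiv.Perm.sign σ • (p.1.compContinuousLinearMap p.2).toAlternatingMap (v ∘ σ) = _
      rw [AlternatingMap.map_perm, smul_smul, Int.units_mul_self, one_smul]
      rfl
    rw [Finset.sum_congr rfl fun σ _ => h σ, Finset.sum_const, Finset.card_univ,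
      Fintype.card_perm, Fintype.card_fin, ← Nat.cast_smul_eq_nsmul ℝ, smul_smul,
      inv_mul_cancel₀ (by positivity), one_smul]
  rw [h3]
  exact h2.const_smul _

/-- A form at a point, on the model space. -/
def FormField.at (α : FormField E M n) (x : M) : E [⋀^Fin n]→L[ℝ] ℝ := α x

variable (E') in
/-- The pull-back of a form at a point, on the model space. -/
def FormField.pullbackAt (f : N → M) (α : FormField E M n) (x : N) : E' [⋀^Fin n]→L[ℝ] ℝ :=
  (α.at (f x)).compContinuousLinearMap (modelDeriv E' E f x)

theorem FormField.pullbackAt_apply (f : N → M) (α : FormField E M n) (x : N) (v : Fin n → E') :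
    α.pullbackAt E' f x v = α.at (f x) (fun i => modelDeriv E' E f x (v i)) := rfl

theorem FormField.pullbackAt_comp {P : Type*} [TopologicalSpace P] [ChartedSpace E'' P]
    [IsManifold 𝓘(ℝ, E'') ∞ P]
    {g : N → M} {f : P → N} {x : P} (hg : MDifferentiableAt 𝓘(ℝ, E') 𝓘(ℝ, E) g (f x))
    (hf : MDifferentiableAt 𝓘(ℝ, E'') 𝓘(ℝ, E') f x) (α : FormField E M n) :
    α.pullbackAt E'' (fun z => g (f z)) x =
      (α.pullbackAt E' g (f x)).compContinuousLinearMap (modelDeriv E'' E' f x) := by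
  ext v
  rw [FormField.pullbackAt_apply, ContinuousAlternatingMap.compContinuousLinearMap_apply,
    FormField.pullbackAt_apply]
  congr 1
  funext i
  exact modelDeriv_comp_apply hg hf rfl (v i)

theorem FormField.pullbackAt_congr {f g : N → M} {x : N} (h : f =ᶠ[𝓝 x] g)
    (α : FormField E M n) : α.pullbackAt E' f x = α.pullbackAt E' g x := by
  ext v
  rw [FormField.pullbackAt_apply, FormField.pullbackAt_apply, modelDeriv_congr h,
    h.self_of_nhds]

/-- Near a point, the pull-back of a form to a vector space is the pull-back of its expression in a
chart. -/
theorem FormField.pullbackAt_eventuallyEq (α : FormField E M n) {f : E' → M} {y : E'}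
    (hf : ∀ᶠ z in 𝓝 y, ContMDiffAt 𝓘(ℝ, E') 𝓘(ℝ, E) ∞ f z) :
    α.pullbackAt E' f =ᶠ[𝓝 y] fun z =>
      (α.inChart (f y) (extChartAt 𝓘(ℝ, E) (f y) (f z))).compContinuousLinearMap
        (fderiv ℝ (fun z => extChartAt 𝓘(ℝ, E) (f y) (f z)) z) := by
  set φ := extChartAt 𝓘(ℝ, E) (f y)
  have hs : ∀ᶠ z in 𝓝 y, f z ∈ φ.source :=
    hf.self_of_nhds.continuousAt.eventually_mem (extChartAt_source_mem_nhds _)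
  filter_upwards [hf, hs.eventually_nhds] with z hfz hsz
  have h1 : f =ᶠ[𝓝 z] fun z => φ.symm (φ (f z)) := by
    filter_upwards [hsz] with w hw
    exact (φ.left_inv hw).symm
  have hz := hsz.self_of_nhds
  have h2 : ContMDiffAt 𝓘(ℝ, E') 𝓘(ℝ, E) ∞ (fun z => φ (f z)) z :=
    ContMDiffAt.comp z (contMDiffAt_extChartAt_self hz) hfz
  rw [FormField.pullbackAt_congr h1,
    FormField.pullbackAt_comp (g := φ.symm) (f := fun z => φ (f z))
      (contMDiffAt_extChartAt_symm_self (φ.map_source hz)).mdiffAt h2.mdiffAt,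
    ← modelDeriv_eq_fderiv]
  rfl

theorem contDiffAt_extChartAt_comp {f : E' → M} {y : E'}
    (hf : ContMDiffAt 𝓘(ℝ, E') 𝓘(ℝ, E) ∞ f y) :
    ContDiffAt ℝ ∞ (fun z => extChartAt 𝓘(ℝ, E) (f y) (f z)) y :=
  contMDiffAt_iff_contDiffAt.1
      (ContMDiffAt.comp y (contMDiffAt_extChartAt_self (mem_extChartAt_source _)) hf)

theorem FormField.IsSmooth.contDiffAt_inChart {α : FormField E M n} (hα : α.IsSmooth) (x : M) :
    ContDiffAt ℝ ∞ (α.inChart x) (extChartAt 𝓘(ℝ, E) x x) :=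
  (hα x).contDiffAt ((isOpen_extChartAt_target _).mem_nhds (mem_extChartAt_target _))

theorem FormField.IsSmooth.contDiffAt_pullbackAt {α : FormField E M n} (hα : α.IsSmooth)
    {f : E' → M} {y : E'} (hf : ∀ᶠ z in 𝓝 y, ContMDiffAt 𝓘(ℝ, E') 𝓘(ℝ, E) ∞ f z) :
    ContDiffAt ℝ ∞ (α.pullbackAt E' f) y := by
  refine ContDiffAt.congr_of_eventuallyEq ?_ (α.pullbackAt_eventuallyEq hf)
  have hy := contDiffAt_extChartAt_comp hf.self_of_nhds
  have h1 : ContDiffAt ℝ ∞ (fun z => (α.inChart (f y) (extChartAt 𝓘(ℝ, E) (f y) (f z)),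
      fderiv ℝ (fun z => extChartAt 𝓘(ℝ, E) (f y) (f z)) z)) y :=
    ContDiffAt.prodMk (ContDiffAt.comp y (hα.contDiffAt_inChart (f y)) hy)
      (hy.fderiv_right (by simp))
  exact ContDiffAt.comp y (contDiff_compContinuousLinearMap (n := n)).contDiffAt h1

/-- In a chart this is the commutation of `d` with pull-back. It serves both local sections of the
projection and parametrizations by the group. -/
theorem FormField.IsClosed.extDeriv_pullbackAt {α : FormField E M n} (hs : α.IsSmooth)
    (hα : α.IsClosed)
    {f : E' → M} {y : E'} (hf : ∀ᶠ z in 𝓝 y, ContMDiffAt 𝓘(ℝ, E') 𝓘(ℝ, E) ∞ f z) :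
    extDeriv (α.pullbackAt E' f) y = 0 := by
  rw [(α.pullbackAt_eventuallyEq hf).extDeriv_eq, _root_.extDeriv_pullback
    (f := fun z => extChartAt 𝓘(ℝ, E) (f y) (f z))
    ((hs.contDiffAt_inChart (f y)).differentiableAt (by simp))
    (contDiffAt_extChartAt_comp hf.self_of_nhds)
    (by simpa using WithTop.coe_le_coe.2 (le_top (a := (2 : ℕ∞)))), hα (f y) _ (mem_extChartAt_target _)]
  ext v
  rfl

end PullbackForms

/-! ### Invariance of closed horizontal one-forms -/

section Invariance

variable {EG : Type*} [NormedAddCommGroup EG] [NormedSpace ℝ EG]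
    {G : Type*} [TopologicalSpace G] [ChartedSpace EG G] [Group G]
    [LieGroup 𝓘(ℝ, EG) ∞ G]
    {E : Type*} [NormedAddCommGroup E] [NormedSpace ℝ E]
    {M : Type*} [TopologicalSpace M] [ChartedSpace E M]
    [IsManifold 𝓘(ℝ, E) ∞ M]
    [MulAction G M] [ContMDiffSMul 𝓘(ℝ, EG) 𝓘(ℝ, E) ∞ G M]

/-- The tangent vectors of an orbit are values of infinitesimal generators. -/
theorem modelDeriv_smul_const_mem_range {B : Type*} [NormedAddCommGroup B] [NormedSpace ℝ B]
    {a : B → G} {t : B} (ha : MDifferentiableAt 𝓘(ℝ, B) 𝓘(ℝ, EG) a t) (y : M) (v : B) :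
    ∃ ξ, modelDeriv B E (fun t => a t • y) t v = generator EG G E (a t • y) ξ := by
  -- Right translation makes the group curve pass through `1`, while the base point becomes `a t •
  -- y`.
  have h1 : MDifferentiableAt 𝓘(ℝ, B) 𝓘(ℝ, EG) (fun s => a s * (a t)⁻¹) t :=
    MDifferentiableAt.comp t (I' := 𝓘(ℝ, EG)) (g := fun g : G => g * (a t)⁻¹)
      ((contMDiff_mul_right (I := 𝓘(ℝ, EG)) (n := ∞) (a := (a t)⁻¹)) (a t)).mdiffAt ha
  have h2 := modelDeriv_smul_curve (E := E) (b := fun _ => a t • y) h1 mdifferentiableAt_const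
    (mul_inv_cancel _) v
  rw [modelDeriv_const] at h2
  refine ⟨_, Eq.trans ?_ (h2.trans (add_zero _))⟩
  congr 2
  funext s
  rw [smul_smul, inv_mul_cancel_right]

/-- A closed one-form vanishing on the infinitesimal generators is invariant under a connected
group. -/
theorem FormField.invariant_of_isClosed_of_horizontal [ConnectedSpace G]
    {α : FormField E M 1} (hs : α.IsSmooth) (hc : α.IsClosed)
    (hα : ∀ (x : M) (ξ : EG), α.at x ![generator EG G E x ξ] = 0) (g : G) (x : M) (v : E) :
    α.at (g • x) ![modelDeriv E E (fun y : M => g • y) x v] = α.at x ![v] := by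
  let f : G → ℝ := fun g => α.at (g • x) ![modelDeriv E E (fun y : M => g • y) x v]
  suffices h : ∀ g, MDifferentiableAt 𝓘(ℝ, EG) 𝓘(ℝ, ℝ) f g ∧ modelDeriv EG ℝ f g = 0 by
    have h1 : IsLocallyConstant f :=
      isLocallyConstant_of_modelDeriv_eq_zero (fun g => (h g).1) fun g => (h g).2
    have h2 : f g = f 1 := h1.apply_eq_of_preconnectedSpace g 1
    refine h2.trans ?_
    simp only [f]
    have h3 : (fun y : M => (1 : G) • y) = fun y => y := funext fun y => one_smul G y
    rw [h3, modelDeriv_id, one_smul]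
    rfl
  intro g₀
  set φ := extChartAt 𝓘(ℝ, EG) g₀ with hφ
  set ψ := extChartAt 𝓘(ℝ, E) x with hψ
  set v' : E := modelDeriv E E ψ x v with hv'
  -- Pulling `α` back by the action in coordinates turns invariance into the vanishing of a
  -- derivative in the group direction.
  let F : EG × E → M := fun p => φ.symm p.1 • ψ.symm p.2
  have hφt : ∀ᶠ p in 𝓝 (φ g₀, ψ x), p ∈ φ.target ×ˢ ψ.target :=
    ((isOpen_extChartAt_target _).prod (isOpen_extChartAt_target _)).mem_nhds
      ⟨mem_extChartAt_target _, mem_extChartAt_target _⟩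
  have hFsm : ∀ p ∈ φ.target ×ˢ ψ.target, ContMDiffAt 𝓘(ℝ, EG × E) 𝓘(ℝ, E) ∞ F p := by
    intro p hp
    have h1 : ContMDiffAt 𝓘(ℝ, EG × E) 𝓘(ℝ, EG) ∞ (fun p : EG × E => φ.symm p.1) p :=
      ContMDiffAt.comp p (contMDiffAt_extChartAt_symm_self hp.1)
        contDiff_fst.contMDiff.contMDiffAt
    have h2 : ContMDiffAt 𝓘(ℝ, EG × E) 𝓘(ℝ, E) ∞ (fun p : EG × E => ψ.symm p.2) p :=
      ContMDiffAt.comp p (contMDiffAt_extChartAt_symm_self hp.2)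
        contDiff_snd.contMDiff.contMDiffAt
    exact ContMDiffAt.comp p (contMDiff_action EG G E M _) (h1.prodMk h2)
  have hF : ∀ᶠ p in 𝓝 (φ g₀, ψ x), ContMDiffAt 𝓘(ℝ, EG × E) 𝓘(ℝ, E) ∞ F p :=
    hφt.mono hFsm
  set β := α.pullbackAt (EG × E) F with hβ
  have hβsm : ContDiffAt ℝ ∞ β (φ g₀, ψ x) := hs.contDiffAt_pullbackAt hF
  have hβd : DifferentiableAt ℝ β (φ g₀, ψ x) := hβsm.differentiableAt (by simp)
  have hdβ : extDeriv β (φ g₀, ψ x) = 0 := hc.extDeriv_pullbackAt hs hF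
  have hvert : ∀ w : EG, (fun p => β p ![(w, (0 : E))]) =ᶠ[𝓝 (φ g₀, ψ x)] fun _ => 0 := by
    intro w
    filter_upwards [hφt] with p hp
    rw [hβ, FormField.pullbackAt_apply]
    have h1 : modelDeriv (EG × E) E F p (w, 0) =
        modelDeriv EG E (fun u => φ.symm u • ψ.symm p.2) p.1 w := by
      have h2 : HasFDerivAt (fun u : EG => (u, p.2)) (ContinuousLinearMap.inl ℝ EG E) p.1 :=
        hasFDerivAt_prodMk_left p.1 p.2
      have h3 := modelDeriv_comp_apply (g := F) (f := fun u : EG => (u, p.2)) (x := p.1) (y := p)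
        (hFsm p hp).mdiffAt h2.differentiableAt.mdifferentiableAt rfl w
      rw [modelDeriv_eq_fderiv (fun u : EG => (u, p.2)), h2.fderiv] at h3
      exact h3.symm
    obtain ⟨ξ, hξ⟩ := modelDeriv_smul_const_mem_range (E := E)
      (contMDiffAt_extChartAt_symm_self hp.1).mdiffAt (ψ.symm p.2) w
    have h4 : (fun i => modelDeriv (EG × E) E F p ((![(w, (0 : E))] : Fin 1 → EG × E) i)) =
        ![generator EG G E (F p) ξ] := by
      funext i
      fin_cases i
      exact h1.trans hξ
    rw [h4]
    exact hα _ ξ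
  let f' : EG → ℝ := fun u => β (u, ψ x) ![((0 : EG), v')]
  let b : EG × E → ℝ := fun p => β p ![((0 : EG), v')]
  have hb : DifferentiableAt ℝ b (φ g₀, ψ x) := by
    exact hβd.continuousAlternatingMap_apply_const _
  -- Cartan's formula in coordinates: `dβ` on `(w, 0)` and `(0, v')` is the derivative of `β (0,
  -- v')` along `w` minus that of `β (w, 0)` along `v'`. The latter vanishes by horizontality, the
  -- former because `β` is closed.
  have hb0 : ∀ w, fderiv ℝ b (φ g₀, ψ x) (w, 0) = 0 := by
    intro w
    have h1 := extDeriv_apply hβd ![(w, (0 : E)), ((0 : EG), v')]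
    rw [hdβ, Fin.sum_univ_two] at h1
    have h2 : (fun p => β p (Fin.removeNth 0 ![(w, (0 : E)), ((0 : EG), v')])) = b := by
      funext p
      simp only [b]
      congr 1
    have h3 : (fun p => β p (Fin.removeNth 1 ![(w, (0 : E)), ((0 : EG), v')])) =
        fun p => β p ![(w, (0 : E))] := by
      funext p
      congr 1
      funext i
      fin_cases i
      rfl
    rw [h2, h3, (hvert w).fderiv_eq] at h1
    simpa using h1.symm
  have hf' : HasFDerivAt f' (0 : EG →L[ℝ] ℝ) (φ g₀) := by
    have h1 := HasFDerivAt.comp (φ g₀) (g := b) (f := fun u : EG => (u, ψ x)) hb.hasFDerivAt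
      (hasFDerivAt_prodMk_left (φ g₀) (ψ x))
    refine h1.congr_fderiv ?_
    ext w
    exact hb0 w
  -- At the fixed point `x`, evaluating `β` on `(0, v')` gives `α` on the translate of `v` by `g`.
  have hff' : f =ᶠ[𝓝 g₀] fun g => f' (φ g) := by
    filter_upwards [extChartAt_source_mem_nhds (I := 𝓘(ℝ, EG)) g₀] with g hg
    simp only [f, f', hβ, FormField.pullbackAt_apply]
    have hx : ψ.symm (ψ x) = x := ψ.left_inv (mem_extChartAt_source _)
    have hFp : F (φ g, ψ x) = g • x := by
      simp only [F, φ.left_inv hg, hx]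
    rw [hFp]
    congr 1
    funext i
    fin_cases i
    change modelDeriv E E (fun y : M => g • y) x v = modelDeriv (EG × E) E F (φ g, ψ x) (0, v')
    have h2 : HasFDerivAt (fun u : E => (φ g, u)) (ContinuousLinearMap.inr ℝ EG E) (ψ x) :=
      hasFDerivAt_prodMk_right (φ g) (ψ x)
    have h3 := modelDeriv_comp_apply (g := F) (f := fun u : E => (φ g, u)) (x := ψ x)
      (y := (φ g, ψ x))
      (hFsm _ ⟨φ.map_source hg, mem_extChartAt_target _⟩).mdiffAt
      h2.differentiableAt.mdifferentiableAt rfl v'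
    rw [modelDeriv_eq_fderiv (fun u : E => (φ g, u)), h2.fderiv] at h3
    refine Eq.trans ?_ h3
    have h4 : (fun u : E => F (φ g, u)) = fun u => (fun y : M => g • y) (ψ.symm u) := by
      funext u
      simp only [F, φ.left_inv hg]
    rw [h4, modelDeriv_comp_apply (g := fun y : M => g • y) (f := ψ.symm) (y := x)
      (contMDiff_translation EG E M g x).mdiffAt
      (contMDiffAt_extChartAt_symm_self (mem_extChartAt_target _)).mdiffAt hx, hv',
      modelDeriv_extChartAt_symm_apply (mem_extChartAt_source x)]
  have hcomp : MDifferentiableAt 𝓘(ℝ, EG) 𝓘(ℝ, ℝ) (fun g => f' (φ g)) g₀ :=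
    MDifferentiableAt.comp g₀ (I' := 𝓘(ℝ, EG)) hf'.differentiableAt.mdifferentiableAt
      (contMDiffAt_extChartAt_self (mem_extChartAt_source _)).mdiffAt
  refine ⟨hcomp.congr_of_eventuallyEq hff', ?_⟩
  rw [modelDeriv_congr hff', modelDeriv_comp (g := f') (f := φ)
    hf'.differentiableAt.mdifferentiableAt
    (contMDiffAt_extChartAt_self (mem_extChartAt_source _)).mdiffAt rfl,
    modelDeriv_eq_fderiv, hf'.fderiv]
  simp

end Invariance

/-! ### Descent of forms along submersions -/

section Descent

/-- Each argument splits as `R (D v) + (v - R (D v))`, with the second summand in `ker D`. In the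
multilinear expansion only the term free of second summands survives. -/
theorem ContinuousAlternatingMap.eq_comp_of_vanishing {F F' : Type*} [NormedAddCommGroup F]
    [NormedSpace ℝ F] [NormedAddCommGroup F'] [NormedSpace ℝ F'] {n : ℕ}
    (P : F [⋀^Fin n]→L[ℝ] ℝ) (D : F →L[ℝ] F') (R : F' →L[ℝ] F) (hR : ∀ v, D (R v) = v)
    (hP : ∀ v : Fin n → F, ∀ i, D (v i) = 0 → P v = 0) :
    P = (P.compContinuousLinearMap R).compContinuousLinearMap D := by
  classical
  ext v
  change P v = P fun i => R (D (v i))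
  have h1 : v = (fun i => R (D (v i))) + fun i => v i - R (D (v i)) := by
    funext i
    simp
  have h2 := P.toMultilinearMap.map_add_univ (fun i => R (D (v i))) (fun i => v i - R (D (v i)))
  rw [← h1] at h2
  refine h2.trans ?_
  rw [Finset.sum_eq_single Finset.univ]
  · rw [Finset.piecewise_univ]
    rfl
  · intro s _ hs
    obtain ⟨i, hi⟩ : ∃ i, i ∉ s := by
      by_contra! h
      exact hs (Finset.eq_univ_of_forall h)
    refine hP _ i ?_
    rw [Finset.piecewise_eq_of_notMem _ _ _ hi, map_sub, hR, sub_self]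
  · intro h
    exact absurd (Finset.mem_univ _) h

variable {E : Type*} [NormedAddCommGroup E] [NormedSpace ℝ E]
    {M : Type*} [TopologicalSpace M] [ChartedSpace E M] [IsManifold 𝓘(ℝ, E) ∞ M]
    {F : Type*} [NormedAddCommGroup F] [NormedSpace ℝ F] [FiniteDimensional ℝ F]
    {N : Type*} [TopologicalSpace N] [ChartedSpace F N] [IsManifold 𝓘(ℝ, F) ∞ N]
    {F' : Type*} [NormedAddCommGroup F'] [NormedSpace ℝ F'] [FiniteDimensional ℝ F']
    {Q : Type*} [TopologicalSpace Q] [ChartedSpace F' Q] [IsManifold 𝓘(ℝ, F') ∞ Q]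
    {n : ℕ} {j : N → M} {p : N → Q}

/-- A form whose pull-back is invariant under the transitive symmetries of the fibres of a
submersion and vanishes on vertical vectors descends. -/
theorem FormField.exists_descent (hp : IsSubmersion 𝓘(ℝ, F) 𝓘(ℝ, F') ∞ p)
    (hsurj : Function.Surjective p) (α : FormField E M n)
    (hvert : ∀ (x : N) (v : Fin n → F) (i : Fin n), modelDeriv F F' p x (v i) = 0 →
      α.pullbackAt F j x v = 0)
    (hinv : ∀ x y : N, p x = p y → ∃ T : N → N, MDifferentiableAt 𝓘(ℝ, F) 𝓘(ℝ, F) T x ∧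
      T x = y ∧ (∀ z, p (T z) = p z) ∧
      (α.pullbackAt F j y).compContinuousLinearMap (modelDeriv F F T x) = α.pullbackAt F j x) :
    ∃ αr : FormField F' Q n, ∀ x, αr.pullbackAt F p x = α.pullbackAt F j x := by
  have hR : ∀ x : N, ∃ R : F' →L[ℝ] F, ∀ v, modelDeriv F F' p x (R v) = v := by
    intro x
    obtain ⟨R, hR⟩ := LinearMap.exists_rightInverse_of_surjective
      (modelDeriv F F' p x).toLinearMap
      (LinearMap.range_eq_top.2 (surjective_modelDeriv_of_isSubmersion hp x))
    exact ⟨R.toContinuousLinearMap, fun v => LinearMap.congr_fun hR v⟩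
  choose R hR using hR
  choose s hs using hsurj
  -- The value at `q` uses an arbitrary point of the fibre and an arbitrary right inverse of `dp`
  -- there. Vertical vanishing removes the dependence on the right inverse, the symmetries `T` that
  -- on the point.
  let A : Q → F' [⋀^Fin n]→L[ℝ] ℝ := fun q =>
    (α.pullbackAt F j (s q)).compContinuousLinearMap (R (s q))
  refine ⟨fun q => A q, fun x => ?_⟩
  change (A (p x)).compContinuousLinearMap (modelDeriv F F' p x) = _
  obtain ⟨T, hT, hTx, hpT, hPT⟩ := hinv (s (p x)) x (hs (p x))
  have h1 := (α.pullbackAt F j x).eq_comp_of_vanishing _ (R x) (hR x) (hvert x)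
  set S := (α.pullbackAt F j x).compContinuousLinearMap (R x)
  have h2 : A (p x) = S := by
    simp only [A]
    rw [← hPT, h1]
    ext v
    simp only [ContinuousAlternatingMap.compContinuousLinearMap_apply, Function.comp_def]
    congr 1
    funext i
    have h3 := modelDeriv_comp_apply (g := p) (f := T) (hp.contMDiff x).mdiffAt hT hTx
      (R (s (p x)) (v i))
    have h4 : (fun z => p (T z)) = p := funext hpT
    rw [h4, hR] at h3
    exact h3.symm
  rw [h2, ← h1]

/-- For a local section `σ` of `p`, the descended form is locally the pull-back of `α` by `j ∘ σ`.
Smoothness and closedness are thus inherited from `α`. -/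
theorem FormField.inChart_eventuallyEq_of_descent (hp : IsSubmersion 𝓘(ℝ, F) 𝓘(ℝ, F') ∞ p)
    (hsurj : Function.Surjective p) (hj : ContMDiff 𝓘(ℝ, F) 𝓘(ℝ, E) ∞ j) {α : FormField E M n}
    {αr : FormField F' Q n} (h : ∀ x, αr.pullbackAt F p x = α.pullbackAt F j x) (c : Q) {z₀ : F'}
    (hz : z₀ ∈ (extChartAt 𝓘(ℝ, F') c).target) :
    ∃ f : F' → M, (∀ᶠ z in 𝓝 z₀, ContMDiffAt 𝓘(ℝ, F') 𝓘(ℝ, E) ∞ f z) ∧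
      αr.inChart c =ᶠ[𝓝 z₀] α.pullbackAt F' f := by
  set φ := extChartAt 𝓘(ℝ, F') c
  obtain ⟨x₀, hx₀⟩ := hsurj (φ.symm z₀)
  obtain ⟨σ, -, hσ, hpσ⟩ := exists_section_of_isSubmersion hp x₀
  rw [hx₀] at hσ hpσ
  have hφ : ∀ z ∈ φ.target, ContMDiffAt 𝓘(ℝ, F') 𝓘(ℝ, F') ∞ φ.symm z := fun z hz =>
    contMDiffAt_extChartAt_symm_self hz
  have htgt : ∀ᶠ z in 𝓝 z₀, z ∈ φ.target := (isOpen_extChartAt_target _).mem_nhds hz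
  have hσ' : ∀ᶠ z in 𝓝 z₀, ContMDiffAt 𝓘(ℝ, F') 𝓘(ℝ, F) ∞ (fun z => σ (φ.symm z)) z := by
    filter_upwards [htgt, (hφ z₀ hz).continuousAt.eventually hσ] with z h1 h2
    exact ContMDiffAt.comp z h2 (hφ z h1)
  refine ⟨fun z => j (σ (φ.symm z)), ?_, ?_⟩
  · filter_upwards [hσ'] with z h1
    exact ContMDiffAt.comp z (hj _) h1
  · have hpσ' : ∀ᶠ z in 𝓝 z₀, φ.symm z = p (σ (φ.symm z)) :=
      ((hφ z₀ hz).continuousAt.eventually hpσ).mono fun z h => h.symm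
    filter_upwards [hσ', hpσ'.eventually_nhds] with z h1 h2
    have h3 : αr.inChart c z = αr.pullbackAt F' φ.symm z := rfl
    rw [h3, FormField.pullbackAt_congr h2,
      FormField.pullbackAt_comp (g := p) (f := fun z => σ (φ.symm z)) (hp.contMDiff _).mdiffAt
        h1.mdiffAt, h,
      ← FormField.pullbackAt_comp (g := j) (f := fun z => σ (φ.symm z)) (hj _).mdiffAt h1.mdiffAt]

theorem FormField.isSmooth_of_descent (hp : IsSubmersion 𝓘(ℝ, F) 𝓘(ℝ, F') ∞ p)
    (hsurj : Function.Surjective p) (hj : ContMDiff 𝓘(ℝ, F) 𝓘(ℝ, E) ∞ j) {α : FormField E M n}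
    (hα : α.IsSmooth)
    {αr : FormField F' Q n} (h : ∀ x, αr.pullbackAt F p x = α.pullbackAt F j x) :
    αr.IsSmooth := by
  intro c z hz
  obtain ⟨f, hf, heq⟩ := FormField.inChart_eventuallyEq_of_descent hp hsurj hj h c hz
  exact ((hα.contDiffAt_pullbackAt hf).congr_of_eventuallyEq heq).contDiffWithinAt

theorem FormField.isClosed_of_descent (hp : IsSubmersion 𝓘(ℝ, F) 𝓘(ℝ, F') ∞ p)
    (hsurj : Function.Surjective p) (hj : ContMDiff 𝓘(ℝ, F) 𝓘(ℝ, E) ∞ j) {α : FormField E M n}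
    (hα : α.IsSmooth) (hαc : α.IsClosed)
    {αr : FormField F' Q n} (h : ∀ x, αr.pullbackAt F p x = α.pullbackAt F j x) :
    αr.IsClosed := by
  intro c z hz
  obtain ⟨f, hf, heq⟩ := FormField.inChart_eventuallyEq_of_descent hp hsurj hj h c hz
  rw [heq.extDeriv_eq]
  exact hαc.extDeriv_pullbackAt hα hf

theorem FormField.eq_of_pullbackAt_eq (hp : IsSubmersion 𝓘(ℝ, F) 𝓘(ℝ, F') ∞ p)
    (hsurj : Function.Surjective p) {α β : FormField F' Q n}
    (h : ∀ x, α.pullbackAt F p x = β.pullbackAt F p x) : α = β := by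
  funext q
  obtain ⟨x, rfl⟩ := hsurj q
  suffices h' : α.at (p x) = β.at (p x) from h'
  ext v
  choose w hw using fun i => surjective_modelDeriv_of_isSubmersion hp x (v i)
  have h1 := congrArg (fun A : F [⋀^Fin n]→L[ℝ] ℝ => A w) (h x)
  simpa only [FormField.pullbackAt_apply, hw] using h1

end Descent

/-! ### Linear polycosymplectic reduction -/

section PolycosymplecticSpaces

variable {V : Type*} [NormedAddCommGroup V] [NormedSpace ℝ V] {k : ℕ}
  {Ω : Fin k → V [⋀^Fin 2]→L[ℝ] ℝ} {η : Fin k → V [⋀^Fin 1]→L[ℝ] ℝ}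

theorem ContinuousAlternatingMap.apply_pair_swap (A : V [⋀^Fin 2]→L[ℝ] ℝ) (v w : V) :
    A ![v, w] = -A ![w, v] := by
  have h := A.toAlternatingMap.map_swap ![w, v] (i := 0) (j := 1) (by decide)
  rw [← ContinuousAlternatingMap.coe_toAlternatingMap, ← h]
  congr 1
  funext i
  fin_cases i <;> rfl

theorem mem_commonKernel_iff (v : V) : v ∈ commonKernel Ω ↔ ∀ a w, Ω a ![v, w] = 0 :=
  ⟨fun h a w => h a w trivial, fun h a w _ => h a w⟩

theorem commonKernel_le_polyOrthogonal (S : Submodule ℝ V) :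
    commonKernel Ω ≤ polyOrthogonal Ω S := fun _ h a s _ => h a s trivial

/-- The values of a family of one-forms. -/
def oneFormsMap (η : Fin k → V [⋀^Fin 1]→L[ℝ] ℝ) : V →ₗ[ℝ] Fin k → ℝ where
  toFun v a := η a ![v]
  map_add' v w := by
    funext a
    have h := (η a).map_update_add ![0] 0 v w
    simp only [Matrix.vecCons, Fin.update_cons_zero] at h
    exact h
  map_smul' c v := by
    funext a
    have h := (η a).map_update_smul ![0] 0 c v
    simp only [Matrix.vecCons, Fin.update_cons_zero] at h
    exact h

theorem oneFormsMap_apply (v : V) (a : Fin k) : oneFormsMap η v a = η a ![v] := rfl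

/-- On preimages of the standard basis the wedge product is the determinant of the identity matrix.
-/
theorem wedgeOneForms_ne_zero_of_surjective (h : Function.Surjective (oneFormsMap η)) :
    wedgeOneForms η ≠ 0 := by
  choose v hv using fun a : Fin k => h (Pi.single a 1)
  intro h0
  have h1 : wedgeOneForms η v = 1 := by
    have h2 : (fun b => oneFormsMap η (v b)) = (1 : Matrix (Fin k) (Fin k) ℝ) := by
      funext b c
      rw [hv, Matrix.one_apply, Pi.single_apply]
      simp only [eq_comm]
    change Matrix.det (fun b => oneFormsMap η (v b)) = 1
    rw [h2, Matrix.det_one]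
  rw [h0] at h1
  exact zero_ne_one h1

variable [FiniteDimensional ℝ V]

/-- The one-forms are jointly injective on the common kernel, whose dimension is `k`; hence they
identify it with `ℝ^k`. -/
theorem IsPolycosymplecticSpace.exists_mem_commonKernel (h : IsPolycosymplecticSpace Ω η)
    (c : Fin k → ℝ) : ∃ r ∈ commonKernel Ω, oneFormsMap η r = c := by
  have hinj : Function.Injective ((oneFormsMap η).domRestrict (commonKernel Ω)) := by
    rw [injective_iff_map_eq_zero]
    intro r hr
    exact Subtype.ext (h.ker_inter_ker r r.2 fun a => congrFun hr a)
  have hsurj := (LinearMap.injective_iff_surjective_of_finrank_eq_finrank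
    (by rw [h.finrank_ker, Module.finrank_fin_fun])).1 hinj
  obtain ⟨r, hr⟩ := hsurj c
  exact ⟨r, r.2, hr⟩

/-- The Reeb vectors are the basis of the common kernel dual to the one-forms. -/
theorem IsPolycosymplecticSpace.reebSpan_eq (h : IsPolycosymplecticSpace Ω η) :
    reebSpan Ω η = commonKernel Ω := by
  apply le_antisymm
  · refine Submodule.span_le.2 ?_
    rintro r ⟨a, hr⟩
    exact (mem_commonKernel_iff r).2 fun b w => (hr b).1 w
  · intro v hv
    choose r hr hrη using fun a : Fin k => h.exists_mem_commonKernel (Pi.single a 1)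
    have h1 : v - ∑ a, oneFormsMap η v a • r a = 0 := by
      refine h.ker_inter_ker _ (sub_mem hv (sum_mem fun a _ => Submodule.smul_mem _ _ (hr a)))
        fun b => ?_
      rw [← oneFormsMap_apply, map_sub, map_sum]
      simp [hrη, Pi.single_apply]
    rw [sub_eq_zero.1 h1]
    refine sum_mem fun a _ => Submodule.smul_mem _ _ (Submodule.subset_span ⟨a, fun b => ⟨?_, ?_⟩⟩)
    · exact (mem_commonKernel_iff _).1 (hr a) b
    · rw [← oneFormsMap_apply, hrη, Pi.single_apply]
      simp only [eq_comm]

variable {F F' : Type*} [NormedAddCommGroup F] [NormedSpace ℝ F]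
  [NormedAddCommGroup F'] [NormedSpace ℝ F'] [FiniteDimensional ℝ F']

/-- Linear polycosymplectic reduction. -/
theorem IsPolycosymplecticSpace.reduced_iff (h : IsPolycosymplecticSpace Ω η)
    {O H : Submodule ℝ V} (hO : ∀ v ∈ O, oneFormsMap η v = 0) (hHO : H ≤ O)
    (I : F →ₗ[ℝ] V) (P : F →ₗ[ℝ] F') (hP : Function.Surjective P)
    (hI : LinearMap.range I = polyOrthogonal Ω O)
    (hIP : ∀ v, P v = 0 ↔ I v ∈ H) (hH : H ≤ LinearMap.range I)
    {Ω' : Fin k → F' [⋀^Fin 2]→L[ℝ] ℝ} {η' : Fin k → F' [⋀^Fin 1]→L[ℝ] ℝ}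
    (hω : ∀ a v w, Ω' a ![P v, P w] = Ω a ![I v, I w])
    (hη : ∀ v, oneFormsMap η' (P v) = oneFormsMap η (I v)) :
    IsPolycosymplecticSpace Ω' η' ↔ Disjoint (reebSpan Ω η) H ∧
      reebSpan Ω η ⊔ H = polyOrthogonal Ω O ⊓ polyOrthogonal Ω (polyOrthogonal Ω O) := by
  rw [h.reebSpan_eq, ← hI]
  -- Directness of the sum is automatic: on `H` the one-forms vanish, and in the common kernel only
  -- `0` is killed by all of them.
  have hdisj : Disjoint (commonKernel Ω) H := by
    rw [Submodule.disjoint_def]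
    intro v hv hvH
    exact h.ker_inter_ker v hv fun a => congrFun (hO v (hHO hvH)) a
  have hle : commonKernel Ω ⊔ H ≤
      LinearMap.range I ⊓ polyOrthogonal Ω (LinearMap.range I) := by
    refine sup_le (le_inf ?_ (commonKernel_le_polyOrthogonal _)) (le_inf hH ?_)
    · rw [hI]
      exact commonKernel_le_polyOrthogonal _
    · intro v hv a s hs
      rw [hI] at hs
      rw [ContinuousAlternatingMap.apply_pair_swap, hs a v (hHO hv), neg_zero]
  -- The reduced common kernel is the image of the radical of the restricted two-forms.
  have hker : ∀ v, P v ∈ commonKernel Ω' ↔ I v ∈ polyOrthogonal Ω (LinearMap.range I) := by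
    intro v
    rw [mem_commonKernel_iff]
    constructor
    · rintro hv a _ ⟨w, rfl⟩
      rw [← hω]
      exact hv a _
    · intro hv a w
      obtain ⟨w, rfl⟩ := hP w
      rw [hω]
      exact hv a _ ⟨w, rfl⟩
  -- The Reeb span lies in the orthogonal of every subspace, so it lifts through `I` and projects
  -- into the reduced common kernel with its one-form values intact.
  have hlift : ∀ c, ∃ w, I w ∈ commonKernel Ω ∧ P w ∈ commonKernel Ω' ∧
      oneFormsMap η (I w) = c := by
    intro c
    obtain ⟨r, hr, hrc⟩ := h.exists_mem_commonKernel c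
    obtain ⟨w, rfl⟩ : r ∈ LinearMap.range I := by
      rw [hI]
      exact commonKernel_le_polyOrthogonal _ hr
    exact ⟨w, hr, (hker w).2 (commonKernel_le_polyOrthogonal _ hr), hrc⟩
  constructor
  · intro h'
    refine ⟨hdisj, le_antisymm hle ?_⟩
    rintro _ ⟨⟨v, rfl⟩, hv⟩
    obtain ⟨w, hw, hw', hwη⟩ := hlift (oneFormsMap η (I v))
    -- Subtracting a Reeb vector with the same one-form values leaves a vector of the reduced kernel
    -- killed by all reduced one-forms. It is zero, so the difference is vertical.
    have h1 : P (v - w) = 0 := by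
      refine h'.ker_inter_ker _ ?_ fun a => ?_
      · rw [map_sub]
        exact sub_mem ((hker v).2 hv) hw'
      · rw [← oneFormsMap_apply, hη, map_sub, map_sub, hwη, sub_self]
        rfl
    rw [hIP, map_sub] at h1
    rw [← add_sub_cancel (I w) (I v)]
    exact Submodule.add_mem_sup hw h1
  · rintro ⟨-, heq⟩
    -- A lift splits into a Reeb part and a vertical part. The vertical part does not affect the
    -- one-forms, so the Reeb part vanishes.
    have hinj : ∀ v ∈ commonKernel Ω', (∀ a, η' a ![v] = 0) → v = 0 := by
      intro v hv hv0
      obtain ⟨v, rfl⟩ := hP v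
      have h1 : I v ∈ commonKernel Ω ⊔ H := by
        rw [heq]
        exact ⟨⟨v, rfl⟩, (hker v).1 hv⟩
      obtain ⟨r, hr, s, hs, hrs⟩ := Submodule.mem_sup.1 h1
      have h2 : oneFormsMap η (I v) = 0 := by
        rw [← hη]
        exact funext hv0
      rw [← hrs, map_add, hO s (hHO hs), add_zero] at h2
      have h3 : r = 0 := h.ker_inter_ker r hr fun a => congrFun h2 a
      rw [hIP, ← hrs, h3, zero_add]
      exact hs
    have hsurj : Function.Surjective ((oneFormsMap η').domRestrict (commonKernel Ω')) := by
      intro c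
      obtain ⟨w, -, hw, hc⟩ := hlift c
      exact ⟨⟨P w, hw⟩, (hη w).trans hc⟩
    refine ⟨wedgeOneForms_ne_zero_of_surjective fun c => ?_, hinj, ?_⟩
    · obtain ⟨w, hw⟩ := hsurj c
      exact ⟨w, hw⟩
    · have hbij : Function.Bijective ((oneFormsMap η').domRestrict (commonKernel Ω')) := by
        refine ⟨?_, hsurj⟩
        rw [injective_iff_map_eq_zero]
        intro r hr
        exact Subtype.ext (hinj r r.2 fun a => congrFun hr a)
      rw [(LinearEquiv.ofBijective _ hbij).finrank_eq, Module.finrank_fin_fun]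

end PolycosymplecticSpaces

/-! ### Reduction of the forms on the manifold -/

section Reduction

variable {EG : Type*} [NormedAddCommGroup EG] [NormedSpace ℝ EG] [FiniteDimensional ℝ EG]
    {G : Type*} [TopologicalSpace G] [ChartedSpace EG G] [Group G]
    [LieGroup 𝓘(ℝ, EG) ∞ G]
    {E : Type*} [NormedAddCommGroup E] [NormedSpace ℝ E] [FiniteDimensional ℝ E]
    {M : Type*} [TopologicalSpace M] [ChartedSpace E M]
    [IsManifold 𝓘(ℝ, E) ∞ M]
    [MulAction G M] [ContMDiffSMul 𝓘(ℝ, EG) 𝓘(ℝ, E) ∞ G M]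
    {k : ℕ} {Ω : Fin k → FormField E M 2} {η : Fin k → FormField E M 1}
    {J : M → Fin k → (EG →L[ℝ] ℝ)}
    {μ : Fin k → (EG →L[ℝ] ℝ)}
    {F F' : Type*} [NormedAddCommGroup F] [NormedSpace ℝ F] [NormedAddCommGroup F']
    [NormedSpace ℝ F'] [FiniteDimensional ℝ F] [FiniteDimensional ℝ F']
    [ChartedSpace F (LevelSet J μ)] [IsManifold 𝓘(ℝ, F) ∞ (LevelSet J μ)]
    [ChartedSpace F' (ReducedSpace G J μ)] [IsManifold 𝓘(ℝ, F') ∞ (ReducedSpace G J μ)]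
    {n : ℕ}

omit [FiniteDimensional ℝ EG] in
theorem surjective_levelProjection : Function.Surjective (levelProjection G J μ) :=
  Quotient.mk_surjective

theorem areReducedForms_iff {Ωr : Fin k → FormField F' (ReducedSpace G J μ) 2}
    {ηr : Fin k → FormField F' (ReducedSpace G J μ) 1} :
    AreReducedForms G (F := F) J μ Ω η Ωr ηr ↔
      (∀ a x, (Ωr a).pullbackAt F (levelProjection G J μ) x =
        (Ω a).pullbackAt F (levelInclusion J μ) x) ∧
      ∀ a x, (ηr a).pullbackAt F (levelProjection G J μ) x =
        (η a).pullbackAt F (levelInclusion J μ) x :=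
  and_congr (forall_congr' fun _ => funext_iff) (forall_congr' fun _ => funext_iff)

/-- Invariant forms that vanish on the orbits of the isotropy group descend to the reduced
space. -/
theorem exists_reducedForm (hJeq : IsEquivariantMomentum G J)
    (hj : IsSmoothEmbedding 𝓘(ℝ, F) 𝓘(ℝ, E) ∞ (levelInclusion J μ))
    (hπ : IsSubmersion 𝓘(ℝ, F) 𝓘(ℝ, F') ∞ (levelProjection G J μ))
    (α : FormField E M n)
    (hinv : ∀ (g : G) (x : M), α.pullbackAt E (fun y : M => g • y) x = α.at x)
    (hvert : ∀ (x : LevelSet J μ) (v : Fin n → F) (i : Fin n),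
      modelDeriv F F' (levelProjection G J μ) x (v i) = 0 →
      α.pullbackAt F (levelInclusion J μ) x v = 0) :
    ∃ αr : FormField F' (ReducedSpace G J μ) n, ∀ x,
      αr.pullbackAt F (levelProjection G J μ) x = α.pullbackAt F (levelInclusion J μ) x := by
  refine FormField.exists_descent hπ surjective_levelProjection α hvert fun x y hxy => ?_
  obtain ⟨g, hg, hgxy⟩ := Quotient.exact hxy
  -- Translation by an isotropy element restricts to the level set; it is smooth there because its
  -- composite with the embedding is.
  let T : LevelSet J μ → LevelSet J μ := fun z =>
    ⟨g • (z : M), (smul_mem_level_iff hJeq z.2 g).2 hg⟩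
  have hjT : ContMDiff 𝓘(ℝ, F) 𝓘(ℝ, E) ∞ (levelInclusion J μ ∘ T) :=
    (contMDiff_translation EG E M g).comp hj.contMDiff
  have hT : ContMDiff 𝓘(ℝ, F) 𝓘(ℝ, F) ∞ T :=
    (ContMDiff.iff_comp_isImmersion hj.isImmersion).2
      ⟨hj.isEmbedding.continuous_iff.2 hjT.continuous, hjT⟩
  have hTx : T x = y := Subtype.ext hgxy
  refine ⟨T, (hT x).mdiffAt, hTx,
    fun z => Quotient.sound ((levelSetSetoid G J μ).symm ⟨g, hg, rfl⟩), ?_⟩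
  subst hTx
  rw [← FormField.pullbackAt_comp (g := levelInclusion J μ) (f := T)
    (hj.contMDiff (T x)).mdiffAt (hT x).mdiffAt]
  have h1 : (fun z => levelInclusion J μ (T z)) =
      fun z => (fun y : M => g • y) (levelInclusion J μ z) := rfl
  rw [h1, FormField.pullbackAt_comp (g := fun y : M => g • y) (f := levelInclusion J μ)
    (contMDiff_translation EG E M g _).mdiffAt (hj.contMDiff x).mdiffAt, hinv]
  rfl

/-- The pairing of `v` with `ξ_M(x)` under the two-forms is, up to sign, `dJ v` evaluated at `ξ`.
All pairings vanish exactly when `dJ v` does. -/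
theorem IsMomentumMap.polyOrthogonal_orbitTangent (hJ : IsMomentumMap G Ω J) (x : M) :
    polyOrthogonal (fun a => (Ω a).at x) (LinearMap.range (generator EG G E x).toLinearMap) =
      LinearMap.ker (modelDeriv E (Fin k → (EG →L[ℝ] ℝ)) J x).toLinearMap := by
  have key : ∀ v a ξ, (Ω a).at x ![v, generator EG G E x ξ] =
      -modelDeriv E (Fin k → (EG →L[ℝ] ℝ)) J x v a ξ := by
    intro v a ξ
    rw [ContinuousAlternatingMap.apply_pair_swap, hJ.modelDeriv_apply]
    rfl
  ext v
  rw [LinearMap.mem_ker]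
  constructor
  · intro h
    funext a
    ext ξ
    have := h a _ ⟨ξ, rfl⟩
    refine neg_eq_zero.1 ((key v a ξ).symm.trans this)
  · rintro h a _ ⟨ξ, rfl⟩
    refine (key v a ξ).trans ?_
    have : modelDeriv E (Fin k → (EG →L[ℝ] ℝ)) J x v = 0 := h
    rw [this]
    simp

end Reduction

section Reduction

variable {EG : Type*} [NormedAddCommGroup EG] [NormedSpace ℝ EG] [FiniteDimensional ℝ EG]
    {G : Type*} [TopologicalSpace G] [T2Space G] [ChartedSpace EG G] [Group G]
    [LieGroup 𝓘(ℝ, EG) ∞ G]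
    {E : Type*} [NormedAddCommGroup E] [NormedSpace ℝ E] [FiniteDimensional ℝ E]
    {M : Type*} [TopologicalSpace M] [T2Space M] [ChartedSpace E M]
    [IsManifold 𝓘(ℝ, E) ∞ M]
    [MulAction G M] [ContMDiffSMul 𝓘(ℝ, EG) 𝓘(ℝ, E) ∞ G M]
    {k : ℕ} {Ω : Fin k → FormField E M 2} {η : Fin k → FormField E M 1}
    {J : M → Fin k → (EG →L[ℝ] ℝ)}
    {μ : Fin k → (EG →L[ℝ] ℝ)}
    {F F' : Type*} [NormedAddCommGroup F] [NormedSpace ℝ F] [NormedAddCommGroup F']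
    [NormedSpace ℝ F'] [FiniteDimensional ℝ F] [FiniteDimensional ℝ F']
    [ChartedSpace F (LevelSet J μ)] [IsManifold 𝓘(ℝ, F) ∞ (LevelSet J μ)]
    [ChartedSpace F' (ReducedSpace G J μ)] [IsManifold 𝓘(ℝ, F') ∞ (ReducedSpace G J μ)]

/-- This is linear reduction with `I` and `P` the derivatives of the inclusion and of the
projection, so that `range I` is the tangent space of the level set and `H` is the vertical space.
-/
theorem isPolycosymplecticSpace_reduced_iff (hfree : ∀ (g : G) (x : M), g • x = x → g = 1)
    (hM : IsPolycosymplectic Ω η) (hG : IsPolycosymplecticAction EG G Ω η)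
    (hJ : IsMomentumMap G Ω J) (hJeq : IsEquivariantMomentum G J)
    (hμ : IsRegularValue (E := E) J μ)
    (hj : IsSmoothEmbedding 𝓘(ℝ, F) 𝓘(ℝ, E) ∞ (levelInclusion J μ))
    (hπ : IsSubmersion 𝓘(ℝ, F) 𝓘(ℝ, F') ∞ (levelProjection G J μ))
    (hd : Module.finrank ℝ F + Module.finrank ℝ (Fin k → (EG →L[ℝ] ℝ)) = Module.finrank ℝ E)
    (he : Module.finrank ℝ (lieSubalgebraOf EG (isotropyGroup G μ)) + Module.finrank ℝ F' =
      Module.finrank ℝ F)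
    {Ωr : Fin k → FormField F' (ReducedSpace G J μ) 2}
    {ηr : Fin k → FormField F' (ReducedSpace G J μ) 1}
    (h : AreReducedForms G (F := F) J μ Ω η Ωr ηr) (x : LevelSet J μ) :
    IsPolycosymplecticSpace (fun a => Ωr a (levelProjection G J μ x))
        (fun a => ηr a (levelProjection G J μ x)) ↔
      Disjoint (reebSpan (fun a => Ω a (x : M)) (fun a => η a (x : M)))
        (isotropyOrbitTangent (G := G) μ (x : M)) ∧
      reebSpan (fun a => Ω a (x : M)) (fun a => η a (x : M)) ⊔
          isotropyOrbitTangent (G := G) μ (x : M) =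
        polyOrthogonal (fun a => Ω a (x : M)) (orbitTangent EG G (x : M)) ⊓
          polyOrthogonal (fun a => Ω a (x : M))
            (polyOrthogonal (fun a => Ω a (x : M)) (orbitTangent EG G (x : M))) := by
  obtain ⟨hΩr, hηr⟩ := areReducedForms_iff.1 h
  have hP : IsPolycosymplecticSpace (fun a => (Ω a).at (x : M)) (fun a => (η a).at (x : M)) :=
    hM.pointwise x
  have hker := range_modelDeriv_levelInclusion hJ hμ hj hd x
  refine hP.reduced_iff (V := E) (F := F) (F' := F')
    (O := LinearMap.range (generator EG G E (x : M)).toLinearMap)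
    (H := (lieSubalgebraOf EG (isotropyGroup G μ)).map (generator EG G E (x : M)).toLinearMap)
    ?_ LinearMap.map_le_range
    (modelDeriv F E (levelInclusion J μ) x).toLinearMap
    (modelDeriv F F' (levelProjection G J μ) x).toLinearMap
    (surjective_modelDeriv_of_isSubmersion hπ x) ?_ ?_ ?_
    (Ω' := fun a => (Ωr a).at (levelProjection G J μ x))
    (η' := fun a => (ηr a).at (levelProjection G J μ x)) ?_ ?_
  · rintro _ ⟨ξ, rfl⟩
    exact funext fun a => hG.horizontal a ξ x
  · rw [hJ.polyOrthogonal_orbitTangent]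
    exact hker
  · exact modelDeriv_levelProjection_eq_zero_iff hfree hJ hJeq hj hπ he x
  · rw [hker]
    rintro _ ⟨ξ, hξ, rfl⟩
    exact (mem_lieSubalgebraOf_isotropy_iff hJ hJeq x.2).1 hξ
  · intro a v w
    have h1 := congrArg (fun A : F [⋀^Fin 2]→L[ℝ] ℝ => A ![v, w]) (hΩr a x)
    simp only [FormField.pullbackAt_apply] at h1
    refine Eq.trans ?_ (h1.trans ?_) <;> congr 1 <;> funext i <;> fin_cases i <;> rfl
  · intro v
    funext a
    have h1 := congrArg (fun A : F [⋀^Fin 1]→L[ℝ] ℝ => A ![v]) (hηr a x)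
    simp only [FormField.pullbackAt_apply] at h1
    refine Eq.trans ?_ (h1.trans ?_)
    · rw [oneFormsMap_apply]
      congr 1
      funext i
      fin_cases i
      rfl
    · rw [oneFormsMap_apply]
      congr 1
      funext i
      fin_cases i
      rfl

/-- Vertical vectors are values of generators. The two-forms vanish on them because tangent vectors
of the level set are orthogonal to orbits, the one-forms by horizontality. Connectedness is needed
only for the invariance of the one-forms. -/
theorem exists_reducedForms [ConnectedSpace G] (hfree : ∀ (g : G) (x : M), g • x = x → g = 1)
    (hM : IsPolycosymplectic Ω η) (hG : IsPolycosymplecticAction EG G Ω η)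
    (hJ : IsMomentumMap G Ω J) (hJeq : IsEquivariantMomentum G J)
    (hμ : IsRegularValue (E := E) J μ)
    (hj : IsSmoothEmbedding 𝓘(ℝ, F) 𝓘(ℝ, E) ∞ (levelInclusion J μ))
    (hπ : IsSubmersion 𝓘(ℝ, F) 𝓘(ℝ, F') ∞ (levelProjection G J μ))
    (hdim : ∀ _ : LevelSet J μ,
      Module.finrank ℝ F + Module.finrank ℝ (Fin k → (EG →L[ℝ] ℝ)) = Module.finrank ℝ E ∧
      Module.finrank ℝ (lieSubalgebraOf EG (isotropyGroup G μ)) + Module.finrank ℝ F' =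
        Module.finrank ℝ F) :
    ∃ (Ωr : Fin k → FormField F' (ReducedSpace G J μ) 2)
      (ηr : Fin k → FormField F' (ReducedSpace G J μ) 1),
      (∀ a, (Ωr a).IsSmooth ∧ (Ωr a).IsClosed ∧ (ηr a).IsSmooth ∧ (ηr a).IsClosed) ∧
      AreReducedForms G (F := F) J μ Ω η Ωr ηr := by
  have hvert : ∀ (x : LevelSet J μ) (v : F), modelDeriv F F' (levelProjection G J μ) x v = 0 →
      ∃ ξ, generator EG G E (x : M) ξ = modelDeriv F E (levelInclusion J μ) x v := by
    intro x v hv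
    obtain ⟨ξ, -, hξ⟩ :=
      (modelDeriv_levelProjection_eq_zero_iff hfree hJ hJeq hj hπ (hdim x).2 x v).1 hv
    exact ⟨ξ, hξ⟩
  have hΩv : ∀ (a : Fin k) (x : LevelSet J μ) (ξ : EG) (w : F), (Ω a).at (x : M)
      ![generator EG G E (x : M) ξ, modelDeriv F E (levelInclusion J μ) x w] = 0 := by
    intro a x ξ w
    have h1 : modelDeriv F E (levelInclusion J μ) x w ∈
        LinearMap.range (modelDeriv F E (levelInclusion J μ) x).toLinearMap := ⟨w, rfl⟩
    rw [range_modelDeriv_levelInclusion hJ hμ hj (hdim x).1 x,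
      ← hJ.polyOrthogonal_orbitTangent] at h1
    rw [ContinuousAlternatingMap.apply_pair_swap, neg_eq_zero]
    exact h1 a _ ⟨ξ, rfl⟩
  have hΩr : ∀ a, ∃ αr : FormField F' (ReducedSpace G J μ) 2, ∀ x,
      αr.pullbackAt F (levelProjection G J μ) x =
        (Ω a).pullbackAt F (levelInclusion J μ) x := by
    intro a
    refine exists_reducedForm hJeq hj hπ (Ω a) (fun g x => congrFun (hG.invariant a g) x) ?_
    intro x v i hv
    obtain ⟨ξ, hξ⟩ := hvert x (v i) hv
    rw [FormField.pullbackAt_apply]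
    have h2 : (fun i => modelDeriv F E (levelInclusion J μ) x (v i)) =
        ![modelDeriv F E (levelInclusion J μ) x (v 0),
          modelDeriv F E (levelInclusion J μ) x (v 1)] := by
      funext i
      fin_cases i <;> rfl
    rw [h2]
    match i, hξ with
    | 0, hξ =>
      rw [← hξ]
      exact hΩv a x ξ (v 1)
    | 1, hξ =>
      rw [← hξ, ContinuousAlternatingMap.apply_pair_swap, neg_eq_zero]
      exact hΩv a x ξ (v 0)
  have hηr : ∀ a, ∃ αr : FormField F' (ReducedSpace G J μ) 1, ∀ x,
      αr.pullbackAt F (levelProjection G J μ) x =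
        (η a).pullbackAt F (levelInclusion J μ) x := by
    intro a
    have hhor : ∀ (x : M) (ξ : EG), (η a).at x ![generator EG G E x ξ] = 0 :=
      fun x ξ => hG.horizontal a ξ x
    have hone : ∀ {B : Type _} (v : Fin 1 → B), v = ![v 0] := fun v => by
      funext i
      fin_cases i
      rfl
    refine exists_reducedForm hJeq hj hπ (η a) (fun g x => ?_) ?_
    · ext v
      rw [FormField.pullbackAt_apply, hone v,
        ← FormField.invariant_of_isClosed_of_horizontal (hM.smooth_one a) (hM.closed_one a) hhor g]
      congr 1
      exact hone _
    · intro x v i hv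
      obtain ⟨ξ, hξ⟩ := hvert x (v i) hv
      rw [FormField.pullbackAt_apply, hone (fun i => modelDeriv F E (levelInclusion J μ) x (v i))]
      rw [Subsingleton.elim i 0] at hξ
      rw [← hξ]
      exact hhor _ ξ
  choose Ωr hΩr using hΩr
  choose ηr hηr using hηr
  have hs := surjective_levelProjection (G := G) (J := J) (μ := μ)
  exact ⟨Ωr, ηr, fun a => ⟨FormField.isSmooth_of_descent hπ hs hj.contMDiff (hM.smooth_two a)
      (hΩr a),
    FormField.isClosed_of_descent hπ hs hj.contMDiff (hM.smooth_two a) (hM.closed_two a) (hΩr a),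
    FormField.isSmooth_of_descent hπ hs hj.contMDiff (hM.smooth_one a) (hηr a),
    FormField.isClosed_of_descent hπ hs hj.contMDiff (hM.smooth_one a) (hM.closed_one a) (hηr a)⟩,
    areReducedForms_iff.2 ⟨hΩr, hηr⟩⟩

end Reduction

end

/-- Polycosymplectic reduction. The level set and the reduced space carry smooth structures that
make the inclusion a smooth embedding and the projection a submersion (properties which determine
these structures); forms on the reduced space are determined by their defining relations; and there
is a polycosymplectic structure satisfying these relations if and only if the pointwise
condition holds along the level set. -/
theorem theorem3
    {EG : Type*} [NormedAddCommGroup EG] [NormedSpace ℝ EG] [FiniteDimensional ℝ EG]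
    {G : Type*} [TopologicalSpace G] [T2Space G] [ConnectedSpace G] [ChartedSpace EG G] [Group G]
    [LieGroup 𝓘(ℝ, EG) ∞ G]
    {E : Type*} [NormedAddCommGroup E] [NormedSpace ℝ E] [FiniteDimensional ℝ E]
    {M : Type*} [TopologicalSpace M] [T2Space M] [SecondCountableTopology M] [ChartedSpace E M]
    [IsManifold 𝓘(ℝ, E) ∞ M]
    [MulAction G M] [ContMDiffSMul 𝓘(ℝ, EG) 𝓘(ℝ, E) ∞ G M] [ProperSMul G M]
    (hfree : ∀ (g : G) (x : M), g • x = x → g = 1)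
    {k : ℕ} (Ω : Fin k → FormField E M 2) (η : Fin k → FormField E M 1)
    (hM : IsPolycosymplectic Ω η) (hG : IsPolycosymplecticAction EG G Ω η)
    (J : M → Fin k → (EG →L[ℝ] ℝ)) (hJ : IsMomentumMap G Ω J)
    (hJeq : IsEquivariantMomentum G J)
    (μ : Fin k → (EG →L[ℝ] ℝ)) (hμ : IsRegularValue (E := E) J μ) :
    ∃ (d e : ℕ)
      (_ : ChartedSpace (EuclideanSpace ℝ (Fin d)) (LevelSet J μ))
      (_ : IsManifold (𝓡 d) ∞ (LevelSet J μ))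
      (_ : ChartedSpace (EuclideanSpace ℝ (Fin e)) (ReducedSpace G J μ))
      (_ : IsManifold (𝓡 e) ∞ (ReducedSpace G J μ)),
      T2Space (ReducedSpace G J μ) ∧
      SecondCountableTopology (ReducedSpace G J μ) ∧
      IsSmoothEmbedding (𝓡 d) 𝓘(ℝ, E) ∞ (levelInclusion J μ) ∧
      IsSubmersion (𝓡 d) (𝓡 e) ∞ (levelProjection G J μ) ∧
      (∀ (Ω₁ Ω₂ : Fin k → FormField (EuclideanSpace ℝ (Fin e)) (ReducedSpace G J μ) 2)
          (η₁ η₂ : Fin k → FormField (EuclideanSpace ℝ (Fin e)) (ReducedSpace G J μ) 1),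
          AreReducedForms G (F := EuclideanSpace ℝ (Fin d)) J μ Ω η Ω₁ η₁ →
          AreReducedForms G (F := EuclideanSpace ℝ (Fin d)) J μ Ω η Ω₂ η₂ →
          Ω₁ = Ω₂ ∧ η₁ = η₂) ∧
      ((∃ (Ωr : Fin k → FormField (EuclideanSpace ℝ (Fin e)) (ReducedSpace G J μ) 2)
          (ηr : Fin k → FormField (EuclideanSpace ℝ (Fin e)) (ReducedSpace G J μ) 1),
          IsPolycosymplectic Ωr ηr ∧
          AreReducedForms G (F := EuclideanSpace ℝ (Fin d)) J μ Ω η Ωr ηr) ↔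
        ∀ x : M, J x = μ →
          Disjoint (reebSpan (fun a => Ω a x) (fun a => η a x))
            (isotropyOrbitTangent (G := G) μ x) ∧
          reebSpan (fun a => Ω a x) (fun a => η a x) ⊔ isotropyOrbitTangent (G := G) μ x =
            polyOrthogonal (fun a => Ω a x) (orbitTangent EG G x) ⊓
              polyOrthogonal (fun a => Ω a x)
                (polyOrthogonal (fun a => Ω a x) (orbitTangent EG G x))) := by
  obtain ⟨d, e, cN, mN, cQ, mQ, hj, hπ, hdim⟩ := exists_manifold_structures hfree hJ hJeq hμ
  have hdim' : LevelSet J μ → Module.finrank ℝ (EuclideanSpace ℝ (Fin d)) +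
      Module.finrank ℝ (Fin k → (EG →L[ℝ] ℝ)) = Module.finrank ℝ E ∧
      Module.finrank ℝ (lieSubalgebraOf EG (isotropyGroup G μ)) +
        Module.finrank ℝ (EuclideanSpace ℝ (Fin e)) =
        Module.finrank ℝ (EuclideanSpace ℝ (Fin d)) := by
    simpa only [finrank_euclideanSpace_fin] using hdim
  have : IsTopologicalGroup G := topologicalGroup_of_lieGroup 𝓘(ℝ, EG) ∞
  refine ⟨d, e, cN, mN, cQ, mQ, t2Space_reducedSpace hJeq,
    secondCountableTopology_reducedSpace (E := E) hJeq, hj, hπ, ?_, ?_⟩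
  · intro Ω₁ Ω₂ η₁ η₂ h₁ h₂
    rw [areReducedForms_iff] at h₁ h₂
    exact ⟨funext fun a => FormField.eq_of_pullbackAt_eq hπ surjective_levelProjection fun x =>
        (h₁.1 a x).trans (h₂.1 a x).symm,
      funext fun a => FormField.eq_of_pullbackAt_eq hπ surjective_levelProjection fun x =>
        (h₁.2 a x).trans (h₂.2 a x).symm⟩
  · have hpt := fun (Ωr : Fin k → FormField (EuclideanSpace ℝ (Fin e)) (ReducedSpace G J μ) 2)
        (ηr : Fin k → FormField (EuclideanSpace ℝ (Fin e)) (ReducedSpace G J μ) 1)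
        (h : AreReducedForms G (F := EuclideanSpace ℝ (Fin d)) J μ Ω η Ωr ηr)
        (x : LevelSet J μ) => isPolycosymplecticSpace_reduced_iff hfree hM hG hJ hJeq hμ hj hπ
          (hdim' x).1 (hdim' x).2 h x
    -- These forms exist, smooth and closed, without the pointwise condition; only nondegeneracy at
    -- each point remains to be compared.
    obtain ⟨Ωr, ηr, hsm, hr⟩ := exists_reducedForms hfree hM hG hJ hJeq hμ hj hπ hdim'
    constructor
    · rintro ⟨Ω', η', hP, h⟩ x hx
      exact (hpt Ω' η' h ⟨x, hx⟩).1 (hP.pointwise _)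
    · intro h
      refine ⟨Ωr, ηr, ⟨fun a => (hsm a).1, fun a => (hsm a).2.1, fun a => (hsm a).2.2.1,
        fun a => (hsm a).2.2.2, fun q => ?_⟩, hr⟩
      obtain ⟨x, rfl⟩ := surjective_levelProjection (J := J) (μ := μ) q
      exact (hpt Ωr ηr hr x).2 (h x x.2)
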